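/- Let $\mathbb K$ be a field of characteristic $0$ (for example $\mathbb C$), let $\hbar\in\mathbb K$, $\hbar\neq0$ (for example $\hbar\in\mathbb C^*$, or a formal variable with $\mathbb K=\mathbb C((\hbar))$), let $n\ge 1$ be an integer, and let $w$ be a formal parameter. All objects are formal series in $w$ and operators act on $\mathbb K((z^{-1}))[[w]]$. Put $$U=\frac1\hbar\,\frac{z^n}{1-wz},\qquad V'(z)=\hbar\int_0^zU=\sum_{k\ge0}\frac{w^kz^{k+n+1}}{k+n+1},\qquad V(z)=\int_0^zV',\qquad \chi=w^{n+1}\hbar .$$ For $k\ge1$ let $$\Phi_k^U(z)=\frac1{\sqrt{2\pi}}\int_{\mathbb R}d\varphi\,\Bigl(z+\frac{\varphi}{\sqrt{U(z)}}\Bigr)^{k-1}e^{-\frac{\varphi^2}{2}-\sum_{j\ge3}\frac{U^{(j-2)}(z)}{j!\,U(z)^{j/2}}\varphi^j},$$ understood as a perturbative Gaussian integral, and let $\mathcal W_U$ be the $w$-adic closure of the $\mathbb K[[w]]$-span of the $\Phi^U_k$. Let $X_U$ be multiplication by $V'(z)$ and $$\tilde Q_U=z+\frac1{U}\frac{\partial}{\partial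 z}-\frac{U'}{2U^2},\qquad F(z)=\frac1{w^{n+1}}\sum_{k=1}^\infty\frac{(-\chi w)^k}{k}B_k\Bigl(\frac12-\frac z\chi\Bigr)\in\mathbb K[z]((w)),$$ where $B_k$ are the Bernoulli polynomials ($B_k(x+1)-B_k(x)=kx^{k-1}$). Then the series defining the $\Phi_k^U$ converge formally (for each coefficient in $w$ and $z$ the partial sums are eventually constant), and there is exactly one invertible operator $G_U$ with $$G_U-1\in z^{-1}\mathbb K[[z^{-1}]][[w]][[\tfrac{\partial}{\partial z}]],\qquad G_U\cdot\mathbb K[z][[w]]=\mathcal W_U .$$ The canonical Kac–Schwarz (quantum spectral curve) operator $P_U:=G_U\frac{\partial}{\partial z}G_U^{-1}$ is $$P_U=\frac1\hbar\Bigl(F(\tilde Q_U)-\frac1{w^{n+1}}\sum_{k=1}^n\frac{(w\tilde Q_U)^k}{k}-X_U\Bigr),$$ where $F(z)-w^{-n-1}\sum_{k=1}^n\frac{(wz)^k}{k}$ lies in $\mathbb K[z][[w]]$ and is evaluated at $z=\tilde Q_U$. Equivalently, let $S_0=zV'-V$, $S_1=-\frac12\log V''$, let $\hat x$ be multiplication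 by $x=V'(z)$ and $\hat y=\hbar\frac{\partial}{\partial x}=\frac{\hbar}{V''(z)}\frac{\partial}{\partial z}$, acting on the space of formal expressions $e^{S_0/\hbar+S_1}f$, $f\in\mathbb K((z^{-1}))[[w]]$. Then for every $f\in\mathbb K((z^{-1}))[[w]]$, with $\tilde f=e^{S_0/\hbar+S_1}f$, $$P_U\cdot f=0\iff e^{w^{n+1}\hat x+\sum_{k=1}^n\frac{w^k}{k}\hat y^k}\Bigl(1-w\hat y-\frac{\chi w}2\Bigr)\cdot\tilde f=\tilde f .$$ There is a unique element $\Psi_U\in\mathcal W_U$ (the wave function) with $\Psi_U-1\in z^{-1}\mathbb K[[z^{-1}]][[w]]$, and the modified wave function $\tilde\Psi_U=e^{S_0/\hbar+S_1}\Psi_U$ satisfies $$e^{w^{n+1}\hat x+\sum_{k=1}^n\frac{w^k}{k}\hat y^k}\Bigl(1-w\hat y-\frac{\chi w}2\Bigr)\cdot\tilde\Psi_U=\tilde\Psi_U .$$ -/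

import Mathlib

namespace DeformedGKM

noncomputable section

open Filter

section Space

variable (𝕜 : Type*) [Field 𝕜]

/-- The space `𝕜((z⁻¹))[[w]]` in which everything happens. The inner variable of the Laurent
series is `z⁻¹`, so that the coefficient with index `i` is the coefficient of `z ^ (-i)`; the outer
power series variable is the deformation parameter `w`. -/
abbrev Space : Type _ := PowerSeries (LaurentSeries 𝕜)

/-- Additive operators on `𝕜((z⁻¹))[[w]]`; the product is composition. -/
abbrev Op : Type _ := AddMonoid.End (Space 𝕜)

/-- The coordinate `z` as an element of `𝕜((z⁻¹))`. -/
def zL : LaurentSeries 𝕜 := HahnSeries.single (-1 : ℤ) (1 : 𝕜)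

/-- The coordinate `z` as an element of `𝕜((z⁻¹))[[w]]`. -/
def z : Space 𝕜 := PowerSeries.C (zL 𝕜)

/-- The deformation parameter `w` as an element of `𝕜((z⁻¹))[[w]]`. -/
def w : Space 𝕜 := PowerSeries.X

variable {𝕜} in
/-- The constant `c` as an element of `𝕜((z⁻¹))[[w]]`. -/
def cst (c : 𝕜) : Space 𝕜 := PowerSeries.C (HahnSeries.C c)

/-- The operator `∂/∂z` on `𝕜((z⁻¹))[[w]]`, acting on each coefficient in `w`. On `𝕜((z⁻¹))`, with
`t = z⁻¹`, it is `- t² d/dt`. -/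
def dz : Op 𝕜 where
  toFun f := PowerSeries.mk fun m =>
    -(HahnSeries.single (2 : ℤ) (1 : 𝕜) * LaurentSeries.derivative 𝕜 (PowerSeries.coeff m f))
  map_zero' := by ext1 m; simp
  map_add' f g := by ext1 m; simp [mul_add, add_comm]

variable {𝕜}

theorem coeff_dz (m : ℕ) (f : Space 𝕜) :
    PowerSeries.coeff m (dz 𝕜 f) =
      -(HahnSeries.single (2 : ℤ) (1 : 𝕜) * LaurentSeries.derivative 𝕜 (PowerSeries.coeff m f)) :=
  PowerSeries.coeff_mk m fun m =>
    -(HahnSeries.single (2 : ℤ) (1 : 𝕜) * LaurentSeries.derivative 𝕜 (PowerSeries.coeff m f))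

/-- The operator of multiplication by `g`. -/
def mulOp : Space 𝕜 →+* Op 𝕜 := Module.toAddMonoidEnd (Space 𝕜) (Space 𝕜)

theorem mulOp_apply (g f : Space 𝕜) : mulOp g f = g * f := rfl

/-- `u 0 + u 1 + u 2 + ⋯ = s` in the sense of formal series: each coefficient of the partial sums,
in `w` and in `z`, is eventually constant and equal to the one of `s`. -/
def FormalHasSum (u : ℕ → Space 𝕜) (s : Space 𝕜) : Prop :=
  ∀ (m : ℕ) (i : ℤ), ∀ᶠ N in atTop,
    (PowerSeries.coeff m (∑ k ∈ Finset.range N, u k)).coeff i = (PowerSeries.coeff m s).coeff i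

open scoped Classical in
/-- The sum of a formally convergent series (and `0` if the series does not converge). -/
def formalSum (u : ℕ → Space 𝕜) : Space 𝕜 :=
  if h : ∃ s, FormalHasSum u s then h.choose else 0

/-- `u 0 + u 1 + ⋯ = A` as operators, pointwise in the sense of formal series. -/
def OpHasSum (u : ℕ → Op 𝕜) (A : Op 𝕜) : Prop :=
  ∀ f, FormalHasSum (fun k => u k f) (A f)

end Space

section Grassmannian

variable (𝕜 : Type*) [Field 𝕜]

/-- `H₊[[w]] = 𝕜[z][[w]]`: only nonnegative powers of `z` occur. -/
def HPlus : Set (Space 𝕜) :=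
  {f | ∀ (m : ℕ) (i : ℤ), 0 < i → (PowerSeries.coeff m f).coeff i = 0}

/-- `H₋[[w]] = z⁻¹ 𝕜[[z⁻¹]][[w]]`: only negative powers of `z` occur. -/
def HMinus : Set (Space 𝕜) :=
  {f | ∀ (m : ℕ) (i : ℤ), i ≤ 0 → (PowerSeries.coeff m f).coeff i = 0}

variable {𝕜}

/-- The point of the Grassmannian with basis `Φ 0, Φ 1, …` over `𝕜[[w]]`: the `w`-adic closure of
the `𝕜[[w]]`-span of the `Φ k`. -/
def closedSpan (Φ : ℕ → Space 𝕜) : Set (Space 𝕜) :=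
  {f | ∀ N : ℕ, ∃ c : ℕ →₀ PowerSeries 𝕜,
    w 𝕜 ^ N ∣ f - c.sum fun k a => PowerSeries.map HahnSeries.C a * Φ k}

/-- `G - 1` lies in `𝒟₋ = H₋[[w]][[∂/∂z]]`: there are `a k ∈ H₋[[w]]` with
`G = 1 + ∑ k, a k (∂/∂z) ^ k`. -/
def IsMonicOrderZero (G : Op 𝕜) : Prop :=
  ∃ a : ℕ → Space 𝕜, (∀ k, a k ∈ HMinus 𝕜) ∧ OpHasSum (fun k => mulOp (a k) * dz 𝕜 ^ k) (G - 1)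

/-- `G` is the Sato group element of `W`: `G ∈ 1 + 𝒟₋` and `G · H₊ = W`. -/
def IsSatoGroupElement (W : Set (Space 𝕜)) (G : (Op 𝕜)ˣ) : Prop :=
  IsMonicOrderZero (G : Op 𝕜) ∧ (fun f => (G : Op 𝕜) f) '' HPlus 𝕜 = W

/-- The canonical Kac-Schwarz operator `P = G (∂/∂z) G⁻¹` (quantum spectral curve operator) of the
point with Sato group element `G`. -/
def canonicalP (G : (Op 𝕜)ˣ) : Op 𝕜 := (G : Op 𝕜) * dz 𝕜 * ((G⁻¹ : (Op 𝕜)ˣ) : Op 𝕜)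

/-- The wave function of `W`: the element of `W` of the form `1 + O(z⁻¹)`. -/
def IsWaveFunction (W : Set (Space 𝕜)) (Ψ : Space 𝕜) : Prop :=
  Ψ ∈ W ∧ Ψ - 1 ∈ HMinus 𝕜

end Grassmannian

section Model

variable {𝕜 : Type*} [Field 𝕜] (n : ℕ) (ħ : 𝕜)

/-- `U = z ^ n / (ħ (1 - w z))`, expanded in powers of `w`. -/
def potU : Space 𝕜 := z 𝕜 ^ n * (cst ħ * (1 - w 𝕜 * z 𝕜))⁻¹

variable (𝕜) in
/-- `V'(z) = ħ ∫₀ᶻ U = ∑ k, w ^ k z ^ (k + n + 1) / (k + n + 1)`; multiplication by it is the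
Kac-Schwarz operator `X_U`. -/
def potV' : Space 𝕜 :=
  PowerSeries.mk fun k => HahnSeries.C ((k + n + 1 : ℕ) : 𝕜)⁻¹ * zL 𝕜 ^ (k + n + 1)

variable (𝕜) in
/-- `V(z) = ∫₀ᶻ V' = ∑ k, w ^ k z ^ (k + n + 2) / ((k + n + 1) (k + n + 2))`. -/
def potV : Space 𝕜 :=
  PowerSeries.mk fun k =>
    HahnSeries.C (((k + n + 1 : ℕ) : 𝕜) * ((k + n + 2 : ℕ) : 𝕜))⁻¹ * zL 𝕜 ^ (k + n + 2)

/-- `Q̃_U = z + U⁻¹ ∂/∂z - U' / (2 U²)`. -/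
def Qtilde : Op 𝕜 :=
  mulOp (z 𝕜) + mulOp (potU n ħ)⁻¹ * dz 𝕜 -
    mulOp (cst (2 : 𝕜)⁻¹ * dz 𝕜 (potU n ħ) * (potU n ħ)⁻¹ ^ 2)

/-- The interaction `- ∑_{j ≥ 3} U^{(j-2)} ψ ^ j / j!`, a power series in `ψ`. -/
def interaction : PowerSeries (Space 𝕜) :=
  PowerSeries.mk fun j =>
    if 3 ≤ j then -(cst (j.factorial : 𝕜)⁻¹ * (dz 𝕜 ^ (j - 2)) (potU n ħ)) else 0

/-- The exponential of a power series in `ψ` without constant term; only the powers `l ≤ N`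
contribute to the coefficient of `ψ ^ N`. -/
def expSeries (T : PowerSeries (Space 𝕜)) : PowerSeries (Space 𝕜) :=
  PowerSeries.mk fun N =>
    ∑ l ∈ Finset.range (N + 1), cst (l.factorial : 𝕜)⁻¹ * PowerSeries.coeff N (T ^ l)

/-- The perturbative Gaussian integral
`√(U/2π) ∫ dψ (z + ψ) ^ k exp (- U ψ² / 2 - ∑_{j ≥ 3} U^{(j-2)} ψ ^ j / j!)`
(so `ψ = φ / √U` for the variable `φ` with standard Gaussian weight): the contribution of
`ψ ^ (2 r)`, whose Gaussian moment is `(2 r - 1)!! U ^ (-r)`. Odd moments vanish. -/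
def gkmTerm (k r : ℕ) : Space 𝕜 :=
  cst (Nat.doubleFactorial (2 * r - 1) : 𝕜) * (potU n ħ)⁻¹ ^ r *
    PowerSeries.coeff (2 * r)
      ((PowerSeries.C (z 𝕜) + PowerSeries.X) ^ k * expSeries (interaction n ħ))

/-- The basis vectors of the generalized Kontsevich model with potential `U`, numbered from `0`:
`gkmBasis n ħ k = z ^ k + ⋯` at `w = 0`. -/
def gkmBasis (k : ℕ) : Space 𝕜 := formalSum (gkmTerm n ħ k)

/-- The point `W_U` of the Sato Grassmannian. (Rescaling all basis vectors by a common invertible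
constant does not change it.) -/
def pointW : Set (Space 𝕜) := closedSpan (gkmBasis n ħ)

end Model

section Bernoulli

variable {𝕜 : Type*} [Field 𝕜] [CharZero 𝕜] (n : ℕ) (ħ : 𝕜)

/-- `c w ^ e` in `𝕜[z]((w))`. -/
def wMonomial (e : ℤ) (c : 𝕜) : LaurentSeries (Polynomial 𝕜) :=
  HahnSeries.single e (Polynomial.C c)

variable (𝕜) in
/-- The variable `z` in `𝕜[z]((w))`. -/
def zPoly : LaurentSeries (Polynomial 𝕜) := HahnSeries.C (Polynomial.X : Polynomial 𝕜)

/-- `(-χ w) ^ k / k * B_k (1/2 - z / χ)` in `𝕜[z]((w))`, where `χ = w ^ (n + 1) ħ` and `B_k` is the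
`k`-th Bernoulli polynomial. -/
def bernoulliTerm (k : ℕ) : LaurentSeries (Polynomial 𝕜) :=
  (-(wMonomial (n + 1) ħ * wMonomial 1 1)) ^ k * wMonomial 0 (k : 𝕜)⁻¹ *
    (Polynomial.bernoulli k).eval₂
      (HahnSeries.C.comp (Polynomial.C.comp (algebraMap ℚ 𝕜)))
      (wMonomial 0 (2 : 𝕜)⁻¹ - zPoly 𝕜 * wMonomial (-(n + 1)) ħ⁻¹)

/-- `F = w ^ (-n-1) ∑_{k ≥ 1} (-χ w) ^ k / k * B_k (1/2 - z / χ)` in `𝕜[z]((w))`: each coefficient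
in `w` of the partial sums is eventually the one of `F`. -/
def IsBernoulliSeries (F : LaurentSeries (Polynomial 𝕜)) : Prop :=
  ∀ m : ℤ, ∀ᶠ K in atTop,
    (wMonomial (-(n + 1)) 1 * ∑ k ∈ Finset.Icc 1 K, bernoulliTerm n ħ k).coeff m = F.coeff m

variable (𝕜) in
/-- `w ^ (-n-1) ∑_{k=1}^n (w z) ^ k / k` in `𝕜[z]((w))`. -/
def logTerms : LaurentSeries (Polynomial 𝕜) :=
  wMonomial (-(n + 1)) 1 * ∑ k ∈ Finset.Icc 1 n, (wMonomial 1 1 * zPoly 𝕜) ^ k * wMonomial 0 (k : 𝕜)⁻¹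

/-- `A = R(Q)`, the value of a series `R ∈ 𝕜[z][[w]]` at `z = Q`. -/
def IsValueAt (R : PowerSeries (Polynomial 𝕜)) (Q A : Op 𝕜) : Prop :=
  OpHasSum (fun m => mulOp (w 𝕜 ^ m) * (PowerSeries.coeff m R).eval₂
    (mulOp.comp (PowerSeries.C.comp HahnSeries.C)) Q) A

end Bernoulli

section Modified

variable {𝕜 : Type*} [Field 𝕜]

/-- The space `e^{S₀/ħ + S₁} 𝕜((z⁻¹))[[w]]` of formal expressions `e^{S₀/ħ + S₁} f`, where
`S₀ = z V' - V` and `S₁ = - log (V'') / 2`; such an expression is stored as `f`. -/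
def ModSpace (_n : ℕ) (_ħ : 𝕜) : Type _ := Space 𝕜

variable (n : ℕ) (ħ : 𝕜)

instance : AddCommGroup (ModSpace n ħ) := inferInstanceAs (AddCommGroup (Space 𝕜))

/-- The map `f ↦ e^{S₀/ħ + S₁} f`; it sends the wave function to the modified wave function. -/
def toMod : Space 𝕜 ≃+ ModSpace n ħ := AddEquiv.refl (Space 𝕜)

/-- The operator `e^S A e^{-S}` on `e^S 𝕜((z⁻¹))[[w]]`, where `S = S₀/ħ + S₁`. -/
def modConj (A : Op 𝕜) : AddMonoid.End (ModSpace n ħ) :=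
  (toMod n ħ).toAddMonoidHom.comp (A.comp (toMod n ħ).symm.toAddMonoidHom)

/-- Multiplication by `g` on `e^{S₀/ħ + S₁} 𝕜((z⁻¹))[[w]]`. -/
def modMul (g : Space 𝕜) : AddMonoid.End (ModSpace n ħ) := modConj n ħ (mulOp g)

/-- `∂/∂z (S₀/ħ + S₁)`, where `∂S₁/∂z = - V''' / (2 V'')`. -/
def dzExponent : Space 𝕜 :=
  cst ħ⁻¹ * dz 𝕜 (z 𝕜 * potV' 𝕜 n - potV 𝕜 n) -
    cst (2 : 𝕜)⁻¹ * dz 𝕜 (dz 𝕜 (potV' 𝕜 n)) * (dz 𝕜 (potV' 𝕜 n))⁻¹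

/-- `∂/∂z` on `e^{S₀/ħ + S₁} 𝕜((z⁻¹))[[w]]`, by the product rule:
`∂/∂z (e^S f) = e^S (f' + S' f)`. -/
def modDz : AddMonoid.End (ModSpace n ħ) :=
  modConj n ħ (dz 𝕜 + mulOp (dzExponent n ħ))

/-- `x̂`, multiplication by `x = V'(z)`. -/
def xHat : AddMonoid.End (ModSpace n ħ) := modMul n ħ (potV' 𝕜 n)

/-- `ŷ = ħ ∂/∂x = ħ (V'')⁻¹ ∂/∂z`, where `V'' = ∂x/∂z`. -/
def yHat : AddMonoid.End (ModSpace n ħ) := modMul n ħ (cst ħ * (dz 𝕜 (potV' 𝕜 n))⁻¹) * modDz n ħ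

/-- `w ^ (n+1) x̂ + ∑_{k=1}^n w ^ k ŷ ^ k / k`. -/
def curveExponent : AddMonoid.End (ModSpace n ħ) :=
  modMul n ħ (w 𝕜 ^ (n + 1)) * xHat n ħ +
    ∑ k ∈ Finset.Icc 1 n, modMul n ħ (cst (k : 𝕜)⁻¹ * w 𝕜 ^ k) * yHat n ħ ^ k

/-- `1 - w ŷ - χ w / 2`, where `χ = w ^ (n+1) ħ`. -/
def curveFactor : AddMonoid.End (ModSpace n ħ) :=
  1 - modMul n ħ (w 𝕜) * yHat n ħ - modMul n ħ (w 𝕜 ^ (n + 1) * cst ħ * w 𝕜 * cst (2 : 𝕜)⁻¹)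

/-- The equation
`exp (w ^ (n+1) x̂ + ∑_{k=1}^n w ^ k ŷ ^ k / k) (1 - w ŷ - χ w / 2) g = g`:
the exponential series applied to `(1 - w ŷ - χ w / 2) g` converges to `g`. -/
def SatisfiesModifiedCurve (g : ModSpace n ħ) : Prop :=
  FormalHasSum
    (fun i => (toMod n ħ).symm
      (modMul n ħ (cst (i.factorial : 𝕜)⁻¹) ((curveExponent n ħ ^ i) (curveFactor n ħ g))))
    ((toMod n ħ).symm g)

end Modified

end

end DeformedGKM

open DeformedGKM

/-! Notation: χ = w^(n+1) ħ, ∂ = ∂/∂z, Q = Q̃_U, H₋ = z⁻¹𝕜[[z⁻¹]][[w]], and 𝒟₋ is the set of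
operators ∑ a_k ∂^k with a_k ∈ H₋. Operators are handled as power series in w with values in the
endomorphisms of 𝕜((z⁻¹)), and 𝒟₋ is replaced by `filS (-1)`: all iterated commutators with z, the
operator itself included, lower the degree in z.

Grassmannian. At w = 0 each Φ_k is z^k plus lower terms, so the space is W ⊕ H₋, which gives the
wave function. The coefficients of G = 1 + ∑ a_k ∂^k are found recursively from G z^j ∈ W. An
element of 𝒟₋ mapping every z^j into W is zero (`eq_zero_of_act_z_pow`). Hence G is unique, and an
operator P equals G ∂ G⁻¹ as soon as P W ⊆ W and P - ∂ ∈ 𝒟₋ (`canonicalP_eq_act`).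

P W ⊆ W. Differentiating under the Gaussian integral gives Q Φ_k = Φ_{k+1} (`Qtilde_gkmBasis`).
Integrating by parts, with numbering from 0, gives V' Φ_k = ∑ w^m Φ_{m+n+1+k} / (m+n+1) - ħ k
Φ_{k-1} (`potV'_mul_gkmBasis`).

P - ∂ ∈ 𝒟₋. The degree in z of R(Q) and of V' is unbounded as the power of w grows, so the
cancellation is seen after exponentiation. Put A = w^(n+1) V' + ∑_{k≤n} (wQ)^k / k and b = w^(n+1)
F; then -χP = A - b(Q). Since [Q, A] = χ is central, exp(A - b(Q)) = exp A · exp(-∫₀¹ b(Q + tχ) dt).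
The mean of B_k over [x, x+1] is x^k, so the integral is -log(1 - w(Q + χ/2)), and exp(-χP) = exp A
· (1 - wQ - χw/2) (`pexp_sub_bernoulliSeries`). On the other hand A is -log(1 - wz) - χ∂ modulo 𝒟₋,
whence exp A = exp(-χ∂)(1 + 𝒟₋)(1 - wz)⁻¹ (`exists_pexp_curveS`), while 1 - wQ - χw/2 = (1 - wz)(1 -
Y) with Y ∈ 𝒟₋ (`one_sub_evalSeries_midSeries`). So exp(-χP) ≡ exp(-χ∂) modulo 𝒟₋, and the formal
logarithm respects this congruence (`sub_mem_filS_of_pexp`).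

Quantum curve. Conjugation by e^{S₀/ħ+S₁} turns ŷ into Q and x̂ into V', so the curve equation reads
exp(-χP) f = f. The exponent is divisible by w, so this is equivalent to P f = 0
(`act_pexp_eq_iff`). Finally Ψ = G·1 and P Ψ = G ∂ 1 = 0.

The identities between exponentials are proved as uniqueness of solutions of linear differential
equations in an auxiliary variable s, followed by s = 1. -/

namespace DeformedGKM

noncomputable section

open Filter

/-! ### Operators on 𝕜((z⁻¹)) and their filtration by commutators with z. -/

section LaurentOperators

variable {𝕜 : Type*} [Field 𝕜]

variable (𝕜) in
/-- `𝕜`-linear operators on `𝕜((z⁻¹))`. -/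
abbrev LaurentEnd : Type _ := Module.End 𝕜 (LaurentSeries 𝕜)

/-- Multiplication operators on `𝕜((z⁻¹))`. -/
def mulL : LaurentSeries 𝕜 →+* LaurentEnd 𝕜 where
  toFun f :=
    { toFun := fun g => f * g
      map_add' := mul_add f
      map_smul' := fun c g => by
        simp only [← HahnSeries.C_mul_eq_smul, RingHom.id_apply, mul_left_comm] }
  map_one' := LinearMap.ext one_mul
  map_mul' f g := LinearMap.ext (mul_assoc f g)
  map_zero' := LinearMap.ext zero_mul
  map_add' f g := LinearMap.ext (add_mul f g)

theorem mulL_apply (f g : LaurentSeries 𝕜) : mulL f g = f * g := rfl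

variable (𝕜) in
/-- The operator `∂/∂z` on `𝕜((z⁻¹))`. -/
def dL : LaurentEnd 𝕜 := -(mulL (HahnSeries.single (2 : ℤ) (1 : 𝕜)) * LaurentSeries.derivative 𝕜)

theorem dL_apply (f : LaurentSeries 𝕜) :
    dL 𝕜 f = -(HahnSeries.single (2 : ℤ) (1 : 𝕜) * LaurentSeries.derivative 𝕜 f) := rfl

theorem coeff_single_one_mul (e i : ℤ) (f : LaurentSeries 𝕜) :
    (HahnSeries.single e (1 : 𝕜) * f).coeff i = f.coeff (i - e) := by
  have h := HahnSeries.coeff_single_mul_add (r := (1 : 𝕜)) (x := f) (a := i - e) (b := e)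
  simpa using h

theorem coeff_zL_mul (i : ℤ) (f : LaurentSeries 𝕜) : (zL 𝕜 * f).coeff i = f.coeff (i + 1) := by
  rw [zL, coeff_single_one_mul, sub_neg_eq_add]

theorem coeff_dL (f : LaurentSeries 𝕜) (i : ℤ) :
    (dL 𝕜 f).coeff i = (1 - i : 𝕜) * f.coeff (i - 1) := by
  rw [dL_apply, HahnSeries.coeff_neg, coeff_single_one_mul, LaurentSeries.derivative_apply,
    LaurentSeries.hasseDeriv_coeff]
  simp only [Nat.cast_one, Ring.choose_one_right, zsmul_eq_mul]
  rw [show i - 2 + 1 = i - 1 by ring]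
  push_cast; ring

/-- The Euler operator z∂ is diagonal: it multiplies the coefficient of index i by -i and does not
enlarge the support. For it the Leibniz rule is additivity of indices on one common antidiagonal,
and ∂ is z⁻¹ times it. -/
theorem dL_mul (f g : LaurentSeries 𝕜) : dL 𝕜 (f * g) = dL 𝕜 f * g + f * dL 𝕜 g := by
  have key : ∀ f : LaurentSeries 𝕜, ∃ θ : LaurentSeries 𝕜, θ.support ⊆ f.support ∧
      (∀ i : ℤ, θ.coeff i = -(i : 𝕜) * f.coeff i) ∧ dL 𝕜 f = HahnSeries.single 1 1 * θ := by
    intro f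
    refine ⟨⟨fun i => -(i : 𝕜) * f.coeff i, f.isPWO_support.mono ?_⟩, ?_, fun _ => rfl, ?_⟩
    · intro i hi h; exact hi (by simp [h])
    · intro i hi h; exact hi (by simp [h])
    · ext i
      rw [coeff_dL, coeff_single_one_mul]
      push_cast; ring
  obtain ⟨p, hp, hpc, hpd⟩ := key f
  obtain ⟨q, hq, hqc, hqd⟩ := key g
  obtain ⟨r, hr, hrc, hrd⟩ := key (f * g)
  rw [hpd, hqd, hrd, mul_assoc, mul_left_comm f, ← mul_add]
  congr 1
  ext i
  rw [hrc, HahnSeries.coeff_add, HahnSeries.coeff_mul_left' f.isPWO_support hp,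
    HahnSeries.coeff_mul_right' g.isPWO_support hq, HahnSeries.coeff_mul, Finset.mul_sum,
    ← Finset.sum_add_distrib]
  refine Finset.sum_congr rfl fun x hx => ?_
  rw [hpc, hqc]
  have : x.1 + x.2 = i := (Finset.mem_antidiagonal.mp hx).2.2
  rw [← this]; push_cast; ring

theorem mulL_C (c : 𝕜) : mulL (HahnSeries.C c) = algebraMap 𝕜 (LaurentEnd 𝕜) c :=
  LinearMap.ext fun _ => HahnSeries.C_mul_eq_smul

theorem dL_comm_mulL (f : LaurentSeries 𝕜) :
    dL 𝕜 * mulL f = mulL f * dL 𝕜 + mulL (dL 𝕜 f) := by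
  refine LinearMap.ext fun g => ?_
  simp only [Module.End.mul_apply, mulL_apply, dL_mul, LinearMap.add_apply]
  ring

theorem dL_zL : dL 𝕜 (zL 𝕜) = 1 := by
  ext i
  rw [coeff_dL, zL]
  by_cases h : i = 0
  · subst h; simp
  · rw [HahnSeries.coeff_single_of_ne (by omega)]
    simp [HahnSeries.coeff_one, h]

/-- `f` has no terms `z ^ j` with `j > L`. -/
def ZDegLE (L : ℤ) (f : LaurentSeries 𝕜) : Prop := ∀ i < -L, f.coeff i = 0

theorem ZDegLE.mono {L L' : ℤ} {f : LaurentSeries 𝕜} (h : ZDegLE L f) (hL : L ≤ L') :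
    ZDegLE L' f := fun i hi => h i (by omega)

theorem ZDegLE.add {L : ℤ} {f g : LaurentSeries 𝕜} (hf : ZDegLE L f) (hg : ZDegLE L g) :
    ZDegLE L (f + g) := fun i hi => by simp [hf i hi, hg i hi]

theorem ZDegLE.neg {L : ℤ} {f : LaurentSeries 𝕜} (hf : ZDegLE L f) : ZDegLE L (-f) :=
  fun i hi => by simp [hf i hi]

theorem ZDegLE.sub {L : ℤ} {f g : LaurentSeries 𝕜} (hf : ZDegLE L f) (hg : ZDegLE L g) :
    ZDegLE L (f - g) := fun i hi => by simp [hf i hi, hg i hi]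

theorem ZDegLE.smul {L : ℤ} {f : LaurentSeries 𝕜} (c : 𝕜) (hf : ZDegLE L f) :
    ZDegLE L (c • f) := fun i hi => by simp [hf i hi]

theorem ZDegLE.zero (L : ℤ) : ZDegLE L (0 : LaurentSeries 𝕜) := fun _ _ => by simp

theorem ZDegLE.sum {ι : Type*} {L : ℤ} (s : Finset ι) {f : ι → LaurentSeries 𝕜}
    (hf : ∀ k ∈ s, ZDegLE L (f k)) : ZDegLE L (∑ k ∈ s, f k) := fun i hi => by
  rw [HahnSeries.coeff_sum]
  exact Finset.sum_eq_zero fun k hk => hf k hk i hi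

theorem ZDegLE.mul {L L' : ℤ} {f g : LaurentSeries 𝕜} (hf : ZDegLE L f) (hg : ZDegLE L' g) :
    ZDegLE (L + L') (f * g) := fun i hi => by
  rw [HahnSeries.coeff_mul]
  refine Finset.sum_eq_zero fun x hx => ?_
  obtain ⟨h1, h2, h3⟩ := Finset.mem_antidiagonal.mp hx
  by_cases h : x.1 < -L
  · exact absurd (hf _ h) h1
  · exact absurd (hg x.2 (by omega)) h2

theorem zDegLE_single (e : ℤ) (c : 𝕜) : ZDegLE (-e) (HahnSeries.single e c) := fun i hi =>
  HahnSeries.coeff_single_of_ne (by omega)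

theorem exists_zDegLE (f : LaurentSeries 𝕜) : ∃ L, ZDegLE L f :=
  ⟨-f.order, fun i hi => HahnSeries.coeff_eq_zero_of_lt_order (by omega)⟩

theorem eq_zero_of_zDegLE {f : LaurentSeries 𝕜} (h : ∀ k : ℕ, ∃ L : ℤ, L ≤ -k ∧ ZDegLE L f) :
    f = 0 := by
  ext i
  obtain ⟨L, hL, h⟩ := h (i.natAbs + 1)
  refine h i ?_
  have := Int.le_natAbs (a := i)
  rw [Nat.cast_succ] at hL
  omega

/-- Every Laurent series is a finite combination of powers of `z` up to terms of low degree. -/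
theorem exists_truncation (f : LaurentSeries 𝕜) (L L' : ℤ) (hf : ZDegLE L f) :
    ZDegLE L' (f - ∑ e ∈ Finset.Ico (-L) (-L'), f.coeff e • HahnSeries.single e (1 : 𝕜)) := by
  intro i hi
  rw [HahnSeries.coeff_sub, HahnSeries.coeff_sum]
  by_cases h : i < -L
  · rw [hf i h, Finset.sum_eq_zero, sub_zero]
    intro e he
    rw [HahnSeries.coeff_smul, HahnSeries.coeff_single_of_ne, smul_zero]
    have := Finset.mem_Ico.mp he
    omega
  · rw [Finset.sum_eq_single i]
    · simp
    · intro e _ he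
      rw [HahnSeries.coeff_smul, HahnSeries.coeff_single_of_ne he.symm, smul_zero]
    · intro h'
      exact absurd (Finset.mem_Ico.mpr ⟨by omega, hi⟩) h'

/-- Operators which raise the degree in `z` at most by `r`. -/
def degLE (r : ℤ) : Submodule 𝕜 (LaurentEnd 𝕜) where
  carrier := {a | ∀ f L, ZDegLE L f → ZDegLE (L + r) (a f)}
  add_mem' ha hb f L hf := (ha f L hf).add (hb f L hf)
  zero_mem' _ _ _ := ZDegLE.zero _
  smul_mem' c _ ha f L hf := (ha f L hf).smul c

theorem degLE_mono {r s : ℤ} (h : r ≤ s) : degLE (𝕜 := 𝕜) r ≤ degLE s :=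
  fun _ ha f L hf => (ha f L hf).mono (by omega)

theorem mul_mem_degLE {r s : ℤ} {a b : LaurentEnd 𝕜} (ha : a ∈ degLE r) (hb : b ∈ degLE s) :
    a * b ∈ degLE (r + s) := fun f L hf =>
  (ha _ _ (hb f L hf)).mono (by rw [add_assoc, add_comm s r])

theorem one_mem_degLE : (1 : LaurentEnd 𝕜) ∈ degLE 0 := fun f L hf => hf.mono (by omega)

theorem mulL_mem_degLE {r : ℤ} {f : LaurentSeries 𝕜} (hf : ZDegLE r f) : mulL f ∈ degLE r :=
  fun g L hg => (hf.mul hg).mono (by omega)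

theorem dL_mem_degLE : dL 𝕜 ∈ degLE (-1) := fun f L hf i hi => by
  rw [coeff_dL, hf (i - 1) (by omega), mul_zero]

variable (𝕜) in
/-- The commutator `a ↦ [a, z]`. -/
def adZ : LaurentEnd 𝕜 →ₗ[𝕜] LaurentEnd 𝕜 :=
  LinearMap.mulRight 𝕜 (mulL (zL 𝕜)) - LinearMap.mulLeft 𝕜 (mulL (zL 𝕜))

theorem adZ_apply (a : LaurentEnd 𝕜) : adZ 𝕜 a = a * mulL (zL 𝕜) - mulL (zL 𝕜) * a := rfl

theorem adZ_apply_apply (a : LaurentEnd 𝕜) (f : LaurentSeries 𝕜) :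
    adZ 𝕜 a f = a (zL 𝕜 * f) - zL 𝕜 * a f := rfl

theorem adZ_mul (a b : LaurentEnd 𝕜) : adZ 𝕜 (a * b) = adZ 𝕜 a * b + a * adZ 𝕜 b := by
  simp only [adZ_apply, mul_sub, sub_mul, mul_assoc]; abel

theorem adZ_mulL (f : LaurentSeries 𝕜) : adZ 𝕜 (mulL f) = 0 := by
  rw [adZ_apply, ← map_mul, ← map_mul, mul_comm, sub_self]

theorem adZ_one : adZ 𝕜 1 = 0 := by simp [adZ_apply]

theorem adZ_dL : adZ 𝕜 (dL 𝕜) = 1 := by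
  rw [adZ_apply, dL_comm_mulL, dL_zL, map_one]; simp

/-- Operators all of whose first `k` commutators with `z` raise the degree at most by `r`. -/
def filUpTo : ℕ → ℤ → Submodule 𝕜 (LaurentEnd 𝕜)
  | 0, r => degLE r
  | k + 1, r => degLE r ⊓ (filUpTo k r).comap (adZ 𝕜)

/-- The operators `∑ k, a k (∂/∂z) ^ k` with coefficients `a k` of degree at most `r` in `z`,
characterised by the property that all iterated commutators with `z` raise the degree in `z` at
most by `r`. -/
def fil (r : ℤ) : Submodule 𝕜 (LaurentEnd 𝕜) := ⨅ k, filUpTo k r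

theorem mem_fil {r : ℤ} {a : LaurentEnd 𝕜} : a ∈ fil r ↔ ∀ k, a ∈ filUpTo k r := by
  simp [fil, Submodule.mem_iInf]

theorem filUpTo_le_degLE (k : ℕ) (r : ℤ) : filUpTo (𝕜 := 𝕜) k r ≤ degLE r := by
  cases k with
  | zero => exact le_rfl
  | succ k => exact inf_le_left

theorem fil_le_degLE (r : ℤ) : fil (𝕜 := 𝕜) r ≤ degLE r := fun _ ha => mem_fil.mp ha 0

theorem filUpTo_succ_le (k : ℕ) (r : ℤ) : filUpTo (𝕜 := 𝕜) (k + 1) r ≤ filUpTo k r := by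
  induction k with
  | zero => exact inf_le_left
  | succ k ih => exact fun a ha => ⟨ha.1, ih (x := adZ 𝕜 a) ha.2⟩

theorem adZ_mem_fil {r : ℤ} {a : LaurentEnd 𝕜} (ha : a ∈ fil r) : adZ 𝕜 a ∈ fil r :=
  mem_fil.mpr fun k => (mem_fil.mp ha (k + 1)).2

theorem filUpTo_mono (k : ℕ) {r s : ℤ} (h : r ≤ s) : filUpTo (𝕜 := 𝕜) k r ≤ filUpTo k s := by
  induction k with
  | zero => exact degLE_mono h
  | succ k ih => exact fun a ha => ⟨degLE_mono h ha.1, ih (x := adZ 𝕜 a) ha.2⟩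

theorem fil_mono {r s : ℤ} (h : r ≤ s) : fil (𝕜 := 𝕜) r ≤ fil s :=
  fun _ ha => mem_fil.mpr fun k => filUpTo_mono k h (mem_fil.mp ha k)

theorem mul_mem_filUpTo (k : ℕ) {r s : ℤ} {a b : LaurentEnd 𝕜} (ha : a ∈ filUpTo k r)
    (hb : b ∈ filUpTo k s) : a * b ∈ filUpTo k (r + s) := by
  induction k generalizing a b with
  | zero => exact mul_mem_degLE ha hb
  | succ k ih =>
    refine ⟨mul_mem_degLE ha.1 hb.1, ?_⟩
    change adZ 𝕜 (a * b) ∈ filUpTo k (r + s)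
    rw [adZ_mul]
    exact add_mem (ih ha.2 (filUpTo_succ_le k s hb)) (ih (filUpTo_succ_le k r ha) hb.2)

theorem mul_mem_fil {r s : ℤ} {a b : LaurentEnd 𝕜} (ha : a ∈ fil r) (hb : b ∈ fil s) :
    a * b ∈ fil (r + s) :=
  mem_fil.mpr fun k => mul_mem_filUpTo k (mem_fil.mp ha k) (mem_fil.mp hb k)

theorem mem_fil_of_adZ {r : ℤ} {a : LaurentEnd 𝕜} (ha : a ∈ degLE r) (h : adZ 𝕜 a ∈ fil r) :
    a ∈ fil r := mem_fil.mpr fun k => by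
  cases k with
  | zero => exact ha
  | succ k => exact ⟨ha, mem_fil.mp h k⟩

theorem mulL_mem_fil {r : ℤ} {f : LaurentSeries 𝕜} (hf : ZDegLE r f) : mulL f ∈ fil r :=
  mem_fil_of_adZ (mulL_mem_degLE hf) (by rw [adZ_mulL]; exact zero_mem _)

theorem one_mem_fil : (1 : LaurentEnd 𝕜) ∈ fil 0 :=
  mem_fil_of_adZ one_mem_degLE (by rw [adZ_one]; exact zero_mem _)

/-- Although ∂ lowers the degree by one, its commutator [∂, z] = 1 does not, so the order in this
filtration is only 0. -/
theorem dL_mem_fil : dL 𝕜 ∈ fil 0 :=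
  mem_fil_of_adZ (degLE_mono (by omega) dL_mem_degLE) (by rw [adZ_dL]; exact one_mem_fil)

theorem dL_pow_mem_fil (k : ℕ) : dL 𝕜 ^ k ∈ fil 0 := by
  induction k with
  | zero => exact one_mem_fil
  | succ k ih => rw [pow_succ]; exact fil_mono (add_zero 0).le (mul_mem_fil ih dL_mem_fil)

theorem dL_pow_mem_degLE (k : ℕ) : dL 𝕜 ^ k ∈ degLE (-k) := by
  induction k with
  | zero => exact one_mem_degLE
  | succ k ih =>
    rw [pow_succ]
    exact degLE_mono (by push_cast; omega) (mul_mem_degLE ih dL_mem_degLE)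

/-- The filtration is closed under limits. -/
theorem mem_fil_of_eventually {r : ℤ} {a : LaurentEnd 𝕜} (b : ℕ → LaurentEnd 𝕜)
    (hb : ∀ K, b K ∈ fil r) (h : ∀ f i, ∀ᶠ K in atTop, (b K f).coeff i = (a f).coeff i) :
    a ∈ fil r := by
  have key : ∀ (k : ℕ) (a : LaurentEnd 𝕜) (b : ℕ → LaurentEnd 𝕜), (∀ K, b K ∈ fil r) →
      (∀ f i, ∀ᶠ K in atTop, (b K f).coeff i = (a f).coeff i) → a ∈ filUpTo k r := by
    intro k
    induction k with
    | zero =>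
      intro a b hb h f L hf i hi
      obtain ⟨K, hK⟩ := (h f i).exists
      rw [← hK]
      exact fil_le_degLE r (hb K) f L hf i hi
    | succ k ih =>
      intro a b hb h
      refine ⟨?_, ih _ (fun K => adZ 𝕜 (b K)) (fun K => adZ_mem_fil (hb K)) ?_⟩
      · exact filUpTo_le_degLE k r (ih a b hb h)
      -- A coefficient of [b K, z] f involves one coefficient of b K (z f) and one of b K f, so the
      -- commutators converge as well.
      · intro f i
        filter_upwards [h (zL 𝕜 * f) i, h f (i + 1)] with K h1 h2
        rw [adZ_apply_apply, adZ_apply_apply, HahnSeries.coeff_sub, HahnSeries.coeff_sub,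
          coeff_zL_mul, coeff_zL_mul, h1, h2]
  exact mem_fil.mpr fun k => key k a b hb h

theorem zL_mul_single (e : ℤ) (c : 𝕜) :
    zL 𝕜 * HahnSeries.single e c = HahnSeries.single (e - 1) c := by
  rw [zL, HahnSeries.single_mul_single, one_mul, neg_add_eq_sub]

theorem zL_pow (j : ℕ) : zL 𝕜 ^ j = HahnSeries.single (-(j : ℤ)) 1 := by
  rw [zL, HahnSeries.single_pow]; simp

end LaurentOperators

/-! ### Formal exponentials over a noncommutative ring. -/

section FormalExponential

open PowerSeries Finset

variable {S : Type*} [Ring S]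

theorem coeff_zero_mul (x y : PowerSeries S) :
    coeff 0 (x * y) = coeff 0 x * coeff 0 y := by simp [coeff_mul]

theorem X_pow_dvd_mul {a b : ℕ} {x y : PowerSeries S} (hx : X ^ a ∣ x) (hy : X ^ b ∣ y) :
    X ^ (a + b) ∣ x * y := by
  rw [X_pow_dvd_iff] at hx hy ⊢
  intro m hm
  rw [coeff_mul]
  refine Finset.sum_eq_zero fun p hp => ?_
  have := Finset.HasAntidiagonal.mem_antidiagonal.mp hp
  by_cases h : p.1 < a
  · rw [hx _ h, zero_mul]
  · rw [hy _ (by omega), mul_zero]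

theorem X_pow_dvd_mul_left {a : ℕ} {x : PowerSeries S} (y : PowerSeries S) (hx : X ^ a ∣ x) :
    X ^ a ∣ y * x := by
  simpa using X_pow_dvd_mul (a := 0) (by rw [pow_zero]; exact ⟨y, (one_mul y).symm⟩) hx

theorem X_dvd_mul_left {x : PowerSeries S} (y : PowerSeries S) (hx : X ∣ x) : X ∣ y * x := by
  simpa using X_pow_dvd_mul_left (a := 1) y (by simpa using hx)

theorem X_pow_dvd_pow {x : PowerSeries S} (hx : X ∣ x) (i : ℕ) : X ^ i ∣ x ^ i := by
  induction i with
  | zero => simp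
  | succ i ih => rw [pow_succ x]; exact X_pow_dvd_mul ih (by simpa using hx)

theorem X_pow_dvd_X_pow_mul {a : ℕ} (x : PowerSeries S) : X ^ a ∣ X ^ a * x := ⟨x, rfl⟩

theorem X_pow_dvd_of_le {a b : ℕ} {x : PowerSeries S} (h : a ≤ b) (hx : X ^ b ∣ x) : X ^ a ∣ x := by
  rw [X_pow_dvd_iff] at hx ⊢
  exact fun m hm => hx m (by omega)

theorem coeff_pow_eq_zero {x : PowerSeries S} (hx : X ∣ x) {i N : ℕ} (h : N < i) :
    coeff N (x ^ i) = 0 := X_pow_dvd_iff.mp (X_pow_dvd_pow hx i) N h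

theorem commute_of_coeff {f g : PowerSeries S} (h : ∀ i j, Commute (coeff i f) (coeff j g)) :
    Commute f g := by
  ext m
  rw [coeff_mul, coeff_mul, ← Finset.Nat.sum_antidiagonal_swap]
  exact Finset.sum_congr rfl fun p _ => h _ _

/-- The derivative of a power series over a possibly noncommutative ring. -/
def pderiv : PowerSeries S →+ PowerSeries S where
  toFun f := PowerSeries.mk fun l => (l + 1) • coeff (l + 1) f
  map_zero' := by ext; simp
  map_add' f g := by ext; simp

theorem coeff_pderiv (f : PowerSeries S) (l : ℕ) :
    coeff l (pderiv f) = (l + 1) • coeff (l + 1) f :=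
  coeff_mk l fun l => (l + 1) • coeff (l + 1) f

theorem pderiv_mul (f g : PowerSeries S) : pderiv (f * g) = pderiv f * g + f * pderiv g := by
  ext n
  have h1 : coeff n (pderiv f * g) =
      ∑ p ∈ antidiagonal (n + 1), p.1 • (coeff p.1 f * coeff p.2 g) := by
    rw [Finset.Nat.sum_antidiagonal_succ, coeff_mul]
    simp only [coeff_pderiv, zero_smul, zero_add, smul_mul_assoc]
  have h2 : coeff n (f * pderiv g) =
      ∑ p ∈ antidiagonal (n + 1), p.2 • (coeff p.1 f * coeff p.2 g) := by
    rw [Finset.Nat.sum_antidiagonal_succ', coeff_mul]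
    simp only [coeff_pderiv, zero_smul, zero_add, mul_smul_comm]
  rw [map_add, h1, h2, ← Finset.sum_add_distrib, coeff_pderiv, coeff_mul, Finset.smul_sum]
  refine Finset.sum_congr rfl fun p hp => ?_
  rw [← add_smul, Finset.HasAntidiagonal.mem_antidiagonal.mp hp]

theorem pderiv_C (a : S) : pderiv (C a) = 0 := by
  ext l; simp [coeff_pderiv]

theorem pderiv_one : pderiv (1 : PowerSeries S) = 0 := by
  rw [← map_one (C (R := S)), pderiv_C]

theorem pderiv_X : pderiv (X : PowerSeries S) = 1 := by
  ext l; by_cases h : l = 0 <;> simp [coeff_pderiv, coeff_X, coeff_one, h]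

theorem pderiv_pow {x : PowerSeries S} (h : Commute x (pderiv x)) (i : ℕ) :
    pderiv (x ^ (i + 1)) = (i + 1) • (pderiv x * x ^ i) := by
  induction i with
  | zero => simp
  | succ i ih =>
    rw [pow_succ, pderiv_mul, ih, smul_mul_assoc, mul_assoc, ← pow_succ, (h.pow_left (i + 1)).eq,
      ← succ_nsmul]

variable {𝕜 : Type*} [Field 𝕜] [Algebra 𝕜 S]

variable (𝕜) in
theorem nsmul_succ_injective [CharZero 𝕜] (l : ℕ) {x y : S} (h : (l + 1) • x = (l + 1) • y) :
    x = y := by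
  rw [← Nat.cast_smul_eq_nsmul 𝕜, ← Nat.cast_smul_eq_nsmul 𝕜] at h
  have h0 : ((l + 1 : ℕ) : 𝕜) ≠ 0 := Nat.cast_ne_zero.mpr (by omega)
  exact (smul_right_injective S h0) h

variable (𝕜) in
/-- A linear differential equation has at most one solution with given initial value. -/
theorem eq_of_pderiv_eq_mul [CharZero 𝕜] (m : PowerSeries S) {f g : PowerSeries S}
    (hf : pderiv f = m * f) (hg : pderiv g = m * g) (h0 : coeff 0 f = coeff 0 g) : f = g := by
  ext l
  induction l using Nat.strong_induction_on with
  | _ l ih =>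
    cases l with
    | zero => exact h0
    | succ l =>
      refine nsmul_succ_injective 𝕜 l ?_
      rw [← coeff_pderiv, ← coeff_pderiv, hf, hg, coeff_mul, coeff_mul]
      refine Finset.sum_congr rfl fun p hp => ?_
      have := Finset.HasAntidiagonal.mem_antidiagonal.mp hp
      rw [ih p.2 (by omega)]

variable (𝕜) in
/-- The exponential of a power series without constant term. -/
def pexp (x : PowerSeries S) : PowerSeries S :=
  PowerSeries.mk fun N => ∑ i ∈ range (N + 1), ((i.factorial : 𝕜)⁻¹) • coeff N (x ^ i)

theorem coeff_pexp {x : PowerSeries S} (hx : X ∣ x) {N B : ℕ} (h : N ≤ B) :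
    coeff N (pexp 𝕜 x) = ∑ i ∈ range (B + 1), ((i.factorial : 𝕜)⁻¹) • coeff N (x ^ i) := by
  rw [pexp, coeff_mk]
  refine Finset.sum_subset (Finset.range_mono (by omega)) fun i _ hi => ?_
  rw [coeff_pow_eq_zero hx (by simpa using hi), smul_zero]

theorem coeff_zero_pexp (x : PowerSeries S) : coeff 0 (pexp 𝕜 x) = 1 := by
  simp [pexp]

theorem coeff_mul_pexp {x : PowerSeries S} (hx : X ∣ x) (y : PowerSeries S) {N B : ℕ}
    (h : N ≤ B) : coeff N (y * pexp 𝕜 x) =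
      ∑ i ∈ range (B + 1), ((i.factorial : 𝕜)⁻¹) • coeff N (y * x ^ i) := by
  simp only [coeff_mul, Finset.smul_sum]
  rw [Finset.sum_comm]
  refine Finset.sum_congr rfl fun p hp => ?_
  have := Finset.HasAntidiagonal.mem_antidiagonal.mp hp
  rw [coeff_pexp hx (show p.2 ≤ B by omega), Finset.mul_sum]
  exact Finset.sum_congr rfl fun i _ => mul_smul_comm _ _ _

variable (𝕜) in
theorem pderiv_pexp [CharZero 𝕜] {x : PowerSeries S} (hx : X ∣ x) (h : Commute x (pderiv x)) :
    pderiv (pexp 𝕜 x) = pderiv x * pexp 𝕜 x := by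
  ext N
  rw [coeff_mul_pexp hx _ le_rfl, coeff_pderiv, coeff_pexp hx le_rfl, Finset.sum_range_succ',
    nsmul_add, Finset.smul_sum]
  rw [pow_zero, coeff_one, if_neg (Nat.succ_ne_zero N), smul_zero, smul_zero, add_zero]
  refine Finset.sum_congr rfl fun i _ => ?_
  rw [smul_comm, ← coeff_pderiv, pderiv_pow h, map_nsmul, ← Nat.cast_smul_eq_nsmul 𝕜, smul_smul,
    Nat.factorial_succ]
  congr 1
  have : ((i + 1 : ℕ) : 𝕜) ≠ 0 := Nat.cast_ne_zero.mpr (by omega)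
  rw [Nat.cast_mul, mul_inv, mul_comm, ← mul_assoc, mul_inv_cancel₀ this, one_mul]

variable (𝕜) in
/-- `exp (s x)` as a power series in `s`. -/
def expS (x : S) : PowerSeries S := PowerSeries.mk fun l => ((l.factorial : 𝕜)⁻¹) • x ^ l

theorem coeff_expS (x : S) (l : ℕ) : coeff l (expS 𝕜 x) = ((l.factorial : 𝕜)⁻¹) • x ^ l :=
  coeff_mk _ _

theorem coeff_zero_expS (x : S) : coeff 0 (expS 𝕜 x) = 1 := by simp [coeff_expS]

theorem commute_C_expS {x y : S} (h : Commute y x) : Commute (C y) (expS 𝕜 x) := by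
  refine commute_of_coeff fun i j => ?_
  rw [coeff_expS, coeff_C]
  split_ifs
  · exact (h.pow_right j).smul_right _
  · exact Commute.zero_left _

theorem pderiv_expS [CharZero 𝕜] (x : S) : pderiv (expS 𝕜 x) = C x * expS 𝕜 x := by
  ext l
  rw [coeff_pderiv, coeff_C_mul, coeff_expS, coeff_expS, ← Nat.cast_smul_eq_nsmul 𝕜, smul_smul,
    pow_succ', Nat.factorial_succ, mul_smul_comm]
  congr 1
  have : ((l + 1 : ℕ) : 𝕜) ≠ 0 := Nat.cast_ne_zero.mpr (by omega)
  rw [Nat.cast_mul, mul_inv, ← mul_assoc, mul_inv_cancel₀ this, one_mul]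

variable (𝕜) in
-- The product has zero derivative in s; uniqueness is applied to the equation f' = 0.
theorem expS_neg_mul_expS [CharZero 𝕜] (x : S) : expS 𝕜 (-x) * expS 𝕜 x = 1 := by
  refine eq_of_pderiv_eq_mul 𝕜 0 ?_ (by rw [pderiv_one, zero_mul]) ?_
  · rw [pderiv_mul, pderiv_expS, pderiv_expS, (commute_C_expS (Commute.refl (-x))).eq, map_neg]
    noncomm_ring
  · rw [coeff_zero_mul, coeff_zero_expS, coeff_zero_expS, mul_one, coeff_zero_one]

theorem expS_mul_expS_neg [CharZero 𝕜] (x : S) : expS 𝕜 x * expS 𝕜 (-x) = 1 := by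
  simpa using expS_neg_mul_expS 𝕜 (-x)

variable (𝕜) in
-- This is e^{sx} q e^{-sx} = q + sκ: the adjoint series stops because κ = [x, q] commutes with x.
-- Both sides solve f' = x f.
theorem expS_mul_C [CharZero 𝕜] {x q κ : S} (h : x * q = q * x + κ) (hκ : Commute κ x) :
    expS 𝕜 x * C q = (C q + X * C κ) * expS 𝕜 x := by
  refine eq_of_pderiv_eq_mul 𝕜 (C x) ?_ ?_ ?_
  · rw [pderiv_mul, pderiv_C, pderiv_expS, mul_zero, add_zero, mul_assoc]
  · rw [pderiv_mul, map_add, pderiv_mul, pderiv_C, pderiv_C, pderiv_X, pderiv_expS]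
    have h1 : C (R := S) x * C q = C q * C x + C κ := by rw [← map_mul, h, map_add, map_mul]
    have h2 : C (R := S) κ * C x = C x * C κ := by rw [← map_mul, hκ.eq, map_mul]
    have h3 : C (R := S) x * (X * C κ) = X * (C κ * C x) := by
      rw [h2, ← mul_assoc, ← X_mul, mul_assoc]
    rw [zero_add, mul_zero, add_zero, one_mul, ← mul_assoc (C x), mul_add, h1, h3]
    simp only [add_mul, mul_assoc]
    abel
  · rw [coeff_zero_mul, coeff_zero_mul, coeff_zero_expS, one_mul, mul_one, map_add, coeff_zero_mul]
    simp

end FormalExponential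

/-! ### Setting the auxiliary variable s equal to 1. -/

section Evaluation

open PowerSeries Finset

variable {S : Type*} [Ring S]

theorem eq_of_forall_X_pow_dvd_sub {x y : PowerSeries S} (h : ∀ N, X ^ N ∣ x - y) : x = y := by
  ext m
  exact sub_eq_zero.mp (by simpa using X_pow_dvd_iff.mp (h (m + 1)) m (by omega))

variable (S) in
/-- The power series `∑ f_l s ^ l` over `S[[w]]` with `w ^ l ∣ f_l`; they can be evaluated at
`s = 1`. -/
def convergentSubring : Subring (PowerSeries (PowerSeries S)) where
  carrier := {f | ∀ l, X ^ l ∣ coeff l f}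
  mul_mem' {f g} hf hg l := by
    rw [coeff_mul]
    refine Finset.dvd_sum fun p hp => ?_
    rw [← Finset.HasAntidiagonal.mem_antidiagonal.mp hp]
    exact X_pow_dvd_mul (hf _) (hg _)
  one_mem' l := by
    rw [coeff_one]
    split_ifs with h
    · rw [h, pow_zero]
    · exact dvd_zero _
  add_mem' hf hg l := by rw [map_add]; exact dvd_add (hf l) (hg l)
  zero_mem' l := by rw [map_zero]; exact dvd_zero _
  neg_mem' {f} hf l := by
    rw [map_neg, ← neg_one_mul]; exact X_pow_dvd_mul_left _ (hf l)

theorem C_mem_convergentSubring (a : PowerSeries S) : C a ∈ convergentSubring S := fun l => by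
  rw [coeff_C]
  split_ifs with h
  · rw [h, pow_zero]; exact ⟨a, (one_mul a).symm⟩
  · exact dvd_zero _

/-- Evaluation at `s = 1` of power series in `s` over `S[[w]]`. -/
def evalOne : PowerSeries (PowerSeries S) →+ PowerSeries S where
  toFun f := PowerSeries.mk fun m => ∑ l ∈ range (m + 1), coeff m (coeff l f)
  map_zero' := by ext; simp
  map_add' f g := by ext; simp [Finset.sum_add_distrib]

theorem coeff_evalOne' (f : PowerSeries (PowerSeries S)) (m : ℕ) :
    coeff m (evalOne f) = ∑ l ∈ range (m + 1), coeff m (coeff l f) :=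
  coeff_mk m fun m => ∑ l ∈ range (m + 1), coeff m (coeff l f)

theorem coeff_evalOne {f : PowerSeries (PowerSeries S)} (hf : f ∈ convergentSubring S) {m B : ℕ}
    (h : m ≤ B) : coeff m (evalOne f) = ∑ l ∈ range (B + 1), coeff m (coeff l f) := by
  rw [coeff_evalOne']
  refine Finset.sum_subset (Finset.range_mono (by omega)) fun l _ hl => ?_
  exact X_pow_dvd_iff.mp (hf l) m (by simpa using hl)

/-- As w^l divides the coefficient of s^l, the coefficient of w^m needs only powers of s up to m in
each factor, and pairs (a, b) with a + b > m contribute nothing. So the sums over the square and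
over the triangle of pairs agree. -/
theorem evalOne_mul {f g : PowerSeries (PowerSeries S)} (hf : f ∈ convergentSubring S)
    (hg : g ∈ convergentSubring S) : evalOne (f * g) = evalOne f * evalOne g := by
  ext m
  have h1 : coeff m (evalOne f * evalOne g) =
      ∑ a ∈ range (m + 1), ∑ b ∈ range (m + 1), coeff m (coeff a f * coeff b g) := by
    rw [coeff_mul]
    have : ∀ p ∈ antidiagonal m, coeff p.1 (evalOne f) * coeff p.2 (evalOne g) =
        ∑ a ∈ range (m + 1), ∑ b ∈ range (m + 1),
          coeff p.1 (coeff a f) * coeff p.2 (coeff b g) := by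
      intro p hp
      have := Finset.HasAntidiagonal.mem_antidiagonal.mp hp
      rw [coeff_evalOne hf (show p.1 ≤ m by omega), coeff_evalOne hg (show p.2 ≤ m by omega),
        Finset.sum_mul_sum]
    rw [Finset.sum_congr rfl this, Finset.sum_comm]
    refine Finset.sum_congr rfl fun a _ => ?_
    rw [Finset.sum_comm]
    exact Finset.sum_congr rfl fun b _ => (coeff_mul _ _ _).symm
  have h2 : coeff m (evalOne (f * g)) =
      ∑ l ∈ range (m + 1), ∑ a ∈ range (l + 1), coeff m (coeff a f * coeff (l - a) g) := by
    rw [coeff_evalOne']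
    refine Finset.sum_congr rfl fun l _ => ?_
    rw [coeff_mul, map_sum,
      Finset.Nat.sum_antidiagonal_eq_sum_range_succ (fun a b => coeff m (coeff a f * coeff b g))]
  rw [h1, h2, Finset.sum_range_diag_flip (m + 1) fun a b => coeff m (coeff a f * coeff b g)]
  refine Finset.sum_congr rfl fun a _ => Finset.sum_subset (Finset.range_mono (by omega)) ?_
  intro b _ hb
  have hb : m + 1 - a ≤ b := by simpa using hb
  exact X_pow_dvd_iff.mp (X_pow_dvd_mul (hf a) (hg b)) m (by omega)

theorem evalOne_C (a : PowerSeries S) : evalOne (C a) = a := by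
  ext m
  rw [coeff_evalOne (C_mem_convergentSubring a) le_rfl, Finset.sum_eq_single 0]
  · simp
  · intro l _ hl; simp [coeff_C, hl]
  · simp

theorem evalOne_one : evalOne (1 : PowerSeries (PowerSeries S)) = 1 := by
  rw [← map_one (C (R := PowerSeries S)), evalOne_C]

theorem evalOne_pow {f : PowerSeries (PowerSeries S)} (hf : f ∈ convergentSubring S) (k : ℕ) :
    evalOne (f ^ k) = evalOne f ^ k := by
  induction k with
  | zero => rw [pow_zero, pow_zero, evalOne_one]
  | succ k ih => rw [pow_succ, pow_succ, evalOne_mul (pow_mem hf k) hf, ih]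

theorem X_dvd_evalOne {f : PowerSeries (PowerSeries S)} (h : ∀ l, X ∣ coeff l f) :
    X ∣ evalOne f := by
  rw [← pow_one X, X_pow_dvd_iff]
  intro m hm
  rw [coeff_evalOne']
  refine Finset.sum_eq_zero fun l _ => ?_
  exact X_pow_dvd_iff.mp (by simpa using h l) m hm

theorem X_pow_dvd_evalOne_sub {f : PowerSeries (PowerSeries S)} (hf : f ∈ convergentSubring S)
    (N : ℕ) : X ^ N ∣ evalOne f - ∑ l ∈ range N, coeff l f := by
  rw [X_pow_dvd_iff]
  intro m hm
  obtain ⟨B, rfl⟩ : ∃ B, N = B + 1 := ⟨N - 1, by omega⟩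
  rw [map_sub, coeff_evalOne hf (show m ≤ B by omega), map_sum, sub_self]

variable {𝕜 : Type*} [Field 𝕜] [Algebra 𝕜 S]

variable (𝕜) in
theorem smul_X_pow_dvd {a : ℕ} (c : 𝕜) {x : PowerSeries S} (hx : X ^ a ∣ x) : X ^ a ∣ c • x := by
  rw [X_pow_dvd_iff] at hx ⊢
  intro m hm
  rw [coeff_smul, hx m hm, smul_zero]

theorem expS_mem_convergentSubring {x : PowerSeries S} (hx : X ∣ x) :
    expS 𝕜 x ∈ convergentSubring S := fun l => by
  rw [coeff_expS]
  exact smul_X_pow_dvd 𝕜 _ (X_pow_dvd_pow hx l)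

theorem evalOne_expS (x : PowerSeries S) : evalOne (expS 𝕜 x) = pexp 𝕜 x := by
  ext m
  rw [coeff_evalOne', pexp, coeff_mk]
  exact Finset.sum_congr rfl fun l _ => by rw [coeff_expS, coeff_smul]

theorem evalOne_pexp {x : PowerSeries (PowerSeries S)} (hx : x ∈ convergentSubring S)
    (h0 : X ∣ x) : evalOne (pexp 𝕜 x) = pexp 𝕜 (evalOne x) := by
  ext m
  rw [coeff_evalOne', pexp, pexp, coeff_mk]
  have : ∀ l ∈ range (m + 1), coeff m (coeff l (pexp 𝕜 x)) =
      ∑ i ∈ range (m + 1), ((i.factorial : 𝕜)⁻¹) • coeff m (coeff l (x ^ i)) := by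
    intro l hl
    have hl : l ≤ m := by simpa [Nat.lt_succ_iff] using hl
    rw [coeff_pexp h0 hl, map_sum]
    exact Finset.sum_congr rfl fun i _ => coeff_smul _ _ _
  rw [← pexp, Finset.sum_congr rfl this, Finset.sum_comm]
  refine Finset.sum_congr rfl fun i _ => ?_
  rw [← Finset.smul_sum, ← evalOne_pow hx, coeff_evalOne (pow_mem hx i) le_rfl]

theorem pexp_mem_convergentSubring {x : PowerSeries (PowerSeries S)}
    (hx : x ∈ convergentSubring S) : pexp 𝕜 x ∈ convergentSubring S := fun l => by
  rw [pexp, coeff_mk]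
  exact Finset.dvd_sum fun i _ => smul_X_pow_dvd 𝕜 _ (pow_mem hx i l)

theorem pexp_neg_mul_pexp [CharZero 𝕜] {x : PowerSeries S} (hx : X ∣ x) :
    pexp 𝕜 (-x) * pexp 𝕜 x = 1 := by
  rw [← evalOne_expS, ← evalOne_expS, ← evalOne_mul, expS_neg_mul_expS, evalOne_one]
  · refine expS_mem_convergentSubring ?_
    rw [← neg_one_mul]; exact X_dvd_mul_left _ hx
  · exact expS_mem_convergentSubring hx

variable (𝕜) in
/-- `∑ k, s ^ k u ^ k / k = - log (1 - s u)` as a power series in `s`. -/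
def logS {S : Type*} [Ring S] [Algebra 𝕜 S] (u : S) : PowerSeries S :=
  PowerSeries.mk fun l => ((l : 𝕜)⁻¹) • u ^ l

theorem coeff_logS {S : Type*} [Ring S] [Algebra 𝕜 S] (u : S) (l : ℕ) :
    coeff l (logS 𝕜 u) = ((l : 𝕜)⁻¹) • u ^ l := coeff_mk _ _

theorem X_dvd_logS (u : S) : X ∣ logS 𝕜 u := by
  rw [← pow_one X, X_pow_dvd_iff]
  intro m hm
  obtain rfl : m = 0 := by omega
  simp [coeff_logS]

theorem logS_mem_convergentSubring {u : PowerSeries S} (hu : X ∣ u) :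
    logS 𝕜 u ∈ convergentSubring S := fun l => by
  rw [coeff_logS]; exact smul_X_pow_dvd 𝕜 _ (X_pow_dvd_pow hu l)

/-- Both sides solve f' = m f with m = -∑ u^(l+1) s^l, the logarithmic derivative of 1 - su. -/
theorem pexp_neg_logS [CharZero 𝕜] (u : S) : pexp 𝕜 (-logS 𝕜 u) = 1 - X * C u := by
  have hX : X ∣ -logS 𝕜 u := by
    rw [← neg_one_mul]; exact X_dvd_mul_left _ (X_dvd_logS u)
  have hd : ∀ l, coeff l (pderiv (-logS 𝕜 u)) = -u ^ (l + 1) := by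
    intro l
    have : ((l + 1 : ℕ) : 𝕜) ≠ 0 := Nat.cast_ne_zero.mpr (by omega)
    rw [coeff_pderiv, map_neg, coeff_logS, smul_neg, ← Nat.cast_smul_eq_nsmul 𝕜, smul_smul,
      mul_inv_cancel₀ this, one_smul]
  refine eq_of_pderiv_eq_mul 𝕜 (pderiv (-logS 𝕜 u)) ?_ ?_ ?_
  · refine pderiv_pexp 𝕜 hX (commute_of_coeff fun i j => ?_)
    rw [hd, map_neg, coeff_logS]
    exact (((Commute.refl u).pow_pow i (j + 1)).smul_left _).neg_left.neg_right
  · rw [map_sub, pderiv_one, pderiv_mul, pderiv_X, pderiv_C, mul_zero, add_zero, one_mul, zero_sub,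
      mul_sub, mul_one]
    ext l
    rw [map_sub, hd, map_neg, coeff_C, X_mul, ← mul_assoc]
    cases l with
    | zero => simp
    | succ l => rw [coeff_succ_mul_X, coeff_mul_C, hd, pow_succ u (l + 1)]; simp
  · rw [coeff_zero_pexp, map_sub, coeff_zero_mul]; simp

variable (𝕜) in
/-- `∑ k, u ^ k / k = - log (1 - u)`, for a power series `u` without constant term. -/
def plog (u : PowerSeries S) : PowerSeries S := evalOne (logS 𝕜 u)

theorem pexp_neg_plog [CharZero 𝕜] {u : PowerSeries S} (hu : X ∣ u) :
    pexp 𝕜 (-plog 𝕜 u) = 1 - u := by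
  rw [plog, ← map_neg, ← evalOne_pexp (neg_mem (logS_mem_convergentSubring hu)), pexp_neg_logS,
    X_mul]
  · ext m
    rw [map_sub, evalOne_one, map_sub, map_sub, coeff_evalOne']
    congr 1
    cases m with
    | zero => simpa using (X_dvd_iff.mp hu).symm
    | succ m =>
      rw [Finset.sum_eq_single 1]
      · simp
      · intro l _ hl
        simp [coeff_X, hl]
      · simp
  · rw [← neg_one_mul]; exact X_dvd_mul_left _ (X_dvd_logS u)

end Evaluation

/-! ### Substituting an operator for the variable of 𝕜[y][[w]]. -/

section Substitution

open PowerSeries Finset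

variable {𝕜 : Type*} [Field 𝕜] {R S : Type*} [Ring R] [Algebra 𝕜 R] [Ring S] [Algebra 𝕜 S]

/-- The terms `w ^ l φ(f_l)`. -/
def extendTerms (φ : R →ₐ[𝕜] PowerSeries S) (f : PowerSeries R) : PowerSeries (PowerSeries S) :=
  PowerSeries.mk fun l => X ^ l * φ (coeff l f)

theorem coeff_extendTerms (φ : R →ₐ[𝕜] PowerSeries S) (f : PowerSeries R) (l : ℕ) :
    coeff l (extendTerms φ f) = X ^ l * φ (coeff l f) := coeff_mk _ _

theorem extendTerms_mem (φ : R →ₐ[𝕜] PowerSeries S) (f : PowerSeries R) :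
    extendTerms φ f ∈ convergentSubring S := fun l => by
  rw [coeff_extendTerms]; exact X_pow_dvd_X_pow_mul _

/-- The extension `∑ w ^ l r_l ↦ ∑ w ^ l φ(r_l)` of a homomorphism `φ : R → S[[w]]` to `R[[w]]`. -/
def extend (φ : R →ₐ[𝕜] PowerSeries S) : PowerSeries R →+* PowerSeries S where
  toFun f := evalOne (extendTerms φ f)
  map_zero' := by
    rw [show extendTerms φ 0 = 0 by ext1 l; simp [coeff_extendTerms], map_zero]
  map_add' f g := by
    rw [← map_add]; congr 1; ext1 l; simp [coeff_extendTerms, mul_add]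
  map_one' := by
    rw [show extendTerms φ 1 = 1 by
      ext1 l
      rw [coeff_extendTerms, coeff_one, coeff_one]
      split_ifs with h <;> simp [h], evalOne_one]
  map_mul' f g := by
    rw [← evalOne_mul (extendTerms_mem φ f) (extendTerms_mem φ g)]
    congr 1
    ext1 l
    rw [coeff_extendTerms, coeff_mul, coeff_mul, map_sum, Finset.mul_sum]
    refine Finset.sum_congr rfl fun p hp => ?_
    rw [coeff_extendTerms, coeff_extendTerms, ← Finset.HasAntidiagonal.mem_antidiagonal.mp hp,
      map_mul, pow_add, mul_assoc, mul_assoc, ← mul_assoc (X ^ p.2), ← mul_assoc (φ _),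
      (commute_X_pow _ p.2).eq]

theorem extend_apply (φ : R →ₐ[𝕜] PowerSeries S) (f : PowerSeries R) :
    extend φ f = evalOne (extendTerms φ f) := rfl

theorem extend_C (φ : R →ₐ[𝕜] PowerSeries S) (r : R) : extend φ (C r) = φ r := by
  rw [extend_apply, show extendTerms φ (C r) = C (φ r) by
    ext1 l
    rw [coeff_extendTerms, coeff_C, coeff_C]
    split_ifs with h <;> simp [h], evalOne_C]

theorem extend_X (φ : R →ₐ[𝕜] PowerSeries S) : extend φ X = X := by
  ext m
  rw [extend_apply, coeff_evalOne (extendTerms_mem φ X) (Nat.le_add_right m 1),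
    Finset.sum_eq_single 1]
  · simp [coeff_extendTerms]
  · intro l _ hl; simp [coeff_extendTerms, coeff_X, hl]
  · simp

theorem extend_smul (φ : R →ₐ[𝕜] PowerSeries S) (c : 𝕜) (f : PowerSeries R) :
    extend φ (c • f) = c • extend φ f := by
  ext m
  rw [extend_apply, coeff_evalOne', coeff_smul, extend_apply, coeff_evalOne', Finset.smul_sum]
  exact Finset.sum_congr rfl fun l _ => by
    rw [coeff_extendTerms, coeff_extendTerms, coeff_smul, map_smul, mul_smul_comm, coeff_smul]

theorem X_pow_dvd_extend (φ : R →ₐ[𝕜] PowerSeries S) {a : ℕ} {f : PowerSeries R}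
    (hf : X ^ a ∣ f) : X ^ a ∣ extend φ f := by
  obtain ⟨g, rfl⟩ := hf
  rw [map_mul, map_pow, extend_X]
  exact X_pow_dvd_X_pow_mul _

theorem X_dvd_extend (φ : R →ₐ[𝕜] PowerSeries S) {f : PowerSeries R}
    (hf : X ∣ f) : X ∣ extend φ f := by
  simpa using X_pow_dvd_extend φ (a := 1) (by simpa using hf)

/-- `extend φ` is w-adically continuous: modulo w^N both sides are the image of the same finite
partial sum. -/
theorem extend_evalOne (φ : R →ₐ[𝕜] PowerSeries S) {f : PowerSeries (PowerSeries R)}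
    (hf : f ∈ convergentSubring R) :
    extend φ (evalOne f) = evalOne (PowerSeries.map (extend φ) f) := by
  refine eq_of_forall_X_pow_dvd_sub fun N => ?_
  have hg : PowerSeries.map (extend φ) f ∈ convergentSubring S := fun l => by
    rw [coeff_map]; exact X_pow_dvd_extend φ (hf l)
  have h1 := X_pow_dvd_extend φ (X_pow_dvd_evalOne_sub hf N)
  have h2 := X_pow_dvd_evalOne_sub hg N
  rw [map_sub, map_sum] at h1
  simp only [coeff_map] at h2
  have := dvd_sub h1 h2
  simpa using this

theorem extend_plog (φ : R →ₐ[𝕜] PowerSeries S) {u : PowerSeries R} (hu : X ∣ u) :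
    extend φ (plog 𝕜 u) = plog 𝕜 (extend φ u) := by
  rw [plog, extend_evalOne φ (logS_mem_convergentSubring hu), plog]
  congr 1
  ext1 l
  rw [coeff_map, coeff_logS, coeff_logS, extend_smul, map_pow]

end Substitution

section PolynomialDerivative

open PowerSeries Finset

variable (𝕜 : Type*) [Field 𝕜]

/-- `∂/∂y` on `𝕜[y][[w]]`. -/
def dy : Derivation 𝕜 (PowerSeries (Polynomial 𝕜)) (PowerSeries (Polynomial 𝕜)) :=
  Derivation.mk'
    { toFun := fun f => PowerSeries.mk fun m => Polynomial.derivative (coeff m f)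
      map_add' := fun f g => by ext1 m; simp
      map_smul' := fun c f => by ext1 m; simp }
    (by
      intro f g
      ext1 m
      simp only [LinearMap.coe_mk, AddHom.coe_mk, coeff_mk, smul_eq_mul, map_add, coeff_mul,
        map_sum, Polynomial.derivative_mul]
      rw [Finset.sum_add_distrib, ← Finset.Nat.sum_antidiagonal_swap (n := m), add_comm]
      congr 1
      exact Finset.sum_congr rfl fun p _ => mul_comm _ _)

variable {𝕜}

theorem coeff_dy (f : PowerSeries (Polynomial 𝕜)) (m : ℕ) :
    coeff m (dy 𝕜 f) = Polynomial.derivative (coeff m f) :=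
  coeff_mk m fun m => Polynomial.derivative (coeff m f)

theorem dy_X : dy 𝕜 X = 0 := by
  ext1 m; rw [coeff_dy, coeff_X]; split_ifs <;> simp

theorem dy_C (p : Polynomial 𝕜) : dy 𝕜 (C p) = C (Polynomial.derivative p) := by
  ext1 m; rw [coeff_dy, coeff_C, coeff_C]; split_ifs <;> simp

theorem X_pow_dvd_dy {a : ℕ} {f : PowerSeries (Polynomial 𝕜)} (hf : X ^ a ∣ f) :
    X ^ a ∣ dy 𝕜 f := by
  rw [X_pow_dvd_iff] at hf ⊢
  intro m hm
  rw [coeff_dy, hf m hm, map_zero]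

theorem X_pow_dvd_dy_iterate {a : ℕ} {f : PowerSeries (Polynomial 𝕜)} (hf : X ^ a ∣ f) (l : ℕ) :
    X ^ a ∣ (dy 𝕜)^[l] f := by
  induction l with
  | zero => exact hf
  | succ l ih => rw [Function.iterate_succ_apply']; exact X_pow_dvd_dy ih

end PolynomialDerivative

/-! ### The exponential of A - b(Q) when [Q, A] is central. -/

section ShiftedExponential

open PowerSeries Finset

variable {𝕜 : Type*} [Field 𝕜] {S : Type*} [Ring S] [Algebra 𝕜 S]

variable (𝕜) in
/-- The value `f(Q)` of `f ∈ 𝕜[y][[w]]` at `y = Q`. -/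
def evalSeries (Q : PowerSeries S) : PowerSeries (Polynomial 𝕜) →+* PowerSeries S :=
  extend (Polynomial.aeval Q)

/-- The commutator with A is a derivation whose value at Q is the central element χ. -/
theorem polynomial_aeval_mul_of_commutator {T : Type*} [Ring T] [Algebra 𝕜 T] {Q A χ : T}
    (h : Q * A = A * Q + χ) (hχ : ∀ y, Commute χ y) (p : Polynomial 𝕜) :
    Polynomial.aeval Q p * A =
      A * Polynomial.aeval Q p + χ * Polynomial.aeval Q (Polynomial.derivative p) := by
  induction p using Polynomial.induction_on' with
  | add p q hp hq => simp only [map_add, add_mul, mul_add, hp, hq]; abel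
  | monomial k a =>
    have key : ∀ k : ℕ, Q ^ k * A = A * Q ^ k + χ * (k • Q ^ (k - 1)) := by
      intro k
      induction k with
      | zero => simp
      | succ k ih =>
        rw [pow_succ', mul_assoc, ih, mul_add, ← mul_assoc, h, add_mul, mul_assoc A, ← pow_succ',
          ← mul_assoc Q χ, (hχ Q).eq.symm, mul_assoc χ Q, add_assoc, ← mul_add, mul_smul_comm]
        congr 2
        rcases k with _ | k
        · simp
        · rw [Nat.succ_sub_one, ← pow_succ', Nat.succ_sub_one, ← succ_nsmul']
    rw [Polynomial.derivative_monomial, Polynomial.aeval_monomial, Polynomial.aeval_monomial,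
      mul_assoc, key k, ← Algebra.smul_def, ← Algebra.smul_def, ← Algebra.smul_def, smul_add, mul_smul_comm,
      mul_smul_comm, mul_smul_comm, mul_smul, Nat.cast_smul_eq_nsmul]

theorem evalSeries_mul_of_commutator {Q A χ : PowerSeries S} (h : Q * A = A * Q + χ)
    (hχ : ∀ y, Commute χ y) (f : PowerSeries (Polynomial 𝕜)) :
    evalSeries 𝕜 Q f * A = A * evalSeries 𝕜 Q f + χ * evalSeries 𝕜 Q (dy 𝕜 f) := by
  have hC := C_mem_convergentSubring (S := S)
  simp only [evalSeries, extend_apply]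
  rw [← evalOne_C A, ← evalOne_C χ, ← evalOne_mul (extendTerms_mem _ _) (hC _),
    ← evalOne_mul (hC _) (extendTerms_mem _ _), ← evalOne_mul (hC _) (extendTerms_mem _ _),
    ← map_add]
  congr 1
  ext1 l
  rw [map_add, coeff_mul_C, coeff_C_mul, coeff_C_mul, coeff_extendTerms, coeff_extendTerms,
    coeff_dy, mul_assoc, polynomial_aeval_mul_of_commutator h hχ, mul_add, ← mul_assoc, ← mul_assoc,
    ← (commute_X_pow A l).eq, ← (hχ (X ^ l)).eq, mul_assoc, mul_assoc]

variable [CharZero 𝕜]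

/-- The series on the left is the Taylor expansion of f(Q + sχ), so this is e^{-sA} f(Q) e^{sA} =
f(Q + sχ). Its s-derivative is χ times the same series for f', hence the induction on the power of s
runs over all f at once. -/
theorem expS_mul_taylor {Q A χ : PowerSeries S} (h : Q * A = A * Q + χ)
    (hχ : ∀ y, Commute χ y) (f : PowerSeries (Polynomial 𝕜)) :
    expS 𝕜 A * PowerSeries.mk
      (fun l => ((l.factorial : 𝕜)⁻¹) • (χ ^ l * evalSeries 𝕜 Q ((dy 𝕜)^[l] f))) =
      C (evalSeries 𝕜 Q f) * expS 𝕜 A := by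
  set T : PowerSeries (Polynomial 𝕜) → PowerSeries (PowerSeries S) := fun f =>
    PowerSeries.mk (fun l => ((l.factorial : 𝕜)⁻¹) • (χ ^ l * evalSeries 𝕜 Q ((dy 𝕜)^[l] f)))
    with hT
  have hTd : ∀ f, pderiv (T f) = C χ * T (dy 𝕜 f) := by
    intro f
    ext1 l
    have : ((l + 1 : ℕ) : 𝕜) ≠ 0 := Nat.cast_ne_zero.mpr (by omega)
    rw [coeff_pderiv, coeff_C_mul, hT, coeff_mk, coeff_mk, ← Nat.cast_smul_eq_nsmul 𝕜, smul_smul,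
      Nat.factorial_succ, Nat.cast_mul, mul_inv, ← mul_assoc, mul_inv_cancel₀ this, one_mul,
      mul_smul_comm, ← mul_assoc, ← pow_succ', Function.iterate_succ_apply]
  have key : ∀ l f, coeff l (expS 𝕜 A * T f) = coeff l (C (evalSeries 𝕜 Q f) * expS 𝕜 A) := by
    intro l
    induction l with
    | zero => intro f; simp [hT, coeff_zero_mul, coeff_zero_expS]
    | succ l ih =>
      intro f
      refine nsmul_succ_injective 𝕜 l ?_
      rw [← coeff_pderiv, ← coeff_pderiv, pderiv_mul, pderiv_mul, pderiv_C, zero_mul, zero_add,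
        pderiv_expS, hTd, ← mul_assoc (expS 𝕜 A), ← (commute_C_expS (hχ A)).eq, mul_assoc,
        mul_assoc, map_add, coeff_C_mul, coeff_C_mul, ih, ih, coeff_C_mul, coeff_C_mul, coeff_C_mul,
        coeff_C_mul, ← mul_assoc, ← mul_assoc, ← mul_assoc, ← add_mul,
        ← evalSeries_mul_of_commutator h hχ]
  exact PowerSeries.ext fun l => key l f

/-- Suppose that `[Q, A] = χ` is central, and that
`∑ l, χ ^ l b^(l)(Q) / (l + 1)! = - log (1 - v)`, where `b^(l) = ∂ ^ l b / ∂y ^ l`. Then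
`exp (A - b(Q)) = exp A (1 - v)`. -/
theorem pexp_sub_evalSeries {Q A χ v : PowerSeries S} (h : Q * A = A * Q + χ)
    (hχ : ∀ y, Commute χ y) (hA : X ∣ A) (hχX : X ∣ χ) (hv : X ∣ v)
    {b : PowerSeries (Polynomial 𝕜)} (hb : X ∣ b)
    (hc : evalOne (X * PowerSeries.mk
      (fun l => (((l + 1).factorial : 𝕜)⁻¹) • (χ ^ l * evalSeries 𝕜 Q ((dy 𝕜)^[l] b)))) =
        plog 𝕜 v) :
    pexp 𝕜 (A - evalSeries 𝕜 Q b) = pexp 𝕜 A * (1 - v) := by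
  have hbl : ∀ l, X ∣ evalSeries 𝕜 Q ((dy 𝕜)^[l] b) := fun l => by
    refine X_dvd_extend _ ?_
    simpa using X_pow_dvd_dy_iterate (a := 1) (by simpa using hb) l
  -- c(s) is the integral of b(Q + tχ) over 0 ≤ t ≤ s; `hc` is its value at s = 1.
  set c : PowerSeries (PowerSeries S) := X * PowerSeries.mk
      (fun l => (((l + 1).factorial : 𝕜)⁻¹) • (χ ^ l * evalSeries 𝕜 Q ((dy 𝕜)^[l] b))) with hcdef
  have hcomm : ∀ i j, Commute (evalSeries 𝕜 Q ((dy 𝕜)^[i] b)) (evalSeries 𝕜 Q ((dy 𝕜)^[j] b)) :=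
    fun i j => (Commute.all ((dy 𝕜)^[i] b) ((dy 𝕜)^[j] b)).map (evalSeries 𝕜 Q)
  have hcd : pderiv c = PowerSeries.mk
      (fun l => ((l.factorial : 𝕜)⁻¹) • (χ ^ l * evalSeries 𝕜 Q ((dy 𝕜)^[l] b))) := by
    ext1 l
    have : ((l + 1 : ℕ) : 𝕜) ≠ 0 := Nat.cast_ne_zero.mpr (by omega)
    rw [coeff_pderiv, hcdef, coeff_succ_X_mul, coeff_mk, coeff_mk, ← Nat.cast_smul_eq_nsmul 𝕜,
      smul_smul, Nat.factorial_succ, Nat.cast_mul, mul_inv, ← mul_assoc, mul_inv_cancel₀ this,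
      one_mul]
  have hcmem : c ∈ convergentSubring S := by
    intro l
    cases l with
    | zero => simp
    | succ l =>
      rw [hcdef, coeff_succ_X_mul, coeff_mk]
      exact smul_X_pow_dvd 𝕜 _ (X_pow_dvd_mul (X_pow_dvd_pow hχX l) (by simpa using hbl l))
  have hcX : X ∣ -c := by
    rw [← neg_one_mul]; exact X_dvd_mul_left _ ⟨_, rfl⟩
  have hcc : Commute (-c) (pderiv (-c)) := by
    rw [map_neg, hcd]
    refine Commute.neg_left (Commute.neg_right (commute_of_coeff fun i j => ?_))
    rw [coeff_mk]
    have h1 : ∀ y, Commute (χ ^ j) y := fun y => (hχ y).pow_left j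
    cases i with
    | zero => simp [hcdef, Commute.zero_left]
    | succ i =>
      rw [hcdef, coeff_succ_X_mul, coeff_mk]
      refine (Commute.smul_left ?_ _).smul_right _
      exact (((hχ _).pow_left i).mul_left ((h1 _).symm.mul_right (hcomm i j)))
  have hγ := pderiv_pexp 𝕜 hcX hcc
  -- Variation of constants: differentiating the right side produces e^{sA} b(Q + sχ) = b(Q) e^{sA}.
  have hE : expS 𝕜 (A - evalSeries 𝕜 Q b) = expS 𝕜 A * pexp 𝕜 (-c) := by
    refine eq_of_pderiv_eq_mul 𝕜 (C (A - evalSeries 𝕜 Q b)) (pderiv_expS _) ?_ ?_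
    · rw [pderiv_mul, pderiv_expS, hγ, map_neg, hcd, map_sub, ← mul_assoc, mul_neg,
        expS_mul_taylor h hχ]
      noncomm_ring
    · rw [coeff_zero_mul, coeff_zero_expS, coeff_zero_expS, coeff_zero_pexp, one_mul]
  rw [← evalOne_expS, hE, evalOne_mul (expS_mem_convergentSubring hA)
    (pexp_mem_convergentSubring (neg_mem hcmem)), evalOne_expS,
    evalOne_pexp (neg_mem hcmem) hcX, map_neg, hc, pexp_neg_plog hv]

end ShiftedExponential

/-! ### Homogenized Bernoulli polynomials. -/

section HomogeneousBernoulli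

open Finset

variable (𝕜 : Type*) [Field 𝕜] [CharZero 𝕜]

/-- The homogenized Bernoulli polynomial `h ^ k B_k(u / h)`. -/
def bernoulliHom {K : Type*} [CommRing K] [Algebra 𝕜 K] (h u : K) (k : ℕ) : K :=
  ∑ i ∈ range (k + 1), (algebraMap ℚ 𝕜 (bernoulli i * k.choose i)) • (h ^ i * u ^ (k - i))

variable {𝕜}

theorem map_bernoulliHom {K L : Type*} [CommRing K] [Algebra 𝕜 K] [CommRing L] [Algebra 𝕜 L]
    (f : K →ₐ[𝕜] L) (h u : K) (k : ℕ) :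
    f (bernoulliHom 𝕜 h u k) = bernoulliHom 𝕜 (f h) (f u) k := by
  simp [bernoulliHom]

theorem bernoulliHom_zero {K : Type*} [CommRing K] [Algebra 𝕜 K] (h u : K) :
    bernoulliHom 𝕜 h u 0 = 1 := by
  simp [bernoulliHom]

theorem eval₂_bernoulli {K : Type*} [CommRing K] (f : ℚ →+* K) (t : K) (k : ℕ) :
    (Polynomial.bernoulli k).eval₂ f t =
      ∑ i ∈ range (k + 1), f (bernoulli i * k.choose i) * t ^ (k - i) := by
  simp only [Polynomial.bernoulli, Polynomial.eval₂_finsetSum, Polynomial.eval₂_monomial]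

theorem pow_mul_eval₂_bernoulli {K : Type*} [CommRing K] [Algebra 𝕜 K] (h t : K) (k : ℕ) :
    h ^ k * (Polynomial.bernoulli k).eval₂ ((algebraMap 𝕜 K).comp (algebraMap ℚ 𝕜)) t =
      bernoulliHom 𝕜 h (h * t) k := by
  rw [eval₂_bernoulli, bernoulliHom, Finset.mul_sum]
  refine Finset.sum_congr rfl fun i hi => ?_
  have hi : i ≤ k := by simpa [Nat.lt_succ_iff] using hi
  rw [Algebra.smul_def, RingHom.comp_apply, mul_pow]
  nth_rewrite 1 [← Nat.add_sub_cancel' hi]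
  rw [pow_add]; ring

/-- Homogeneous form of ∑_{j≤k} C(k+1, j) B_j(t) = (k+1) t^k. Dividing by h to obtain t = u / h
requires the fraction field, from which the identity descends by injectivity. -/
theorem sum_choose_mul_bernoulliHom {K : Type*} [CommRing K] [IsDomain K] [Algebra 𝕜 K] {h : K}
    (hh : h ≠ 0) (u : K) (k : ℕ) :
    ∑ j ∈ range (k + 1), (((k + 1).choose j : 𝕜)) • (h ^ (k - j) * bernoulliHom 𝕜 h u j) =
      ((k + 1 : ℕ) : 𝕜) • u ^ k := by
  have key : ∀ {L : Type _} [Field L] [Algebra 𝕜 L] {h : L} (_ : h ≠ 0) (u : L),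
      ∑ j ∈ range (k + 1), (((k + 1).choose j : 𝕜)) • (h ^ (k - j) * bernoulliHom 𝕜 h u j) =
      ((k + 1 : ℕ) : 𝕜) • u ^ k := by
    intro L _ _ h hh u
    obtain ⟨t, rfl⟩ : ∃ t, u = h * t := ⟨u / h, by field_simp⟩
    have := congrArg (Polynomial.eval₂ ((algebraMap 𝕜 L).comp (algebraMap ℚ 𝕜)) t)
      (Polynomial.sum_bernoulli k)
    rw [Polynomial.eval₂_monomial, Polynomial.eval₂_finsetSum] at this
    have h2 := congrArg (fun x => h ^ k * x) this
    rw [Finset.mul_sum] at h2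
    rw [mul_pow, Algebra.smul_def, mul_left_comm]
    refine Eq.trans (Finset.sum_congr rfl fun j hj => ?_) (h2.trans ?_)
    · have hj : j ≤ k := by simpa [Nat.lt_succ_iff] using hj
      rw [← pow_mul_eval₂_bernoulli, Polynomial.eval₂_smul, Algebra.smul_def, ← mul_assoc (h ^ _),
        ← pow_add, Nat.sub_add_cancel hj]
      simp only [map_natCast]
      ring
    · rw [RingHom.comp_apply, map_add, map_add, map_natCast, map_natCast, map_one, map_one,
        Nat.cast_add, Nat.cast_one, map_add, map_natCast, map_one]
  have hinj := IsFractionRing.injective K (FractionRing K)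
  apply hinj
  have hh' : algebraMap K (FractionRing K) h ≠ 0 := by
    rwa [Ne, ← map_zero (algebraMap K (FractionRing K)), hinj.eq_iff]
  have := key hh' (algebraMap K (FractionRing K) u)
  have hm := fun j => map_bernoulliHom (IsScalarTower.toAlgHom 𝕜 K (FractionRing K)) h u j
  simp only [IsScalarTower.coe_toAlgHom'] at hm
  simp only [map_sum, map_mul, map_pow, hm, Algebra.smul_def] at this ⊢
  simpa only [← IsScalarTower.algebraMap_apply] using this

theorem derivation_bernoulliHom {K : Type*} [CommRing K] [Algebra 𝕜 K] (d : Derivation 𝕜 K K)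
    {h u x : K} (hh : d h = 0) (hu : d u = x) (k : ℕ) :
    d (bernoulliHom 𝕜 h u (k + 1)) = ((k + 1 : ℕ) : 𝕜) • (x * bernoulliHom 𝕜 h u k) := by
  rw [bernoulliHom, map_sum, Finset.sum_range_succ, bernoulliHom, Finset.mul_sum, Finset.smul_sum]
  have hlast : d ((algebraMap ℚ 𝕜 (bernoulli (k + 1) * (k + 1).choose (k + 1))) •
      (h ^ (k + 1) * u ^ (k + 1 - (k + 1)))) = 0 := by
    simp [Derivation.leibniz_pow, hh]
  rw [hlast, add_zero]
  refine Finset.sum_congr rfl fun i hi => ?_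
  have hi : i ≤ k := by simpa [Nat.lt_succ_iff] using hi
  rw [Derivation.map_smul, Derivation.leibniz, Derivation.leibniz_pow, Derivation.leibniz_pow, hh, hu,
    smul_zero, smul_zero, smul_zero, add_zero, Nat.succ_sub hi, Nat.succ_sub_one, smul_eq_mul,
    smul_eq_mul, mul_smul_comm, mul_smul_comm, smul_smul, ← Nat.cast_smul_eq_nsmul 𝕜, smul_smul]
  have hc : (algebraMap ℚ 𝕜) (bernoulli i * ((k + 1).choose i : ℕ)) * ((k - i).succ : ℕ) =
      ((k + 1 : ℕ) : 𝕜) * (algebraMap ℚ 𝕜) (bernoulli i * (k.choose i : ℕ)) := by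
    have := Nat.choose_mul_succ_eq k i
    rw [Nat.succ_sub hi] at this
    have h3 : ((k.choose i : ℕ) : 𝕜) * ((k + 1 : ℕ) : 𝕜) =
        ((k + 1).choose i : ℕ) * (((k - i).succ : ℕ) : 𝕜) := by exact_mod_cast this
    rw [map_mul, map_mul, map_natCast, map_natCast, mul_assoc, ← h3]; ring
  rw [hc]
  congr 1; ring

theorem derivation_iterate_bernoulliHom {K : Type*} [CommRing K] [Algebra 𝕜 K]
    (d : Derivation 𝕜 K K) {h u x : K} (hh : d h = 0) (hu : d u = x) (hx : d x = 0) (l k : ℕ) :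
    d^[l] (bernoulliHom 𝕜 h u k) =
      (k.descFactorial l : 𝕜) • (x ^ l * bernoulliHom 𝕜 h u (k - l)) := by
  induction l with
  | zero => simp
  | succ l ih =>
    rw [Function.iterate_succ_apply', ih, Derivation.map_smul, Derivation.leibniz, Derivation.leibniz_pow, hx,
      smul_zero, smul_zero, smul_zero, add_zero, Nat.descFactorial_succ, smul_eq_mul]
    rcases Nat.lt_or_ge l k with hl | hl
    · obtain ⟨j, hj⟩ : ∃ j, k - l = j + 1 := ⟨k - l - 1, by omega⟩
      rw [hj, derivation_bernoulliHom d hh hu, show k - (l + 1) = j by omega, mul_smul_comm,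
        smul_smul, ← mul_assoc, ← pow_succ, Nat.cast_mul, mul_comm ((j + 1 : ℕ) : 𝕜)]
    · rw [show k - l = 0 by omega, bernoulliHom_zero, Derivation.map_one_eq_zero]
      simp

end HomogeneousBernoulli

/-! ### The Bernoulli series and its mean over an interval of length χ. -/

section BernoulliSeries

open PowerSeries Finset

variable {𝕜 : Type*} [Field 𝕜] (n : ℕ) (ħ : 𝕜)

/-- `χ = w ^ (n + 1) ħ` in `𝕜[y][[w]]`. -/
def chiSeries : PowerSeries (Polynomial 𝕜) := ħ • X ^ (n + 1)

variable (𝕜) in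
/-- `w y` in `𝕜[y][[w]]`. -/
def wySeries : PowerSeries (Polynomial 𝕜) := X * C Polynomial.X

/-- `w (y + χ / 2)` in `𝕜[y][[w]]`. -/
def midSeries : PowerSeries (Polynomial 𝕜) := wySeries 𝕜 + (2 : 𝕜)⁻¹ • (X * chiSeries n ħ)

theorem X_pow_dvd_chiSeries : X ^ (n + 1) ∣ chiSeries n ħ :=
  smul_X_pow_dvd 𝕜 ħ (dvd_refl _)

theorem X_dvd_midSeries : X ∣ midSeries n ħ :=
  dvd_add ⟨_, rfl⟩ (by
    rw [← pow_one X]; exact smul_X_pow_dvd 𝕜 _ (by rw [pow_one]; exact ⟨_, rfl⟩))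

theorem dy_chiSeries : dy 𝕜 (chiSeries n ħ) = 0 := by
  simp [chiSeries, Derivation.leibniz_pow, dy_X]

theorem dy_midSeries : dy 𝕜 (midSeries n ħ) = X := by
  simp [midSeries, wySeries, dy_chiSeries, dy_X, dy_C]

variable [CharZero 𝕜]

/-- `(- χ w) ^ k / k * B_k (1/2 - y / χ)` in `𝕜[y][[w]]`. -/
def bernoulliSeriesTerm (k : ℕ) : PowerSeries (Polynomial 𝕜) :=
  (k : 𝕜)⁻¹ • bernoulliHom 𝕜 (X * chiSeries n ħ) (midSeries n ħ) k

/-- `w ^ (n + 1) F` in `𝕜[y][[w]]`. -/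
def bernoulliSeries : PowerSeries (Polynomial 𝕜) :=
  evalOne (PowerSeries.mk (bernoulliSeriesTerm n ħ))

theorem X_pow_dvd_bernoulliSeriesTerm (k : ℕ) : X ^ k ∣ bernoulliSeriesTerm n ħ k := by
  refine smul_X_pow_dvd 𝕜 _ (Finset.dvd_sum fun i hi => smul_X_pow_dvd 𝕜 _ ?_)
  have hi : i ≤ k := by simpa [Nat.lt_succ_iff] using hi
  rw [← Nat.add_sub_cancel' hi]
  exact X_pow_dvd_mul (X_pow_dvd_pow ⟨_, rfl⟩ i) (by
    rw [Nat.add_sub_cancel_left]; exact X_pow_dvd_pow (X_dvd_midSeries n ħ) _)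

theorem mk_bernoulliSeriesTerm_mem :
    PowerSeries.mk (bernoulliSeriesTerm n ħ) ∈ convergentSubring (Polynomial 𝕜) := fun k => by
  rw [coeff_mk]; exact X_pow_dvd_bernoulliSeriesTerm n ħ k

theorem X_dvd_bernoulliSeries : X ∣ bernoulliSeries n ħ := X_dvd_evalOne fun k => by
  rw [coeff_mk]
  cases k with
  | zero => simp [bernoulliSeriesTerm]
  | succ k => exact (dvd_pow_self X (Nat.succ_ne_zero k)).trans (X_pow_dvd_bernoulliSeriesTerm n ħ _)

/-- The sum over l is the Taylor expansion of the mean of the k-th term over [y, y + χ], and the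
mean of B_k over a unit interval is the pure power at its left end. -/
theorem sum_dy_bernoulliSeriesTerm (hħ : ħ ≠ 0) {N k : ℕ} (hk : k < N) :
    ∑ l ∈ range N, (((l + 1).factorial : 𝕜)⁻¹) •
      (chiSeries n ħ ^ l * (dy 𝕜)^[l] (bernoulliSeriesTerm n ħ k)) =
        ((k : 𝕜)⁻¹) • midSeries n ħ ^ k := by
  have hd : ∀ l, (dy 𝕜)^[l] (bernoulliSeriesTerm n ħ k) = ((k : 𝕜)⁻¹ * k.descFactorial l) •
      (X ^ l * bernoulliHom 𝕜 (X * chiSeries n ħ) (midSeries n ħ) (k - l)) := by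
    intro l
    have hs : ∀ (c : 𝕜) f, (dy 𝕜)^[l] (c • f) = c • (dy 𝕜)^[l] f := by
      intro c f
      induction l with
      | zero => rfl
      | succ l ih => rw [Function.iterate_succ_apply', ih, Derivation.map_smul, Function.iterate_succ_apply']
    rw [bernoulliSeriesTerm, hs, derivation_iterate_bernoulliHom (dy 𝕜)
      (by simp [dy_chiSeries, dy_X]) (dy_midSeries n ħ) dy_X, smul_smul]
  -- For k = 0 both sides vanish by the convention 0⁻¹ = 0.
  rcases Nat.eq_zero_or_pos k with rfl | hk0
  · simp [hd]
  have hk1 : (k : 𝕜) ≠ 0 := Nat.cast_ne_zero.mpr (by omega)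
  have hk2 : ((k + 1 : ℕ) : 𝕜) ≠ 0 := Nat.cast_ne_zero.mpr (by omega)
  have hχ : X * chiSeries n ħ ≠ 0 :=
    mul_ne_zero X_ne_zero (smul_ne_zero hħ (pow_ne_zero _ X_ne_zero))
  have key := sum_choose_mul_bernoulliHom (𝕜 := 𝕜) hχ (midSeries n ħ) k
  -- The derivative of order l leaves the Bernoulli polynomial of index j = k - l. Derivatives of
  -- order l > k vanish, so the bound N plays no role.
  rw [← Finset.sum_range_reflect] at key
  have h2 := congrArg (fun t => ((k : 𝕜)⁻¹ * ((k + 1 : ℕ) : 𝕜)⁻¹) • t) key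
  rw [smul_smul, mul_assoc, inv_mul_cancel₀ hk2, mul_one, Finset.smul_sum] at h2
  rw [← h2]
  symm
  refine Finset.sum_subset_zero_on_sdiff (Finset.range_mono (by omega)) ?_ ?_
  · intro l hl
    have hl : k < l := by
      have := (Finset.mem_sdiff.mp hl).2
      simp only [Finset.mem_range] at this
      omega
    rw [hd, Nat.descFactorial_eq_zero_iff_lt.mpr hl]
    simp
  · intro l hl
    have hl : l ≤ k := by simpa [Nat.lt_succ_iff] using hl
    rw [hd, smul_smul, mul_smul_comm, smul_smul, show k + 1 - 1 - l = k - l by omega,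
      show k - (k - l) = l by omega, mul_pow, ← mul_assoc, mul_comm (X ^ l)]
    rw [mul_assoc (chiSeries n ħ ^ l)]
    congr 1
    rw [← Nat.choose_symm (show k - l ≤ k + 1 by omega), show k + 1 - (k - l) = l + 1 by omega]
    have hf : ((l + 1).factorial : 𝕜) ≠ 0 := Nat.cast_ne_zero.mpr (Nat.factorial_ne_zero _)
    have h3 : ((k + 1 : ℕ) : 𝕜) * (k.descFactorial l : 𝕜) =
        ((l + 1).factorial : 𝕜) * ((k + 1).choose (l + 1) : 𝕜) := by
      have := Nat.descFactorial_eq_factorial_mul_choose (k + 1) (l + 1)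
      rw [Nat.succ_descFactorial_succ] at this
      exact_mod_cast this
    field_simp
    linear_combination -h3

/-- The termwise means are the powers of w(y + χ/2) divided by k, which add up to the logarithm.
Modulo w^N only k, l < N matter, so the two sums can be exchanged. -/
theorem evalOne_taylor_bernoulliSeries (hħ : ħ ≠ 0) :
    evalOne (X * PowerSeries.mk (fun l => (((l + 1).factorial : 𝕜)⁻¹) •
      (chiSeries n ħ ^ l * (dy 𝕜)^[l] (bernoulliSeries n ħ)))) = plog 𝕜 (midSeries n ħ) := by
  have hadd : ∀ (l : ℕ) f g, (dy 𝕜)^[l] (f - g) = (dy 𝕜)^[l] f - (dy 𝕜)^[l] g := by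
    intro l f g
    induction l with
    | zero => rfl
    | succ l ih => rw [Function.iterate_succ_apply', ih, map_sub, Function.iterate_succ_apply',
        Function.iterate_succ_apply']
  have hsum : ∀ (l : ℕ) (s : Finset ℕ) (f : ℕ → PowerSeries (Polynomial 𝕜)),
      (dy 𝕜)^[l] (∑ k ∈ s, f k) = ∑ k ∈ s, (dy 𝕜)^[l] (f k) := by
    intro l s f
    induction l with
    | zero => rfl
    | succ l ih => simp only [Function.iterate_succ_apply', ih, map_sum]
  have hχ : X ∣ chiSeries n ħ :=
    (dvd_pow_self X (Nat.succ_ne_zero n)).trans (X_pow_dvd_chiSeries n ħ)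
  have hmem : X * PowerSeries.mk (fun l => (((l + 1).factorial : 𝕜)⁻¹) •
      (chiSeries n ħ ^ l * (dy 𝕜)^[l] (bernoulliSeries n ħ))) ∈
        convergentSubring (Polynomial 𝕜) := by
    intro l
    cases l with
    | zero => simp
    | succ l =>
      rw [coeff_succ_X_mul, coeff_mk]
      exact smul_X_pow_dvd 𝕜 _ (X_pow_dvd_mul (X_pow_dvd_pow hχ l) (by
        simpa using X_pow_dvd_dy_iterate (a := 1) (by simpa using X_dvd_bernoulliSeries n ħ) l))
  refine eq_of_forall_X_pow_dvd_sub fun N => ?_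
  have h1 := X_pow_dvd_of_le (Nat.le_succ N) (X_pow_dvd_evalOne_sub hmem (N + 1))
  have h2 := X_pow_dvd_evalOne_sub
    (logS_mem_convergentSubring (𝕜 := 𝕜) (X_dvd_midSeries n ħ)) N
  rw [Finset.sum_range_succ'] at h1
  simp only [coeff_succ_X_mul, coeff_mk, coeff_zero_X_mul, add_zero] at h1
  simp only [coeff_logS] at h2
  have h3 : X ^ N ∣ ∑ l ∈ range N, (((l + 1).factorial : 𝕜)⁻¹) •
      (chiSeries n ħ ^ l * (dy 𝕜)^[l] (bernoulliSeries n ħ)) -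
        ∑ l ∈ range N, ((l : 𝕜)⁻¹) • midSeries n ħ ^ l := by
    have hb := X_pow_dvd_evalOne_sub (mk_bernoulliSeriesTerm_mem n ħ) N
    rw [← Finset.sum_congr rfl fun k hk =>
        sum_dy_bernoulliSeriesTerm n ħ hħ (Finset.mem_range.mp hk), Finset.sum_comm,
      ← Finset.sum_sub_distrib]
    refine Finset.dvd_sum fun l _ => ?_
    rw [← Finset.smul_sum, ← smul_sub, ← Finset.mul_sum, ← mul_sub]
    refine smul_X_pow_dvd 𝕜 _ (dvd_mul_of_dvd_right ?_ _)
    rw [← hsum, ← hadd]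
    refine X_pow_dvd_dy_iterate ?_ l
    simpa [bernoulliSeries] using hb
  have := dvd_sub (dvd_add h1 h3) h2
  simpa [plog] using this

variable {n ħ}

/-- The Bernoulli series is designed for this: it moves the factor 1 - w(Q + χ/2) of the curve into
the exponent. The integral condition is the commutative identity in 𝕜[y][[w]], evaluated at y = Q.
-/
theorem pexp_sub_bernoulliSeries {S : Type*} [Ring S] [Algebra 𝕜 S] (hħ : ħ ≠ 0)
    {Q A : PowerSeries S} (h : Q * A = A * Q + evalSeries 𝕜 Q (chiSeries n ħ)) (hA : X ∣ A) :
    pexp 𝕜 (A - evalSeries 𝕜 Q (bernoulliSeries n ħ)) =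
      pexp 𝕜 A * (1 - evalSeries 𝕜 Q (midSeries n ħ)) := by
  have hχ : X ∣ chiSeries n ħ :=
    (dvd_pow_self X (Nat.succ_ne_zero n)).trans (X_pow_dvd_chiSeries n ħ)
  refine pexp_sub_evalSeries h ?_ hA (X_dvd_extend _ hχ) (X_dvd_extend _ (X_dvd_midSeries n ħ))
    (X_dvd_bernoulliSeries n ħ) ?_
  · intro y
    rw [chiSeries, evalSeries, extend_smul, map_pow, extend_X]
    exact (((commute_X y).symm).pow_left _).smul_left _
  · rw [evalSeries, ← extend_plog _ (X_dvd_midSeries n ħ), ← evalOne_taylor_bernoulliSeries n ħ hħ,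
      extend_evalOne]
    · congr 1
      rw [map_mul, map_X]
      congr 1
      ext1 l
      rw [coeff_map, coeff_mk, coeff_mk, extend_smul, map_mul, map_pow]
    · intro l
      cases l with
      | zero => simp
      | succ l =>
        rw [coeff_succ_X_mul, coeff_mk]
        exact smul_X_pow_dvd 𝕜 _ (X_pow_dvd_mul (X_pow_dvd_pow hχ l) (by
          simpa using X_pow_dvd_dy_iterate (a := 1) (by simpa using X_dvd_bernoulliSeries n ħ) l))

end BernoulliSeries

/-! ### Power series of operators acting on 𝕜((z⁻¹))[[w]]. -/

section Action

open PowerSeries Finset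

variable {𝕜 : Type*} [Field 𝕜]

variable (𝕜) in
/-- `𝕜[[w]]`-linear operators on `𝕜((z⁻¹))[[w]]`, as power series in `w`. -/
abbrev OpSeries : Type _ := PowerSeries (LaurentEnd 𝕜)

/-- The action of a power series of operators, as an additive map. -/
def actHom (a : OpSeries 𝕜) : Op 𝕜 where
  toFun f := PowerSeries.mk fun m => ∑ p ∈ antidiagonal m, coeff p.1 a (coeff p.2 f)
  map_zero' := by ext1 m; simp
  map_add' f g := by ext1 m; simp [Finset.sum_add_distrib]

theorem coeff_actHom (a : OpSeries 𝕜) (f : Space 𝕜) (m : ℕ) :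
    coeff m (actHom a f) = ∑ p ∈ antidiagonal m, coeff p.1 a (coeff p.2 f) :=
  coeff_mk m fun m => ∑ p ∈ antidiagonal m, coeff p.1 a (coeff p.2 f)

/-- The action of a power series of operators. -/
def act : OpSeries 𝕜 →+* Op 𝕜 where
  toFun := actHom
  map_one' := by
    ext1 f
    ext1 m
    change coeff m (actHom 1 f) = coeff m f
    rw [coeff_actHom, Finset.sum_eq_single (0, m)]
    · simp
    · intro p hp hne
      have := Finset.HasAntidiagonal.mem_antidiagonal.mp hp
      rw [coeff_one, if_neg, LinearMap.zero_apply]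
      rintro h0
      exact hne (Prod.ext h0 (by simp only; omega))
    · simp
  map_zero' := by
    ext1 f
    ext1 m
    change coeff m (actHom 0 f) = coeff m 0
    simp [coeff_actHom]
  map_add' a b := by
    ext1 f
    ext1 m
    change coeff m (actHom (a + b) f) = coeff m (actHom a f + actHom b f)
    simp [coeff_actHom, Finset.sum_add_distrib]
  map_mul' a b := by
    ext1 f
    ext1 m
    change coeff m (actHom (a * b) f) = coeff m (actHom a (actHom b f))
    simp only [coeff_actHom, coeff_mul, LinearMap.sum_apply, Module.End.mul_apply, map_sum]
    rw [Finset.sum_sigma', Finset.sum_sigma']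
    refine Finset.sum_nbij' (fun x => ⟨(x.2.1, x.2.2 + x.1.2), (x.2.2, x.1.2)⟩)
      (fun x => ⟨(x.1.1 + x.2.1, x.2.2), (x.1.1, x.2.1)⟩) ?_ ?_ ?_ ?_ ?_
    all_goals
      rintro ⟨⟨i, j⟩, ⟨k, l⟩⟩
      simp only [Finset.mem_sigma, Finset.HasAntidiagonal.mem_antidiagonal]
      rintro ⟨h1, h2⟩
      subst h1; subst h2; simp [add_assoc]

theorem act_mul_apply (a b : OpSeries 𝕜) (f : Space 𝕜) : act (a * b) f = act a (act b f) := by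
  rw [map_mul]; rfl

theorem coeff_act (a : OpSeries 𝕜) (f : Space 𝕜) (m : ℕ) :
    coeff m (act a f) = ∑ p ∈ antidiagonal m, coeff p.1 a (coeff p.2 f) :=
  coeff_actHom a f m

theorem coeff_act_C (a : OpSeries 𝕜) (f : LaurentSeries 𝕜) (m : ℕ) :
    coeff m (act a (C f)) = coeff m a f := by
  rw [coeff_act, Finset.sum_eq_single (m, 0)]
  · simp
  · intro p hp hne
    have := Finset.HasAntidiagonal.mem_antidiagonal.mp hp
    rw [coeff_C, if_neg, map_zero]
    rintro h0
    exact hne (Prod.ext (by simp only; omega) h0)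
  · simp

theorem coeff_act_C_left (a : LaurentEnd 𝕜) (f : Space 𝕜) (m : ℕ) :
    coeff m (act (C a) f) = a (coeff m f) := by
  rw [coeff_act, Finset.sum_eq_single (0, m)]
  · simp
  · intro p hp hne
    have := Finset.HasAntidiagonal.mem_antidiagonal.mp hp
    rw [coeff_C, if_neg, LinearMap.zero_apply]
    rintro h0
    exact hne (Prod.ext h0 (by simp only; omega))
  · simp

/-- Multiplication operators, as power series of operators. -/
def mulS : Space 𝕜 →+* OpSeries 𝕜 := PowerSeries.map mulL

theorem coeff_mulS (g : Space 𝕜) (m : ℕ) : coeff m (mulS g) = mulL (coeff m g) := coeff_map _ _ _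

theorem act_mulS (g : Space 𝕜) : act (mulS g) = mulOp g := by
  ext1 f
  ext1 m
  rw [coeff_act, mulOp_apply, coeff_mul]
  exact Finset.sum_congr rfl fun p _ => by rw [coeff_mulS, mulL_apply]

theorem mulS_w : mulS (w 𝕜) = X := map_X _

theorem mulS_cst (c : 𝕜) : mulS (cst c) = algebraMap 𝕜 (OpSeries 𝕜) c := by
  rw [mulS, cst, map_C, mulL_C, PowerSeries.algebraMap_apply]

variable (𝕜) in
/-- `∂/∂z` as a power series of operators. -/
def dS : OpSeries 𝕜 := C (dL 𝕜)

theorem act_dS : act (dS 𝕜) = dz 𝕜 := by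
  ext1 f
  ext1 m
  rw [dS, coeff_act_C_left, coeff_dz, dL_apply]

theorem coeff_dz' (m : ℕ) (f : Space 𝕜) : coeff m (dz 𝕜 f) = dL 𝕜 (coeff m f) := by
  rw [coeff_dz, dL_apply]

theorem act_X (f : Space 𝕜) : act X f = w 𝕜 * f := by rw [← mulS_w, act_mulS, mulOp_apply]

theorem act_X_pow (k : ℕ) (f : Space 𝕜) : act (X ^ k) f = w 𝕜 ^ k * f := by
  rw [← mulS_w, ← map_pow, act_mulS, mulOp_apply]

theorem act_w_pow_mul (a : OpSeries 𝕜) (k : ℕ) (f : Space 𝕜) :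
    act a (w 𝕜 ^ k * f) = w 𝕜 ^ k * act a f := by
  rw [← act_X_pow, ← act_X_pow, ← act_mul_apply, ← act_mul_apply, (commute_X_pow a k).eq]

theorem act_smul (c : 𝕜) (a : OpSeries 𝕜) (f : Space 𝕜) : act (c • a) f = cst c * act a f := by
  rw [Algebra.smul_def, map_mul, ← mulS_cst, act_mulS]; rfl

theorem dS_mul_mulS (g : Space 𝕜) : dS 𝕜 * mulS g = mulS g * dS 𝕜 + mulS (dz 𝕜 g) := by
  ext1 m
  rw [map_add, dS, coeff_C_mul, coeff_mul_C, coeff_mulS, coeff_mulS, coeff_dz', dL_comm_mulL]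

theorem dz_mul (f g : Space 𝕜) : dz 𝕜 (f * g) = dz 𝕜 f * g + f * dz 𝕜 g := by
  have := congrArg (fun a => act a g) (dS_mul_mulS f)
  simp only [map_add, map_mul, act_mulS, act_dS] at this
  change dz 𝕜 (f * g) = f * dz 𝕜 g + dz 𝕜 f * g at this
  rw [this, add_comm]

end Action

/-! ### The filtration, coefficient by coefficient in w. -/

section Filtration

open PowerSeries Finset

variable {𝕜 : Type*} [Field 𝕜] {S : Type*} [Ring S] [Algebra 𝕜 S]

/-- The power series with all coefficients in `F`. -/
def coeffwise (F : Submodule 𝕜 S) : Submodule 𝕜 (PowerSeries S) where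
  carrier := {f | ∀ m, coeff m f ∈ F}
  add_mem' hf hg m := by rw [map_add]; exact add_mem (hf m) (hg m)
  zero_mem' m := by rw [map_zero]; exact zero_mem _
  smul_mem' c f hf m := by rw [coeff_smul]; exact F.smul_mem c (hf m)

theorem coeffwise_mono {F G : Submodule 𝕜 S} (h : F ≤ G) : coeffwise F ≤ coeffwise G :=
  fun _ hf m => h (hf m)

theorem X_pow_mul_mem_coeffwise {F : Submodule 𝕜 S} (k : ℕ) {f : PowerSeries S} :
    X ^ k * f ∈ coeffwise F ↔ f ∈ coeffwise F := by
  constructor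
  · intro h m
    have := h (m + k)
    rwa [coeff_X_pow_mul] at this
  · intro h m
    rw [coeff_X_pow_mul']
    split_ifs
    · exact h _
    · exact zero_mem _

theorem evalOne_mem_coeffwise {F : Submodule 𝕜 S} {f : PowerSeries (PowerSeries S)}
    (hf : f ∈ coeffwise (coeffwise F)) : evalOne f ∈ coeffwise F := fun m => by
  rw [coeff_evalOne']; exact sum_mem fun l _ => hf l m

/-- The filtration of `OpSeries 𝕜` by the degree of the coefficients in `z`. -/
def filS (r : ℤ) : Submodule 𝕜 (OpSeries 𝕜) := coeffwise (fil r)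

theorem filS_mono {r s : ℤ} (h : r ≤ s) : filS (𝕜 := 𝕜) r ≤ filS s := coeffwise_mono (fil_mono h)

theorem mul_mem_filS {r s t : ℤ} (h : r + s ≤ t) {a b : OpSeries 𝕜} (ha : a ∈ filS r)
    (hb : b ∈ filS s) : a * b ∈ filS t := fun m => by
  rw [coeff_mul]
  exact sum_mem fun p _ => fil_mono h (mul_mem_fil (ha p.1) (hb p.2))

theorem one_mem_filS : (1 : OpSeries 𝕜) ∈ filS 0 := fun m => by
  rw [coeff_one]
  split_ifs
  · exact one_mem_fil
  · exact zero_mem (fil (𝕜 := 𝕜) 0)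

theorem dS_mem_filS : dS 𝕜 ∈ filS 0 := fun m => by
  rw [dS, coeff_C]
  split_ifs
  · exact dL_mem_fil
  · exact zero_mem (fil (𝕜 := 𝕜) 0)

theorem mulS_mem_filS {r : ℤ} {g : Space 𝕜} (hg : ∀ m, ZDegLE r (coeff m g)) :
    mulS g ∈ filS r := fun m => by rw [coeff_mulS]; exact mulL_mem_fil (hg m)

end Filtration

/-! ### Convergence uniform in z. -/

section Convergence

open PowerSeries Finset

variable {𝕜 : Type*} [Field 𝕜]

/-- A sequence which tends to zero uniformly in `z`: for each `m`, the degree in `z` of the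
coefficient of `w ^ m` tends to `-∞`. -/
def IsNull (u : ℕ → Space 𝕜) : Prop :=
  ∀ (m : ℕ) (L : ℤ), ∀ᶠ k in atTop, ZDegLE L (coeff m (u k))

theorem IsNull.add {u v : ℕ → Space 𝕜} (hu : IsNull u) (hv : IsNull v) :
    IsNull fun k => u k + v k := fun m L => by
  filter_upwards [hu m L, hv m L] with k h1 h2
  rw [map_add]; exact h1.add h2

/-- Every coefficient raises the degree in `z` by a bounded amount. -/
def IsBoundedOp (a : OpSeries 𝕜) : Prop := ∀ m, ∃ r, coeff m a ∈ degLE r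

theorem isBoundedOp_of_mem_filS {r : ℤ} {a : OpSeries 𝕜} (ha : a ∈ filS r) : IsBoundedOp a :=
  fun m => ⟨r, fil_le_degLE r (ha m)⟩

theorem isBoundedOp_mulS (g : Space 𝕜) : IsBoundedOp (mulS g) := fun m => by
  obtain ⟨r, hr⟩ := exists_zDegLE (coeff m g)
  exact ⟨r, by rw [coeff_mulS]; exact mulL_mem_degLE hr⟩

theorem isBoundedOp_dS : IsBoundedOp (dS 𝕜) := isBoundedOp_of_mem_filS dS_mem_filS

/-- The reason for a uniform notion: one coefficient of the image may depend on ever higher powers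
of z in u k, which coefficientwise convergence does not control. -/
theorem IsNull.act {a : OpSeries 𝕜} (ha : IsBoundedOp a) {u : ℕ → Space 𝕜} (hu : IsNull u) :
    IsNull fun k => act a (u k) := fun m L => by
  choose r hr using ha
  have : ∀ p ∈ antidiagonal m, ∀ᶠ k in atTop, ZDegLE (L - r p.1) (coeff p.2 (u k)) :=
    fun p _ => hu _ _
  filter_upwards [(Filter.eventually_all_finset _).mpr this] with k hk
  rw [coeff_act]
  exact ZDegLE.sum _ fun p hp => (hr p.1 _ _ (hk p hp)).mono (by omega)

theorem eq_zero_of_isNull_const {s : Space 𝕜} (h : IsNull fun _ => s) : s = 0 := by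
  ext1 m
  refine eq_zero_of_zDegLE fun k => ⟨-k, le_rfl, ?_⟩
  obtain ⟨_, h⟩ := (h m (-k)).exists
  exact h

/-- Convergence of a series, uniform in `z`. -/
def StrongHasSum (u : ℕ → Space 𝕜) (s : Space 𝕜) : Prop :=
  IsNull fun N => s - ∑ k ∈ Finset.range N, u k

/-- Only finitely many terms reach a given power of z, and the finitely many terms of positive
degree have a common degree bound, so the coefficientwise sum is again a Laurent series. -/
theorem IsNull.exists_strongHasSum {u : ℕ → Space 𝕜} (hu : IsNull u) : ∃ s, StrongHasSum u s := by
  have hK : ∀ m L, ∃ K, ∀ k ≥ K, ZDegLE L (coeff m (u k)) :=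
    fun m L => Filter.eventually_atTop.mp (hu m L)
  choose K hK using hK
  have hbdd : ∀ m, ∃ b : ℤ, ∀ i < b, ∀ k, (coeff m (u k)).coeff i = 0 := by
    intro m
    choose L hL using fun k => exists_zDegLE (coeff m (u k))
    obtain ⟨M, hM⟩ := (Finset.finite_toSet ((Finset.range (K m 0)).image L)).bddAbove
    refine ⟨-max M 0, fun i hi k => ?_⟩
    by_cases h : k < K m 0
    · have : L k ≤ M := hM (by simpa using ⟨k, h, rfl⟩)
      exact hL k i (by omega)
    · exact hK m 0 k (by omega) i (by omega)
  choose b hb using hbdd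
  refine ⟨PowerSeries.mk fun m => HahnSeries.ofSuppBddBelow
    (fun i => ∑ k ∈ range (K m (-(i + 1))), (coeff m (u k)).coeff i) ⟨b m, ?_⟩, ?_⟩
  · intro i hi
    by_contra h
    exact hi (Finset.sum_eq_zero fun k _ => hb m i (by omega) k)
  · intro m L
    filter_upwards [Filter.eventually_ge_atTop (K m L)] with N hN i hi
    rw [map_sub, coeff_mk, HahnSeries.coeff_sub, map_sum, HahnSeries.coeff_sum, sub_eq_zero]
    change ∑ k ∈ range (K m (-(i + 1))), (coeff m (u k)).coeff i = _
    rcases le_total (K m (-(i + 1))) N with h | h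
    · refine Finset.sum_subset (Finset.range_mono h) fun k _ hk => ?_
      exact hK m _ k (by simpa using hk) i (by omega)
    · refine (Finset.sum_subset (Finset.range_mono h) fun k _ hk => ?_).symm
      have hk : N ≤ k := by simpa using hk
      exact hK m L k (by omega) i hi

theorem StrongHasSum.formalHasSum {u : ℕ → Space 𝕜} {s : Space 𝕜} (h : StrongHasSum u s) :
    FormalHasSum u s := fun m i => by
  filter_upwards [h m (-(i + 1))] with N hN
  have := hN i (by omega)
  rw [map_sub, HahnSeries.coeff_sub, sub_eq_zero] at this
  exact this.symm

theorem FormalHasSum.unique {u : ℕ → Space 𝕜} {s s' : Space 𝕜} (h : FormalHasSum u s)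
    (h' : FormalHasSum u s') : s = s' := by
  ext m i
  obtain ⟨N, h1, h2⟩ := ((h m i).and (h' m i)).exists
  rw [← h1, ← h2]

theorem FormalHasSum.formalSum_eq {u : ℕ → Space 𝕜} {s : Space 𝕜} (h : FormalHasSum u s) :
    formalSum u = s := by
  have h' : ∃ s, FormalHasSum u s := ⟨s, h⟩
  rw [formalSum, dif_pos h']
  exact h'.choose_spec.unique h

theorem StrongHasSum.unique {u : ℕ → Space 𝕜} {s s' : Space 𝕜} (h : StrongHasSum u s)
    (h' : StrongHasSum u s') : s = s' := h.formalHasSum.unique h'.formalHasSum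

theorem StrongHasSum.add {u v : ℕ → Space 𝕜} {s t : Space 𝕜} (hu : StrongHasSum u s)
    (hv : StrongHasSum v t) : StrongHasSum (fun k => u k + v k) (s + t) := by
  have := IsNull.add hu hv
  simp only [StrongHasSum, Finset.sum_add_distrib, add_sub_add_comm] at this ⊢
  exact this

theorem StrongHasSum.act {a : OpSeries 𝕜} (ha : IsBoundedOp a) {u : ℕ → Space 𝕜} {s : Space 𝕜}
    (h : StrongHasSum u s) : StrongHasSum (fun k => DeformedGKM.act a (u k))
      (DeformedGKM.act a s) := by
  simpa only [StrongHasSum, map_sub, map_sum] using IsNull.act ha h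

theorem StrongHasSum.mul_left (g : Space 𝕜) {u : ℕ → Space 𝕜} {s : Space 𝕜}
    (h : StrongHasSum u s) : StrongHasSum (fun k => g * u k) (g * s) := by
  simpa only [act_mulS, mulOp_apply] using h.act (isBoundedOp_mulS g)

end Convergence

/-! ### Comparing exponents modulo 𝒟₋. -/

section FormalLogarithm

open PowerSeries Finset

variable {𝕜 : Type*} [Field 𝕜]

theorem pow_mem_filS_zero {a : OpSeries 𝕜} (ha : a ∈ filS 0) (k : ℕ) : a ^ k ∈ filS 0 := by
  induction k with
  | zero => rw [pow_zero]; exact one_mem_filS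
  | succ k ih => rw [pow_succ]; exact mul_mem_filS (by omega) ih ha

theorem pexp_mem_filS_zero {a : OpSeries 𝕜} (ha : a ∈ filS 0) : pexp 𝕜 a ∈ filS 0 := fun m => by
  rw [pexp, coeff_mk]
  exact sum_mem fun i _ => (fil 0).smul_mem _ (pow_mem_filS_zero ha i m)

theorem pow_sub_pow_mem_filS {a b : OpSeries 𝕜} (ha : a ∈ filS 0) (hb : b ∈ filS 0)
    (hab : a - b ∈ filS (-1)) (k : ℕ) : a ^ k - b ^ k ∈ filS (-1) := by
  induction k with
  | zero => rw [pow_zero, pow_zero, sub_self]; exact zero_mem _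
  | succ k ih =>
    rw [show a ^ (k + 1) - b ^ (k + 1) = (a - b) * a ^ k + b * (a ^ k - b ^ k) by
      rw [pow_succ', pow_succ', sub_mul, mul_sub]; abel]
    exact add_mem (mul_mem_filS (by omega) hab (pow_mem_filS_zero ha k))
      (mul_mem_filS (by omega) hb ih)

/-- Powers of exponent at least 2 gain one order in w from the extra factor. Hence in the
coefficient of w^m of an exponential only the linear term sees the m-th coefficient of the exponent.
-/
theorem X_pow_dvd_pow_sub_pow {S : Type*} [Ring S] {a b : PowerSeries S} (ha : X ∣ a) (hb : X ∣ b)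
    {m : ℕ} (hab : X ^ m ∣ a - b) (k : ℕ) : X ^ (m + 1) ∣ a ^ (k + 2) - b ^ (k + 2) := by
  induction k with
  | zero =>
    rw [show a ^ (0 + 2) - b ^ (0 + 2) = (a - b) * a + b * (a - b) by noncomm_ring]
    refine dvd_add (X_pow_dvd_mul hab (by simpa using ha)) ?_
    rw [add_comm m]
    exact X_pow_dvd_mul (by simpa using hb) hab
  | succ k ih =>
    rw [show a ^ (k + 1 + 2) - b ^ (k + 1 + 2) =
        (a - b) * a ^ (k + 2) + b * (a ^ (k + 2) - b ^ (k + 2)) by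
      rw [show k + 1 + 2 = (k + 2) + 1 by ring, pow_succ' a (k + 2), pow_succ' b (k + 2), sub_mul,
        mul_sub]
      abel]
    refine dvd_add (X_pow_dvd_of_le (by omega) (X_pow_dvd_mul hab (X_pow_dvd_pow ha (k + 2)))) ?_
    exact X_pow_dvd_mul_left _ ih

/-- If the exponentials of two operators agree modulo `𝒟₋`, then so do the operators. -/
theorem sub_mem_filS_of_pexp {a b : OpSeries 𝕜} (ha : X ∣ a) (hb : X ∣ b) (hb0 : b ∈ filS 0)
    (h : pexp 𝕜 a - pexp 𝕜 b ∈ filS (-1)) : a - b ∈ filS (-1) := by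
  intro m
  induction m using Nat.strong_induction_on with
  | _ m ih =>
    rw [← pow_one X, X_pow_dvd_iff] at ha hb
    rcases Nat.eq_zero_or_pos m with rfl | hm
    · rw [map_sub, ha 0 (by omega), hb 0 (by omega), sub_self]
      exact zero_mem _
    -- c equals a below w^m and b from there on. It is congruent to b modulo 𝒟₋ by induction, and
    -- its powers of exponent at least 2 have the same m-th coefficient as those of a.
    · set c : OpSeries 𝕜 := PowerSeries.mk fun i => if i < m then coeff i a else coeff i b with hc
      have hcb : c - b ∈ filS (-1) := by
        intro i
        rw [map_sub, hc, coeff_mk]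
        split_ifs with hi
        · rw [← map_sub]; exact ih i hi
        · rw [sub_self]; exact zero_mem _
      have hc0 : c ∈ filS 0 := by
        rw [← sub_add_cancel c b]
        exact add_mem (filS_mono (by omega) hcb) hb0
      have hac : X ^ m ∣ a - c := by
        rw [X_pow_dvd_iff]
        intro i hi
        rw [map_sub, hc, coeff_mk, if_pos hi, sub_self]
      have hX : ∀ {x : OpSeries 𝕜}, (∀ i < 1, coeff i x = 0) → X ∣ x := fun hx => by
        rw [← pow_one X, X_pow_dvd_iff]; exact hx
      have hcX : X ∣ c := hX fun i hi => by
        rw [hc, coeff_mk]; split_ifs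
        · exact ha i hi
        · exact hb i hi
      have hm1 := h m
      rw [map_sub, coeff_pexp (hX ha) (Nat.le_succ m), coeff_pexp (hX hb) (Nat.le_succ m),
        ← Finset.sum_sub_distrib, Finset.sum_range_succ', Finset.sum_range_succ'] at hm1
      have hrest : ∑ k ∈ range m, (((k + 1 + 1).factorial : 𝕜)⁻¹ • coeff m (a ^ (k + 1 + 1)) -
          ((k + 1 + 1).factorial : 𝕜)⁻¹ • coeff m (b ^ (k + 1 + 1))) ∈ fil (-1) := by
        refine sum_mem fun k _ => ?_
        have h1 := X_pow_dvd_iff.mp (X_pow_dvd_pow_sub_pow (hX ha) hcX hac k) m (by omega)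
        rw [map_sub, sub_eq_zero] at h1
        rw [h1]
        have h2 := (fil (-1)).smul_mem (((k + 1 + 1).factorial : 𝕜)⁻¹)
          (pow_sub_pow_mem_filS hc0 hb0 hcb (k + 2) m)
        rwa [map_sub, smul_sub] at h2
      have h2 := sub_mem hm1 hrest
      simpa using h2

end FormalLogarithm

/-! ### Leading terms of powers of Q̃, and a differential equation in 1 + 𝒟₋. -/

section PowersOfQ

open PowerSeries

variable {𝕜 : Type*} [Field 𝕜]

/-- The filtration of power series in an additional variable over `OpSeries 𝕜`. -/
def filSS (r : ℤ) : Submodule 𝕜 (PowerSeries (OpSeries 𝕜)) := coeffwise (filS r)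

theorem filSS_mono {r s : ℤ} (h : r ≤ s) : filSS (𝕜 := 𝕜) r ≤ filSS s :=
  coeffwise_mono (filS_mono h)

theorem mul_mem_filSS {r s : ℤ} (t : ℤ) (h : r + s ≤ t) {a b : PowerSeries (OpSeries 𝕜)}
    (ha : a ∈ filSS r) (hb : b ∈ filSS s) : a * b ∈ filSS t := fun m => by
  rw [coeff_mul]
  exact sum_mem fun p _ => mul_mem_filS h (ha p.1) (hb p.2)

theorem C_mem_filSS {r : ℤ} {a : OpSeries 𝕜} (ha : a ∈ filS r) : C a ∈ filSS r := fun m => by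
  rw [coeff_C]
  split_ifs
  · exact ha
  · exact zero_mem (filS (𝕜 := 𝕜) r)

theorem X_mul_mem_filSS {r : ℤ} {a : PowerSeries (OpSeries 𝕜)} (ha : a ∈ filSS r) :
    X * a ∈ filSS r := fun m => by
  cases m with
  | zero => rw [coeff_zero_X_mul]; exact zero_mem (filS (𝕜 := 𝕜) r)
  | succ m => rw [coeff_succ_X_mul]; exact ha m

/-- The leading terms of the powers of `z + v ∂ + r`. -/
theorem pow_sub_mem_filSS {n : ℤ} (hn : 1 ≤ n) {ζ v d r : PowerSeries (OpSeries 𝕜)}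
    (hζ : ζ ∈ filSS 1) (hv : v ∈ filSS (1 - n)) (hd : d ∈ filSS 0) (hr : r ∈ filSS (-n))
    (hdz : d * ζ = ζ * d + 1) (hvz : v * ζ = ζ * v) (k : ℕ) :
    (ζ + v * d + r) ^ (k + 1) - ζ ^ (k + 1) - (k + 1) • (ζ ^ k * (v * d)) ∈ filSS (k - n) := by
  have hpow : ∀ k : ℕ, ζ ^ k ∈ filSS k := by
    intro k
    induction k with
    | zero =>
      rw [pow_zero]
      have := C_mem_filSS (one_mem_filS (𝕜 := 𝕜))
      rwa [map_one] at this
    | succ k ih => rw [pow_succ]; exact mul_mem_filSS _ (by push_cast; omega) ih hζ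
  have hvd : v * d ∈ filSS (1 - n) := mul_mem_filSS _ (by omega) hv hd
  have hdpow : ∀ k : ℕ, d * ζ ^ (k + 1) = ζ ^ (k + 1) * d + (k + 1) • ζ ^ k := by
    intro k
    induction k with
    | zero => simp [hdz]
    | succ k ih =>
      rw [pow_succ ζ (k + 1), ← mul_assoc, ih, add_mul, mul_assoc, hdz, mul_add, mul_one,
        ← mul_assoc, smul_mul_assoc, ← pow_succ, ← pow_succ ζ k, add_assoc, succ_nsmul _ (k + 1), add_comm (ζ ^ _)]
  have hvpow : ∀ k : ℕ, v * ζ ^ k = ζ ^ k * v := fun k => (Commute.pow_right hvz k)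
  induction k with
  | zero =>
    have : (ζ + v * d + r) ^ (0 + 1) - ζ ^ (0 + 1) - (0 + 1) • (ζ ^ 0 * (v * d)) = r := by
      rw [zero_add, pow_one, pow_one, one_smul, pow_zero, one_mul]; abel
    rw [this]
    simpa using hr
  | succ k ih =>
    set ρ := (ζ + v * d + r) ^ (k + 1) - ζ ^ (k + 1) - (k + 1) • (ζ ^ k * (v * d)) with hρ
    have hexp : (ζ + v * d + r) ^ (k + 1) = ρ + ζ ^ (k + 1) + (k + 1) • (ζ ^ k * (v * d)) := by
      rw [hρ]; abel
    have h1 : v * d * ζ ^ (k + 1) = ζ ^ (k + 1) * (v * d) + (k + 1) • (ζ ^ k * v) := by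
      rw [mul_assoc, hdpow, mul_add, ← mul_assoc v, hvpow (k + 1), mul_smul_comm, hvpow k,
        mul_assoc]
    have key : (ζ + v * d + r) ^ (k + 1 + 1) - ζ ^ (k + 1 + 1) -
        (k + 1 + 1) • (ζ ^ (k + 1) * (v * d)) =
        (ζ + v * d + r) * ρ + (k + 1) • (ζ ^ k * v) + r * ζ ^ (k + 1) +
          (k + 1) • ((v * d + r) * (ζ ^ k * (v * d))) := by
      rw [pow_succ' (ζ + v * d + r) (k + 1), hexp, mul_add, mul_add, add_mul (ζ + v * d) r (ζ ^ _),
        add_mul ζ (v * d) (ζ ^ _), h1, ← pow_succ', mul_smul_comm, add_assoc ζ (v * d) r,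
        add_mul ζ (v * d + r) (ζ ^ k * _), smul_add, ← mul_assoc ζ, ← pow_succ',
        succ_nsmul _ (k + 1)]
      abel
    rw [key]
    have hq : ζ + v * d + r ∈ filSS 1 :=
      add_mem (add_mem hζ (filSS_mono (by omega) hvd)) (filSS_mono (by omega) hr)
    refine add_mem (add_mem (add_mem ?_ ?_) ?_) ?_
    · exact mul_mem_filSS _ (by push_cast; omega) hq ih
    · exact nsmul_mem (mul_mem_filSS _ (by push_cast; omega) (hpow k) hv) _
    · exact mul_mem_filSS _ (by push_cast; omega) hr (hpow (k + 1))
    -- The quadratic terms have order k + 2 - 2n, which is at most k + 1 - n because n ≥ 1.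
    · refine nsmul_mem (mul_mem_filSS (r := 1 - n) (s := k + 1 - n) _ (by push_cast; omega) ?_ ?_) _
      · exact add_mem hvd (filSS_mono (by omega) hr)
      · exact mul_mem_filSS _ (by omega) (hpow k) hvd

/-- Solutions of `f' = f y + [a, f]` with `y ∈ 𝒟₋` and `f(0) = 1` lie in `1 + 𝒟₋`. -/
theorem sub_one_mem_filSS_of_pderiv [CharZero 𝕜] {f y : PowerSeries (OpSeries 𝕜)} {a : OpSeries 𝕜}
    (ha : a ∈ filS 0) (hy : y ∈ filSS (-1)) (hf : pderiv f = f * y + (C a * f - f * C a))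
    (h0 : coeff 0 f = 1) : f - 1 ∈ filSS (-1) := by
  have key : ∀ l, coeff l f ∈ filS 0 ∧ coeff (l + 1) f ∈ filS (-1) := by
    intro l
    induction l using Nat.strong_induction_on with
    | _ l ih =>
      have hl : ∀ i ≤ l, coeff i f ∈ filS 0 := by
        intro i hi
        cases i with
        | zero => rw [h0]; exact one_mem_filS
        | succ i => exact filS_mono (by omega) (ih i (by omega)).2
      refine ⟨hl l le_rfl, ?_⟩
      have h1 : (l + 1) • coeff (l + 1) f ∈ filS (-1) := by
        rw [← coeff_pderiv, hf, map_add, map_sub, coeff_C_mul, coeff_mul_C, coeff_mul]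
        refine add_mem (sum_mem fun p hp => ?_) ?_
        · have := Finset.HasAntidiagonal.mem_antidiagonal.mp hp
          exact mul_mem_filS (by omega) (hl p.1 (by omega)) (hy p.2)
        -- The operator a has order 0 only, but at l = 0 it enters through [a, 1] = 0, and later
        -- through commutators with coefficients already in 𝒟₋.
        · cases l with
          | zero => rw [h0, mul_one, one_mul, sub_self]; exact zero_mem _
          | succ l =>
            have := (ih l (by omega)).2
            exact sub_mem (mul_mem_filS (by omega) ha this) (mul_mem_filS (by omega) this ha)
      have hl0 : ((l + 1 : ℕ) : 𝕜) ≠ 0 := Nat.cast_ne_zero.mpr (by omega)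
      have h2 := (filS (𝕜 := 𝕜) (-1)).smul_mem (((l + 1 : ℕ) : 𝕜)⁻¹) h1
      rwa [← Nat.cast_smul_eq_nsmul 𝕜, smul_smul, inv_mul_cancel₀ hl0, one_smul] at h2
  intro l
  cases l with
  | zero => rw [map_sub, h0, coeff_zero_one, sub_self]; exact zero_mem (filS (𝕜 := 𝕜) (-1))
  | succ l =>
    rw [map_sub, coeff_one, if_neg (Nat.succ_ne_zero l), sub_zero]
    exact (key l).2

end PowersOfQ

/-! ### Degrees bounded uniformly in w, and calculus in z. -/

section Degree

open PowerSeries Finset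

variable {𝕜 : Type*} [Field 𝕜]

/-- Every coefficient in `w` has degree at most `L` in `z`. -/
def SDegLE (L : ℤ) (g : Space 𝕜) : Prop := ∀ m, ZDegLE L (coeff m g)

theorem SDegLE.mono {L L' : ℤ} {g : Space 𝕜} (h : SDegLE L g) (hL : L ≤ L') : SDegLE L' g :=
  fun m => (h m).mono hL

theorem SDegLE.add {L : ℤ} {f g : Space 𝕜} (hf : SDegLE L f) (hg : SDegLE L g) :
    SDegLE L (f + g) := fun m => by rw [map_add]; exact (hf m).add (hg m)

theorem SDegLE.neg {L : ℤ} {f : Space 𝕜} (hf : SDegLE L f) : SDegLE L (-f) :=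
  fun m => by rw [map_neg]; exact (hf m).neg

theorem SDegLE.sub {L : ℤ} {f g : Space 𝕜} (hf : SDegLE L f) (hg : SDegLE L g) :
    SDegLE L (f - g) := fun m => by rw [map_sub]; exact (hf m).sub (hg m)

theorem SDegLE.sum {ι : Type*} {L : ℤ} (s : Finset ι) {f : ι → Space 𝕜}
    (hf : ∀ k ∈ s, SDegLE L (f k)) : SDegLE L (∑ k ∈ s, f k) := fun m => by
  rw [map_sum]; exact ZDegLE.sum s fun k hk => hf k hk m

theorem SDegLE.mul {L L' : ℤ} {f g : Space 𝕜} (hf : SDegLE L f) (hg : SDegLE L' g) :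
    SDegLE (L + L') (f * g) := fun m => by
  rw [coeff_mul]; exact ZDegLE.sum _ fun p _ => (hf p.1).mul (hg p.2)

theorem sDegLE_C {L : ℤ} {f : LaurentSeries 𝕜} (hf : ZDegLE L f) : SDegLE L (C f) := fun m => by
  rw [coeff_C]; split_ifs
  · exact hf
  · exact ZDegLE.zero _

theorem sDegLE_z : SDegLE 1 (z 𝕜) := sDegLE_C (by
  have := zDegLE_single (-1 : ℤ) (1 : 𝕜)
  rwa [neg_neg] at this)

theorem sDegLE_cst (c : 𝕜) : SDegLE 0 (cst c) :=
  sDegLE_C (by simpa using zDegLE_single (0 : ℤ) c)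

theorem sDegLE_one : SDegLE 0 (1 : Space 𝕜) := by simpa [cst] using sDegLE_cst (1 : 𝕜)

theorem sDegLE_w : SDegLE 0 (w 𝕜) := fun m => by
  rw [w, coeff_X]; split_ifs
  · exact zDegLE_single (0 : ℤ) (1 : 𝕜)
  · exact ZDegLE.zero _

theorem SDegLE.pow {L : ℤ} {f : Space 𝕜} (hf : SDegLE L f) (k : ℕ) : SDegLE (k * L) (f ^ k) := by
  induction k with
  | zero => simpa using sDegLE_one
  | succ k ih => rw [pow_succ]; exact (ih.mul hf).mono (by push_cast; linarith)

theorem SDegLE.dz {L : ℤ} {f : Space 𝕜} (hf : SDegLE L f) : SDegLE (L - 1) (dz 𝕜 f) := fun m => by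
  rw [coeff_dz']; exact (dL_mem_degLE _ L (hf m)).mono (by omega)

variable (𝕜) in
/-- `z⁻¹` in `𝕜((z⁻¹))[[w]]`. -/
def zInv : Space 𝕜 := C (HahnSeries.single (1 : ℤ) (1 : 𝕜))

theorem sDegLE_zInv : SDegLE (-1) (zInv 𝕜) := sDegLE_C (zDegLE_single (1 : ℤ) (1 : 𝕜))

theorem z_mul_zInv : z 𝕜 * zInv 𝕜 = 1 := by
  rw [z, zInv, ← map_mul, zL_mul_single, sub_self]; exact map_one _

theorem cst_mul (a b : 𝕜) : cst (a * b) = cst a * cst b := by rw [cst, map_mul, map_mul]; rfl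

theorem cst_one : cst (1 : 𝕜) = 1 := by simp [cst]

theorem cst_natCast (k : ℕ) : cst (k : 𝕜) = k := by simp [cst]

theorem dz_z : dz 𝕜 (z 𝕜) = 1 := by
  ext1 m
  rw [coeff_dz', z, coeff_C, coeff_one]
  split_ifs
  · exact dL_zL
  · exact map_zero _

theorem dz_w : dz 𝕜 (w 𝕜) = 0 := by
  ext1 m
  rw [coeff_dz', w, coeff_X, map_zero]
  split_ifs
  · ext i; rw [coeff_dL]
    by_cases h : i = 1
    · simp [h]
    · rw [HahnSeries.coeff_one, if_neg (by omega)]; simp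
  · exact map_zero _

theorem dz_cst (c : 𝕜) : dz 𝕜 (cst c) = 0 := by
  ext1 m
  rw [coeff_dz', cst, coeff_C, map_zero]
  split_ifs
  · ext i; rw [coeff_dL]
    by_cases h : i = 1
    · simp [h]
    · rw [HahnSeries.C_apply, HahnSeries.coeff_single_of_ne (by omega)]; simp
  · exact map_zero _

theorem dz_one : dz 𝕜 1 = 0 := by rw [← cst_one, dz_cst]

theorem dz_pow (f : Space 𝕜) (k : ℕ) : dz 𝕜 (f ^ k) = k * f ^ (k - 1) * dz 𝕜 f := by
  induction k with
  | zero => rw [pow_zero, dz_one, Nat.cast_zero, zero_mul, zero_mul]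
  | succ k ih =>
    rw [pow_succ, dz_mul, ih]
    cases k with
    | zero => simp
    | succ k => rw [Nat.add_sub_cancel, Nat.add_sub_cancel]; push_cast; ring

theorem dz_cst_mul (c : 𝕜) (f : Space 𝕜) : dz 𝕜 (cst c * f) = cst c * dz 𝕜 f := by
  rw [dz_mul, dz_cst, zero_mul, zero_add]

theorem dz_w_mul (f : Space 𝕜) : dz 𝕜 (w 𝕜 * f) = w 𝕜 * dz 𝕜 f := by
  rw [dz_mul, dz_w, zero_mul, zero_add]

theorem dz_w_pow_mul (k : ℕ) (f : Space 𝕜) : dz 𝕜 (w 𝕜 ^ k * f) = w 𝕜 ^ k * dz 𝕜 f := by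
  rw [dz_mul, dz_pow, dz_w, mul_zero, zero_mul, zero_add]

theorem dz_zInv : dz 𝕜 (zInv 𝕜) = -zInv 𝕜 ^ 2 := by
  have h := congrArg (dz 𝕜) (z_mul_zInv (𝕜 := 𝕜))
  rw [dz_mul, dz_z, dz_one] at h
  linear_combination zInv 𝕜 * h - dz 𝕜 (zInv 𝕜) * z_mul_zInv (𝕜 := 𝕜)

theorem cst_mul_cst_inv {a : 𝕜} (ha : a ≠ 0) : cst a * cst a⁻¹ = 1 := by
  rw [← cst_mul, mul_inv_cancel₀ ha, cst_one]

theorem coeff_cst_mul (c : 𝕜) (f : Space 𝕜) (m : ℕ) :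
    coeff m (cst c * f) = HahnSeries.C c * coeff m f := coeff_C_mul _ _ _

theorem mulS_cst_mul (c : 𝕜) (g : Space 𝕜) : mulS (cst c * g) = c • mulS g := by
  rw [map_mul, mulS_cst, Algebra.smul_def]

theorem mulS_mem_filS' {r : ℤ} {g : Space 𝕜} (hg : SDegLE r g) : mulS g ∈ filS r :=
  mulS_mem_filS hg

end Degree

/-! ### The potential U and the operator Q̃. -/

section Potential

open PowerSeries Finset

variable {𝕜 : Type*} [Field 𝕜] (n : ℕ) (ħ : 𝕜)

/-- `U⁻¹ = ħ z⁻ⁿ (1 - w z)`. -/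
def uInv : Space 𝕜 := zInv 𝕜 ^ n * (cst ħ * (1 - w 𝕜 * z 𝕜))

theorem zInv_pow_mul_z_pow : zInv 𝕜 ^ n * z 𝕜 ^ n = 1 := by
  rw [← mul_pow, mul_comm, z_mul_zInv, one_pow]

theorem sDegLE_uInv : SDegLE (1 - n) (uInv n ħ) := by
  have h1 : SDegLE 1 (1 - w 𝕜 * z 𝕜) :=
    (sDegLE_one.mono (by omega)).sub ((sDegLE_w.mul sDegLE_z).mono (by omega))
  exact ((sDegLE_zInv.pow n).mul ((sDegLE_cst ħ).mul h1)).mono (by linarith)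

variable {ħ}

theorem potU_mul_uInv (hħ : ħ ≠ 0) : potU n ħ * uInv n ħ = 1 := by
  rw [potU, uInv]
  have h : (cst ħ * (1 - w 𝕜 * z 𝕜))⁻¹ * (cst ħ * (1 - w 𝕜 * z 𝕜)) = 1 := by
    refine PowerSeries.inv_mul_cancel _ ?_
    simp [w, cst, hħ]
  linear_combination zInv 𝕜 ^ n * z 𝕜 ^ n * h + zInv_pow_mul_z_pow (𝕜 := 𝕜) n

theorem potU_inv (hħ : ħ ≠ 0) : (potU n ħ)⁻¹ = uInv n ħ := by
  have h0 : constantCoeff (potU n ħ) ≠ 0 := fun h => by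
    have := congrArg constantCoeff (potU_mul_uInv n hħ)
    rw [map_mul, h, zero_mul, map_one] at this
    exact zero_ne_one this
  have := PowerSeries.mul_inv_cancel (potU n ħ) h0
  linear_combination uInv n ħ * this - (potU n ħ)⁻¹ * potU_mul_uInv n hħ

theorem dz_uInv (hħ : ħ ≠ 0) : dz 𝕜 (uInv n ħ) = -(dz 𝕜 (potU n ħ) * uInv n ħ ^ 2) := by
  have h := congrArg (dz 𝕜) (potU_mul_uInv n hħ)
  rw [dz_mul, dz_one] at h
  linear_combination uInv n ħ * h - dz 𝕜 (uInv n ħ) * potU_mul_uInv n hħ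

variable (ħ) in
/-- The operator `Q̃_U` as a power series of operators. -/
def qS : OpSeries 𝕜 :=
  mulS (z 𝕜) + mulS (uInv n ħ) * dS 𝕜 + mulS (cst (2 : 𝕜)⁻¹ * dz 𝕜 (uInv n ħ))

theorem act_qS (hħ : ħ ≠ 0) : act (qS n ħ) = Qtilde n ħ := by
  rw [qS, Qtilde, map_add, map_add, map_mul, act_mulS, act_mulS, act_mulS, act_dS, potU_inv n hħ,
    dz_uInv n hħ, sub_eq_add_neg, ← map_neg]
  congr 2
  ring

theorem qS_mul_mulS (g : Space 𝕜) :
    qS n ħ * mulS g = mulS g * qS n ħ + mulS (uInv n ħ * dz 𝕜 g) := by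
  have h1 : ∀ f : Space 𝕜, mulS f * mulS g = mulS g * mulS f := fun f => by
    rw [← map_mul, mul_comm, map_mul]
  rw [qS, add_mul, add_mul, mul_add, mul_add, h1, h1, mul_assoc, dS_mul_mulS, mul_add, ← mul_assoc,
    h1, mul_assoc, map_mul mulS (uInv n ħ) (dz 𝕜 g)]
  abel

theorem dL_C_mul_zL_pow (c : 𝕜) (m : ℕ) :
    dL 𝕜 (HahnSeries.C c * zL 𝕜 ^ (m + 1)) = HahnSeries.C (c * (m + 1 : ℕ)) * zL 𝕜 ^ m := by
  have := congrArg (coeff 0) (dz_cst_mul c (z 𝕜 ^ (m + 1)))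
  rw [dz_pow, dz_z, coeff_dz', coeff_cst_mul, coeff_cst_mul, z, ← map_pow, coeff_zero_C,
    ← cst_natCast, mul_one, Nat.add_sub_cancel, coeff_cst_mul, ← map_pow, coeff_zero_C] at this
  rw [this, ← mul_assoc, ← map_mul]

/-- Series with geometric coefficients. -/
theorem one_sub_mul_mk (f : LaurentSeries 𝕜) :
    (1 - w 𝕜 * z 𝕜) * PowerSeries.mk (fun k => zL 𝕜 ^ k * f) = C f := by
  ext1 m
  rw [sub_mul, one_mul, map_sub, coeff_mk, mul_assoc, w, z]
  cases m with
  | zero => rw [coeff_zero_X_mul]; simp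
  | succ m => rw [coeff_succ_X_mul, coeff_C_mul, coeff_mk, coeff_C, if_neg (by omega)]; ring

variable (𝕜) in
/-- `-log (1 - w z)`. -/
def logZ : Space 𝕜 := PowerSeries.mk fun m => HahnSeries.C (m : 𝕜)⁻¹ * zL 𝕜 ^ m

theorem mulS_logZ : mulS (logZ 𝕜) = plog 𝕜 (X * C (mulL (zL 𝕜))) := by
  ext1 m
  have hc : ∀ l, coeff m (coeff l (logS 𝕜 (X * C (mulL (zL 𝕜))))) =
      if m = l then (l : 𝕜)⁻¹ • mulL (zL 𝕜) ^ l else 0 := by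
    intro l
    rw [coeff_logS, (commute_X _).symm.mul_pow, coeff_smul, coeff_X_pow_mul',
      ← map_pow, coeff_C]
    split_ifs <;> first | rfl | omega | simp
  rw [plog, coeff_evalOne', Finset.sum_congr rfl fun l _ => hc l, Finset.sum_ite_eq,
    if_pos (by simp), coeff_mulS, logZ, coeff_mk, map_mul, mulL_C, map_pow, Algebra.smul_def]

variable [CharZero 𝕜]

theorem dz_potV' (hħ : ħ ≠ 0) : dz 𝕜 (potV' 𝕜 n) = cst ħ * potU n ħ := by
  have h1 : (1 - w 𝕜 * z 𝕜) * dz 𝕜 (potV' 𝕜 n) = z 𝕜 ^ n := by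
    rw [z, ← map_pow, ← one_sub_mul_mk (zL 𝕜 ^ n)]
    congr 1
    ext1 m
    have h0 : ((m + n + 1 : ℕ) : 𝕜) ≠ 0 := Nat.cast_ne_zero.mpr (by omega)
    rw [coeff_dz', potV', coeff_mk, coeff_mk, dL_C_mul_zL_pow, inv_mul_cancel₀ h0, map_one,
      one_mul, pow_add]
  have h2 : uInv n ħ * dz 𝕜 (potV' 𝕜 n) = cst ħ := by
    rw [uInv]
    linear_combination zInv 𝕜 ^ n * cst ħ * h1 + cst ħ * zInv_pow_mul_z_pow (𝕜 := 𝕜) n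
  linear_combination potU n ħ * h2 - dz 𝕜 (potV' 𝕜 n) * potU_mul_uInv n hħ

theorem uInv_mul_dz_potV' (hħ : ħ ≠ 0) : uInv n ħ * dz 𝕜 (potV' 𝕜 n) = cst ħ := by
  rw [dz_potV' n hħ]
  linear_combination cst ħ * potU_mul_uInv n hħ

theorem one_sub_mul_dz_logZ : (1 - w 𝕜 * z 𝕜) * dz 𝕜 (logZ 𝕜) = w 𝕜 := by
  have h : dz 𝕜 (logZ 𝕜) = w 𝕜 * PowerSeries.mk (fun k => zL 𝕜 ^ k * 1) := by
    ext1 m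
    rw [coeff_dz', logZ, coeff_mk, w]
    cases m with
    | zero => rw [coeff_zero_X_mul]; simp
    | succ m =>
      have h0 : ((m + 1 : ℕ) : 𝕜) ≠ 0 := Nat.cast_ne_zero.mpr (by omega)
      rw [coeff_succ_X_mul, coeff_mk, dL_C_mul_zL_pow, inv_mul_cancel₀ h0]; simp
  have := one_sub_mul_mk (1 : LaurentSeries 𝕜)
  rw [map_one] at this
  rw [h, mul_left_comm, this, mul_one]

variable (𝕜) in
-- V' is the tail of -log(1 - wz) divided by w^(n+1). So replacing Q̃ by z in the curve exponent
-- leaves exactly -log(1 - wz).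
theorem w_pow_mul_potV' : w 𝕜 ^ (n + 1) * potV' 𝕜 n =
    logZ 𝕜 - ∑ k ∈ Icc 1 n, cst (k : 𝕜)⁻¹ * (w 𝕜 * z 𝕜) ^ k := by
  have hc : ∀ m k : ℕ, coeff m (cst (k : 𝕜)⁻¹ * (w 𝕜 * z 𝕜) ^ k) =
      if m = k then HahnSeries.C (k : 𝕜)⁻¹ * zL 𝕜 ^ k else 0 := by
    intro m k
    rw [coeff_cst_mul, mul_pow, w, z, ← map_pow, coeff_X_pow_mul', coeff_C]
    split_ifs <;> first | rfl | omega | simp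
  ext1 m
  rw [map_sub, map_sum, Finset.sum_congr rfl fun k _ => hc m k, Finset.sum_ite_eq, logZ, coeff_mk,
    w, coeff_X_pow_mul']
  split_ifs with h1 h2 h2
  · simp at h2; omega
  · rw [potV', coeff_mk, sub_zero, show m - (n + 1) + n + 1 = m by omega]
  · rw [sub_self]
  · have : m = 0 := by simp at h2; omega
    simp [this]

end Potential

/-! ### Products of exponentials and conjugated exponents. -/

section Conjugation

open PowerSeries Finset

variable {𝕜 : Type*} [Field 𝕜] {S : Type*} [Ring S] [Algebra 𝕜 S]

theorem coeff_zero_expS_mul (a b c : S) :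
    coeff 0 (expS 𝕜 a * expS 𝕜 b * expS 𝕜 c) = 1 := by
  rw [coeff_zero_mul, coeff_zero_mul, coeff_zero_expS, coeff_zero_expS, coeff_zero_expS, mul_one,
    mul_one]

variable [CharZero 𝕜]

/-- Here l = e^{sx}(a - x)e^{-sx}. Splitting δf as fδ + [δ, f] brings the equation into the form
required by `sub_one_mem_filSS_of_pderiv`, where only l + δ has to lie in 𝒟₋. -/
theorem pderiv_expS_mul {a x δ : S} {l : PowerSeries S}
    (hl : expS 𝕜 x * C (a - x) = l * expS 𝕜 x) :
    pderiv (expS 𝕜 δ * expS 𝕜 a * expS 𝕜 (-x)) =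
      expS 𝕜 δ * expS 𝕜 a * expS 𝕜 (-x) * (l + C δ) +
        (C δ * (expS 𝕜 δ * expS 𝕜 a * expS 𝕜 (-x)) -
          expS 𝕜 δ * expS 𝕜 a * expS 𝕜 (-x) * C δ) := by
  have hl' : expS 𝕜 (-x) * l = C (a - x) * expS 𝕜 (-x) := by
    calc expS 𝕜 (-x) * l = expS 𝕜 (-x) * (l * expS 𝕜 x) * expS 𝕜 (-x) := by
          rw [mul_assoc, mul_assoc l, expS_mul_expS_neg, mul_one]
      _ = expS 𝕜 (-x) * expS 𝕜 x * C (a - x) * expS 𝕜 (-x) := by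
          rw [← hl, mul_assoc, mul_assoc, mul_assoc, mul_assoc]
      _ = C (a - x) * expS 𝕜 (-x) := by rw [expS_neg_mul_expS, one_mul]
  have ha : C a * expS 𝕜 a = expS 𝕜 a * C a := (commute_C_expS (Commute.refl a)).eq
  rw [pderiv_mul, pderiv_mul, pderiv_expS, pderiv_expS, pderiv_expS, ha, mul_add,
    mul_assoc (expS 𝕜 δ * expS 𝕜 a) _ l, hl', map_sub, map_neg]
  simp only [mul_assoc, add_mul, sub_mul, mul_sub, neg_mul, mul_neg]
  abel

omit [CharZero 𝕜] in
variable (𝕜) in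
-- Separates the first-order part of each power: the factor k + 1 produced by the expansion cancels
-- the denominator of the logarithm.
theorem sum_inv_smul_pow_sub_pow [CharZero 𝕜] (n : ℕ) (x q ζ y : S) :
    ∑ k ∈ range n, ((k + 1 : ℕ) : 𝕜)⁻¹ • (x ^ (k + 1) * (q ^ (k + 1) - ζ ^ (k + 1))) =
      ∑ k ∈ range n, ((k + 1 : ℕ) : 𝕜)⁻¹ •
        (x ^ (k + 1) * (q ^ (k + 1) - ζ ^ (k + 1) - (k + 1) • (ζ ^ k * y))) +
      ∑ k ∈ range n, x ^ (k + 1) * (ζ ^ k * y) := by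
  rw [← Finset.sum_add_distrib]
  refine Finset.sum_congr rfl fun k _ => ?_
  have h0 : ((k + 1 : ℕ) : 𝕜) ≠ 0 := Nat.cast_ne_zero.mpr (by omega)
  rw [mul_sub _ _ ((k + 1) • _), smul_sub, mul_smul_comm (k + 1), ← Nat.cast_smul_eq_nsmul 𝕜 (k + 1),
    smul_smul, inv_mul_cancel₀ h0, one_smul, sub_add_cancel]

theorem X_dvd_neg {S : Type*} [Ring S] {y : PowerSeries S} (hy : X ∣ y) : X ∣ -y := by
  rw [← neg_one_mul]; exact X_dvd_mul_left _ hy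

theorem commute_C_X (y : PowerSeries (PowerSeries S)) : Commute (C X) y :=
  commute_of_coeff fun i j => by
    rw [coeff_C]; split_ifs
    · exact (commute_X _).symm
    · exact Commute.zero_left _

end Conjugation

/-! ### The exponential of the curve exponent modulo 𝒟₋. -/

section KacSchwarz

open PowerSeries Finset

variable {𝕜 : Type*} [Field 𝕜] (n : ℕ) (ħ : 𝕜)

theorem sum_Icc_one_eq {M : Type*} [AddCommMonoid M] (f : ℕ → M) (n : ℕ) :
    ∑ k ∈ Icc 1 n, f k = ∑ k ∈ range n, f (k + 1) := by
  induction n with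
  | zero => simp
  | succ n ih => rw [Finset.sum_Icc_succ_top (by omega), ih, Finset.sum_range_succ]

/-- The exponent `w ^ (n + 1) V' + ∑_{k=1}^n (w Q̃) ^ k / k` of the quantum curve. -/
def curveS : OpSeries 𝕜 :=
  X ^ (n + 1) * mulS (potV' 𝕜 n) + ∑ k ∈ Icc 1 n, (k : 𝕜)⁻¹ • (X * qS n ħ) ^ k

/-- `χ ∂/∂z`. -/
def chiDS : OpSeries 𝕜 := (ħ • X ^ (n + 1)) * dS 𝕜

theorem X_mem_filS : (X : OpSeries 𝕜) ∈ filS 0 := by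
  rw [← mulS_w]; exact mulS_mem_filS' sDegLE_w

theorem chiDS_mem_filS : chiDS n ħ ∈ filS 0 :=
  mul_mem_filS (by omega) ((filS 0).smul_mem ħ (pow_mem_filS_zero X_mem_filS _)) dS_mem_filS

theorem X_dvd_chiDS : X ∣ chiDS n ħ :=
  ⟨ħ • X ^ n * dS 𝕜, by rw [chiDS, pow_succ', smul_mul_assoc, smul_mul_assoc, mul_smul_comm,
    mul_assoc]⟩

theorem X_dvd_smul_pow (c : 𝕜) (y : OpSeries 𝕜) {k : ℕ} (hk : 1 ≤ k) : X ∣ c • (X * y) ^ k := by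
  obtain ⟨k, rfl⟩ : ∃ m, k = m + 1 := ⟨k - 1, by omega⟩
  exact ⟨c • (y * (X * y) ^ k), by rw [pow_succ', mul_assoc, mul_smul_comm]⟩

theorem X_dvd_curveS : X ∣ curveS n ħ := by
  refine dvd_add ⟨X ^ n * mulS (potV' 𝕜 n), by rw [pow_succ', mul_assoc]⟩
    (Finset.dvd_sum fun k hk => ?_)
  exact X_dvd_smul_pow _ _ (Finset.mem_Icc.mp hk).1

variable (𝕜) in
theorem X_dvd_plog (y : OpSeries 𝕜) : X ∣ plog 𝕜 (X * y) := X_dvd_evalOne fun l => by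
  rw [coeff_logS]
  cases l with
  | zero => simp
  | succ l => exact X_dvd_smul_pow _ _ (Nat.le_add_left 1 l)

variable [CharZero 𝕜]

/-- The logarithmic part of the exponent of the quantum curve. -/
theorem curveS_sub_logZ : curveS n ħ - mulS (logZ 𝕜) = ∑ k ∈ range n,
    ((k + 1 : ℕ) : 𝕜)⁻¹ • ((X * qS n ħ) ^ (k + 1) - (X * mulS (z 𝕜)) ^ (k + 1)) := by
  have h := congrArg mulS (w_pow_mul_potV' 𝕜 n)
  rw [map_mul, map_pow, mulS_w, map_sub, map_sum, sum_Icc_one_eq] at h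
  rw [curveS, h, sum_Icc_one_eq]
  simp only [mulS_cst_mul]
  simp only [map_pow, map_mul, mulS_w, smul_sub, Finset.sum_sub_distrib]
  abel

variable {ħ}

/-- The sum of powers of Q̃ commutes with Q̃, and [Q̃, V'] = U⁻¹ V'' = ħ. -/
theorem qS_mul_curveS (hħ : ħ ≠ 0) :
    qS n ħ * curveS n ħ = curveS n ħ * qS n ħ + ħ • X ^ (n + 1) := by
  have h1 : qS n ħ * (X ^ (n + 1) * mulS (potV' 𝕜 n)) =
      X ^ (n + 1) * mulS (potV' 𝕜 n) * qS n ħ + ħ • X ^ (n + 1) := by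
    rw [← mul_assoc, (commute_X_pow _ _).eq, mul_assoc, qS_mul_mulS, uInv_mul_dz_potV' n hħ,
      mulS_cst, mul_add, mul_assoc, ← Algebra.commutes, ← Algebra.smul_def]
  have h2 : Commute (qS n ħ) (∑ k ∈ Icc 1 n, (k : 𝕜)⁻¹ • (X * qS n ħ) ^ k) :=
    Commute.sum_right _ _ _ fun k _ =>
      (((commute_X _).mul_right (Commute.refl _)).pow_right k).smul_right _
  rw [curveS, mul_add, h1, h2.eq, add_mul]
  abel

omit [CharZero 𝕜] in
theorem evalSeries_chiSeries (Q : OpSeries 𝕜) :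
    evalSeries 𝕜 Q (chiSeries n ħ) = ħ • X ^ (n + 1) := by
  rw [evalSeries, chiSeries, extend_smul, map_pow, extend_X]

omit [CharZero 𝕜] in
theorem evalSeries_wySeries (Q : OpSeries 𝕜) : evalSeries 𝕜 Q (wySeries 𝕜) = X * Q := by
  rw [evalSeries, wySeries, map_mul, extend_X, extend_C, Polynomial.aeval_X]

omit [CharZero 𝕜] in
theorem evalSeries_midSeries (Q : OpSeries 𝕜) : evalSeries 𝕜 Q (midSeries n ħ) =
    X * Q + (2 : 𝕜)⁻¹ • (X * (ħ • X ^ (n + 1))) := by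
  rw [midSeries, map_add, evalSeries_wySeries, evalSeries, extend_smul, map_mul, extend_X,
    ← evalSeries, evalSeries_chiSeries]

/-- `w κ` in the factorization of `1 - w Q̃ - χ w / 2`. -/
def midCorrection (ħ : 𝕜) : Space 𝕜 :=
  cst (ħ * 2⁻¹) * (-(n * zInv 𝕜 ^ (n + 1)) -
    w 𝕜 * ∑ i ∈ range n, w 𝕜 ^ i * (z 𝕜 ^ i * zInv 𝕜 ^ n))

omit [CharZero 𝕜] in
theorem z_pow_mul_zInv_pow {i n : ℕ} (h : i ≤ n) :
    z 𝕜 ^ i * zInv 𝕜 ^ n = zInv 𝕜 ^ (n - i) := by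
  obtain ⟨j, rfl⟩ := Nat.exists_eq_add_of_le h
  rw [pow_add, ← mul_assoc, ← mul_pow, z_mul_zInv, one_pow, one_mul, Nat.add_sub_cancel_left]

omit [CharZero 𝕜] in
theorem sDegLE_midCorrection (ħ : 𝕜) : SDegLE (-1) (midCorrection n ħ) := by
  have h1 : SDegLE (-1) ((n : Space 𝕜) * zInv 𝕜 ^ (n + 1)) := by
    rw [← cst_natCast]
    exact ((sDegLE_cst _).mul (sDegLE_zInv.pow (n + 1))).mono (by push_cast; linarith)
  have h2 : ∀ i ∈ range n, SDegLE (-1) (w 𝕜 ^ i * (z 𝕜 ^ i * zInv 𝕜 ^ n)) := by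
    intro i hi
    have hi : i < n := by simpa using hi
    rw [z_pow_mul_zInv_pow hi.le]
    exact ((sDegLE_w.pow i).mul (sDegLE_zInv.pow (n - i))).mono (by
      have : ((n - i : ℕ) : ℤ) = n - i := by omega
      rw [this]; linarith)
  exact ((sDegLE_cst _).mul (h1.neg.sub ((sDegLE_w.mul (SDegLE.sum _ h2)).mono (by omega)))).mono
    (by omega)

omit [CharZero 𝕜] in
-- The first-order parts of (wQ̃)^k / k, summed over k ≤ n, have coefficient ħ w z⁻ⁿ (1 - (wz)ⁿ) = ħ
-- w z⁻ⁿ - χ. This is the source of -χ∂; the other summand is in 𝒟₋.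
theorem geom_sum_mul_uInv :
    ∑ k ∈ range n, w 𝕜 ^ (k + 1) * z 𝕜 ^ k * uInv n ħ + cst ħ * w 𝕜 ^ (n + 1) =
      cst ħ * w 𝕜 * zInv 𝕜 ^ n := by
  have h := mul_neg_geom_sum (w 𝕜 * z 𝕜) n
  have h1 : ∑ k ∈ range n, w 𝕜 ^ (k + 1) * z 𝕜 ^ k * uInv n ħ =
      w 𝕜 * uInv n ħ * ∑ k ∈ range n, (w 𝕜 * z 𝕜) ^ k := by
    rw [Finset.mul_sum]
    exact Finset.sum_congr rfl fun k _ => by ring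
  rw [h1, uInv]
  linear_combination w 𝕜 * zInv 𝕜 ^ n * cst ħ * h - cst ħ * w 𝕜 ^ (n + 1) * zInv_pow_mul_z_pow (𝕜 := 𝕜) n

omit [CharZero 𝕜] in
-- The shift χ/2 is what keeps the quotient of degree at most -1: the part -w z⁻ⁿ of (U⁻¹)'/ħ
-- combines with w^(n+1) into -w z⁻ⁿ (1 - (wz)ⁿ), whose quotient by 1 - wz is a finite geometric
-- sum.
theorem one_sub_mul_midCorrection : (1 - w 𝕜 * z 𝕜) * midCorrection n ħ =
    cst (2 : 𝕜)⁻¹ * (dz 𝕜 (uInv n ħ) + cst ħ * w 𝕜 ^ (n + 1)) := by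
  have h := mul_neg_geom_sum (w 𝕜 * z 𝕜) n
  have h1 : ∑ i ∈ range n, w 𝕜 ^ i * (z 𝕜 ^ i * zInv 𝕜 ^ n) =
      zInv 𝕜 ^ n * ∑ k ∈ range n, (w 𝕜 * z 𝕜) ^ k := by
    rw [Finset.mul_sum]
    exact Finset.sum_congr rfl fun k _ => by ring
  have h2 : (n : Space 𝕜) * zInv 𝕜 ^ (n - 1) * zInv 𝕜 ^ 2 = n * zInv 𝕜 ^ (n + 1) := by
    cases n with
    | zero => simp
    | succ n => rw [Nat.add_sub_cancel]; ring
  have h3 : dz 𝕜 (uInv n ħ) =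
      cst ħ * (-(n * zInv 𝕜 ^ (n + 1)) * (1 - w 𝕜 * z 𝕜) - zInv 𝕜 ^ n * w 𝕜) := by
    rw [uInv, dz_mul, dz_pow, dz_zInv, dz_cst_mul, map_sub, dz_one, dz_w_mul, dz_z]
    linear_combination -cst ħ * (1 - w 𝕜 * z 𝕜) * h2
  rw [midCorrection, h1, h3, cst_mul]
  linear_combination -cst ħ * cst 2⁻¹ * w 𝕜 * zInv 𝕜 ^ n * h +
    cst ħ * cst 2⁻¹ * w 𝕜 ^ (n + 1) * zInv_pow_mul_z_pow (𝕜 := 𝕜) n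

omit [CharZero 𝕜] in
/-- The factorization of `1 - w Q̃ - χ w / 2`. -/
theorem one_sub_evalSeries_midSeries : 1 - evalSeries 𝕜 (qS n ħ) (midSeries n ħ) =
    (1 - mulS (w 𝕜 * z 𝕜)) * (1 - (mulS (cst ħ * w 𝕜 * zInv 𝕜 ^ n) * dS 𝕜 +
      mulS (w 𝕜 * midCorrection n ħ))) := by
  have h1 : X * qS n ħ = mulS (w 𝕜 * z 𝕜) + mulS (w 𝕜 * uInv n ħ) * dS 𝕜 +
      mulS (w 𝕜 * (cst (2 : 𝕜)⁻¹ * dz 𝕜 (uInv n ħ))) := by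
    rw [← mulS_w, qS, mul_add, mul_add, map_mul mulS (w 𝕜) (z 𝕜), map_mul mulS (w 𝕜) (uInv n ħ), map_mul mulS (w 𝕜) (cst _ * _),
      mul_assoc (mulS (w 𝕜)) (mulS (uInv n ħ))]
  have h2 : (2 : 𝕜)⁻¹ • (X * (ħ • X ^ (n + 1))) =
      mulS (w 𝕜 * (cst (2 : 𝕜)⁻¹ * (cst ħ * w 𝕜 ^ (n + 1)))) := by
    rw [map_mul, mulS_cst_mul, mulS_cst_mul, map_pow, mulS_w, mul_smul_comm, mul_smul_comm,
      mul_smul_comm]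
  have h3 : (1 - mulS (w 𝕜 * z 𝕜)) = mulS (1 - w 𝕜 * z 𝕜) := by rw [map_sub, map_one]
  have h4 : (1 - w 𝕜 * z 𝕜) * (cst ħ * w 𝕜 * zInv 𝕜 ^ n) = w 𝕜 * uInv n ħ := by rw [uInv]; ring
  have h5 : (1 - w 𝕜 * z 𝕜) * (w 𝕜 * midCorrection n ħ) = w 𝕜 * (cst (2 : 𝕜)⁻¹ * dz 𝕜 (uInv n ħ)) +
      w 𝕜 * (cst (2 : 𝕜)⁻¹ * (cst ħ * w 𝕜 ^ (n + 1))) := by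
    linear_combination w 𝕜 * one_sub_mul_midCorrection n (ħ := ħ)
  rw [evalSeries_midSeries, h1, h2, h3, mul_sub, mul_one, mul_add,
    ← mul_assoc (mulS (1 - w 𝕜 * z 𝕜)) _ (dS 𝕜), ← map_mul mulS _ (cst ħ * w 𝕜 * zInv 𝕜 ^ n), ← map_mul mulS _ (w 𝕜 * midCorrection n ħ), h4, h5, map_add, map_sub, map_one]
  abel

/-- `-[log(1 - w z), Q̃]`. -/
theorem mulS_logZ_mul_qS : mulS (logZ 𝕜) * qS n ħ =
    qS n ħ * mulS (logZ 𝕜) + mulS (-(cst ħ * w 𝕜 * zInv 𝕜 ^ n)) := by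
  have h : uInv n ħ * dz 𝕜 (logZ 𝕜) = cst ħ * w 𝕜 * zInv 𝕜 ^ n := by
    rw [uInv]
    linear_combination zInv 𝕜 ^ n * cst ħ * one_sub_mul_dz_logZ (𝕜 := 𝕜)
  rw [qS_mul_mulS, h, map_neg]
  abel

/-- `e^{s log} Q̃ e^{-s log}`. -/
def qConj (ħ : 𝕜) : PowerSeries (OpSeries 𝕜) :=
  C (qS n ħ) + X * C (mulS (-(cst ħ * w 𝕜 * zInv 𝕜 ^ n)))

theorem expS_logZ_mul_C_qS :
    SemiconjBy (expS 𝕜 (mulS (logZ 𝕜))) (C (qS n ħ)) (qConj n ħ) :=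
  expS_mul_C 𝕜 (mulS_logZ_mul_qS n) (by
    rw [Commute, SemiconjBy, ← map_mul, ← map_mul, mul_comm])

/-- The conjugated logarithmic part of the exponent. -/
def logConj (ħ : 𝕜) : PowerSeries (OpSeries 𝕜) := ∑ k ∈ range n, ((k + 1 : ℕ) : 𝕜)⁻¹ •
  (C X ^ (k + 1) * (qConj n ħ ^ (k + 1) - C (mulS (z 𝕜)) ^ (k + 1)))

theorem expS_logZ_mul_C_sub : expS 𝕜 (mulS (logZ 𝕜)) * C (curveS n ħ - mulS (logZ 𝕜)) =
    logConj n ħ * expS 𝕜 (mulS (logZ 𝕜)) := by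
  have hz : SemiconjBy (expS 𝕜 (mulS (logZ 𝕜))) (C (mulS (z 𝕜))) (C (mulS (z 𝕜))) :=
    (commute_C_expS (by rw [Commute, SemiconjBy, ← map_mul, ← map_mul, mul_comm])).symm
  rw [curveS_sub_logZ, map_sum, Finset.mul_sum, logConj, Finset.sum_mul]
  refine Finset.sum_congr rfl fun k _ => ?_
  have hC : ∀ (c : 𝕜) (y : OpSeries 𝕜), C (c • y) = c • C y := fun c y => by
    ext1 m
    rw [coeff_smul, coeff_C, coeff_C]; split_ifs <;> simp
  have hX : ∀ y : OpSeries 𝕜, C ((X * y) ^ (k + 1)) = C X ^ (k + 1) * C y ^ (k + 1) := fun y => by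
    rw [(commute_X y).symm.mul_pow, map_mul, map_pow, map_pow]
  rw [hC, map_sub, hX, hX, ← mul_sub, mul_smul_comm, smul_mul_assoc, ← mul_assoc,
    ((commute_C_X _).pow_left (k + 1)).symm.eq, mul_assoc, mul_assoc]
  congr 2
  exact ((expS_logZ_mul_C_qS n).pow_right (k + 1)).sub_right (hz.pow_right (k + 1))

/-- Conjugation changes Q̃ only by a multiplication operator of degree -n, which joins the remainder
r of `pow_sub_mem_filSS`. The powers of z cancel, and the first-order parts add up to -χ∂ modulo 𝒟₋
by `geom_sum_mul_uInv`. -/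
theorem logConj_add_mem (hn : 1 ≤ n) (ħ : 𝕜) : logConj n ħ + C (chiDS n ħ) ∈ filSS (-1) := by
  have hn' : (1 : ℤ) ≤ n := by exact_mod_cast hn
  have hX : ∀ k, (C X : PowerSeries (OpSeries 𝕜)) ^ k ∈ filSS 0 := fun k => by
    rw [← map_pow]; exact C_mem_filSS (pow_mem_filS_zero X_mem_filS k)
  have hdeg : SDegLE (-(n : ℤ)) (cst ħ * w 𝕜 * zInv 𝕜 ^ n) :=
    (((sDegLE_cst ħ).mul sDegLE_w).mul (sDegLE_zInv.pow n)).mono (by linarith)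
  have hr : C (mulS (cst (2 : 𝕜)⁻¹ * dz 𝕜 (uInv n ħ))) +
      X * C (mulS (-(cst ħ * w 𝕜 * zInv 𝕜 ^ n))) ∈ filSS (-n) :=
    add_mem (C_mem_filSS (mulS_mem_filS' (((sDegLE_cst _).mul (sDegLE_uInv n ħ).dz).mono
      (by linarith)))) (X_mul_mem_filSS (C_mem_filSS (mulS_mem_filS' hdeg.neg)))
  have hq : qConj n ħ = C (mulS (z 𝕜)) + C (mulS (uInv n ħ)) * C (dS 𝕜) +
      (C (mulS (cst (2 : 𝕜)⁻¹ * dz 𝕜 (uInv n ħ))) +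
        X * C (mulS (-(cst ħ * w 𝕜 * zInv 𝕜 ^ n)))) := by
    rw [qConj, qS, map_add, map_add, map_mul C (mulS (uInv n ħ))]; abel
  have key := pow_sub_mem_filSS hn' (C_mem_filSS (mulS_mem_filS' sDegLE_z))
    (C_mem_filSS (mulS_mem_filS' (sDegLE_uInv n ħ))) (C_mem_filSS dS_mem_filS) hr
    (by rw [← map_mul, dS_mul_mulS, dz_z, map_one, map_add, map_mul, map_one])
    (by rw [← map_mul, ← map_mul, ← map_mul, ← map_mul, mul_comm])
  rw [← hq] at key
  have hC : ∀ k, C (X ^ (k + 1) * (mulS (z 𝕜) ^ k * (mulS (uInv n ħ) * dS 𝕜))) =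
      C X ^ (k + 1) * (C (mulS (z 𝕜)) ^ k * (C (mulS (uInv n ħ)) * C (dS 𝕜))) := fun k => by
    rw [RingHom.map_mul, RingHom.map_mul, RingHom.map_mul, RingHom.map_pow, RingHom.map_pow]
  set ρ : ℕ → PowerSeries (OpSeries 𝕜) := fun k => qConj n ħ ^ (k + 1) - C (mulS (z 𝕜)) ^ (k + 1) -
    (k + 1) • (C (mulS (z 𝕜)) ^ k * (C (mulS (uInv n ħ)) * C (dS 𝕜))) with hρ
  have hmain : ∑ k ∈ range n, C (X ^ (k + 1) * (mulS (z 𝕜) ^ k * (mulS (uInv n ħ) * dS 𝕜))) +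
      C (chiDS n ħ) = C (mulS (cst ħ * w 𝕜 * zInv 𝕜 ^ n) * dS 𝕜) := by
    rw [← geom_sum_mul_uInv, ← map_sum, ← map_add, chiDS, map_add mulS, mulS_cst_mul, map_pow,
      mulS_w, add_mul, map_sum, Finset.sum_mul]
    congr 2
    refine Finset.sum_congr rfl fun k _ => ?_
    rw [map_mul, map_mul, map_pow, map_pow, mulS_w, mul_assoc, mul_assoc]
  have hexp : logConj n ħ + C (chiDS n ħ) =
      ∑ k ∈ range n, ((k + 1 : ℕ) : 𝕜)⁻¹ • (C X ^ (k + 1) * ρ k) +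
        C (mulS (cst ħ * w 𝕜 * zInv 𝕜 ^ n) * dS 𝕜) := by
    rw [← hmain, Finset.sum_congr rfl fun k _ => hC k, ← add_assoc]
    exact congrArg (· + C (chiDS n ħ)) (sum_inv_smul_pow_sub_pow 𝕜 n (C X) (qConj n ħ)
      (C (mulS (z 𝕜))) (C (mulS (uInv n ħ)) * C (dS 𝕜)))
  have hterm : ∀ k ∈ range n, C X ^ (k + 1) * ρ k ∈ filSS (-1) := fun k hk => by
    have hk : k < n := by simpa using hk
    -- The remainder has degree k - n, which is at most -1 because the sum stops at k = n - 1.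
    exact mul_mem_filSS (-1) (by omega) (hX (k + 1)) (key k)
  have hlast : C (mulS (cst ħ * w 𝕜 * zInv 𝕜 ^ n) * dS 𝕜) ∈ filSS (-1) :=
    C_mem_filSS (mul_mem_filS (r := -n) (s := 0) (by omega) (mulS_mem_filS' hdeg) dS_mem_filS)
  rw [hexp]
  clear_value ρ
  exact Submodule.add_mem (filSS (-1)) (Submodule.sum_mem (filSS (-1)) fun k hk =>
    Submodule.smul_mem (filSS (-1)) _ (hterm k hk)) hlast

/-- The exponential of the curve exponent is `exp (-χ ∂) (1 + 𝒟₋) exp (-log (1 - w z))`. -/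
theorem exists_pexp_curveS (hn : 1 ≤ n) (ħ : 𝕜) : ∃ Z : OpSeries 𝕜, Z - 1 ∈ filS (-1) ∧
    pexp 𝕜 (curveS n ħ) = pexp 𝕜 (-chiDS n ħ) * Z * pexp 𝕜 (mulS (logZ 𝕜)) := by
  have hXl : X ∣ mulS (logZ 𝕜) := by
    rw [mulS_logZ]; exact X_dvd_plog 𝕜 _
  have hδ := X_dvd_chiDS n ħ
  have hA := X_dvd_curveS n ħ
  have h := sub_one_mem_filSS_of_pderiv (chiDS_mem_filS n ħ) (logConj_add_mem n hn ħ)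
    (pderiv_expS_mul (expS_logZ_mul_C_sub n)) (coeff_zero_expS_mul _ _ _)
  have m1 := expS_mem_convergentSubring (𝕜 := 𝕜) hδ
  have m2 := expS_mem_convergentSubring (𝕜 := 𝕜) hA
  have m3 := expS_mem_convergentSubring (𝕜 := 𝕜) (X_dvd_neg hXl)
  -- Z is exp(χ∂) exp(A) (1 - wz), the value at s = 1 of the solution found in 1 + 𝒟₋.
  refine ⟨evalOne (expS 𝕜 (chiDS n ħ) * expS 𝕜 (curveS n ħ) * expS 𝕜 (-mulS (logZ 𝕜))), ?_, ?_⟩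
  · rw [← evalOne_one, ← map_sub]
    exact evalOne_mem_coeffwise h
  · rw [evalOne_mul (mul_mem m1 m2) m3, evalOne_mul m1 m2, evalOne_expS, evalOne_expS, evalOne_expS,
      mul_assoc, mul_assoc, pexp_neg_mul_pexp hXl, mul_one, ← mul_assoc, pexp_neg_mul_pexp hδ,
      one_mul]

/-- This is -χP ≡ -χ∂. In exp(-χP) = exp(A)(1 - wQ̃ - χw/2) the factor (1 - wz)⁻¹ ending exp A meets
the factor 1 - wz that begins the second operator; what remains is exp(-χ∂)(1 + 𝒟₋). -/
theorem curveS_sub_evalSeries_add_mem (hn : 1 ≤ n) (hħ : ħ ≠ 0) :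
    curveS n ħ - evalSeries 𝕜 (qS n ħ) (bernoulliSeries n ħ) + chiDS n ħ ∈ filS (-1) := by
  obtain ⟨Z, hZ, hA⟩ := exists_pexp_curveS n hn ħ
  have hδ0 : -chiDS n ħ ∈ filS 0 := neg_mem (chiDS_mem_filS n ħ)
  have hlog : pexp 𝕜 (mulS (logZ 𝕜)) * (1 - mulS (w 𝕜 * z 𝕜)) = 1 := by
    have hu : X ∣ X * C (mulL (zL 𝕜)) := ⟨_, rfl⟩
    have hl : X ∣ plog 𝕜 (X * C (mulL (zL 𝕜))) := X_dvd_plog 𝕜 _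
    have h1 := pexp_neg_mul_pexp (𝕜 := 𝕜) (X_dvd_neg hl)
    rw [neg_neg, pexp_neg_plog hu] at h1
    rw [mulS_logZ, map_mul, mulS_w, show mulS (z 𝕜) = C (mulL (zL 𝕜)) from map_C _ _]
    exact h1
  set Y : OpSeries 𝕜 := mulS (cst ħ * w 𝕜 * zInv 𝕜 ^ n) * dS 𝕜 + mulS (w 𝕜 * midCorrection n ħ)
    with hY
  have hYm : Y ∈ filS (-1) := by
    refine add_mem (mul_mem_filS (r := -1) (by omega) (mulS_mem_filS' ?_) dS_mem_filS)
      (mulS_mem_filS' ((sDegLE_w.mul (sDegLE_midCorrection n ħ)).mono (by omega)))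
    exact (((sDegLE_cst ħ).mul sDegLE_w).mul (sDegLE_zInv.pow n)).mono (by
      have : (1 : ℤ) ≤ n := by exact_mod_cast hn
      linarith)
  have hN : pexp 𝕜 (curveS n ħ - evalSeries 𝕜 (qS n ħ) (bernoulliSeries n ħ)) =
      pexp 𝕜 (-chiDS n ħ) * Z * (1 - Y) := by
    rw [pexp_sub_bernoulliSeries hħ (by rw [evalSeries_chiSeries]; exact qS_mul_curveS n hħ)
      (X_dvd_curveS n ħ), one_sub_evalSeries_midSeries, hA, ← hY, ← mul_assoc,
      mul_assoc _ (pexp 𝕜 (mulS (logZ 𝕜))), hlog, mul_one]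
  have hXN : X ∣ curveS n ħ - evalSeries 𝕜 (qS n ħ) (bernoulliSeries n ħ) := by
    rw [sub_eq_add_neg]
    exact dvd_add (X_dvd_curveS n ħ) (X_dvd_neg (X_dvd_extend _ (X_dvd_bernoulliSeries n ħ)))
  have := sub_mem_filS_of_pexp hXN (X_dvd_neg (X_dvd_chiDS n ħ)) hδ0 (by
    rw [hN, show pexp 𝕜 (-chiDS n ħ) * Z * (1 - Y) - pexp 𝕜 (-chiDS n ħ) =
      pexp 𝕜 (-chiDS n ħ) * ((Z - 1) - (Z - 1) * Y - Y) by
        simp only [mul_sub, sub_mul, mul_one, one_mul, mul_assoc]; abel]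
    refine mul_mem_filS (s := -1) (by omega) (pexp_mem_filS_zero hδ0)
      (sub_mem (sub_mem hZ (mul_mem_filS (r := -1) (s := -1) (by omega) hZ hYm)) hYm))
  rwa [sub_neg_eq_add] at this

end KacSchwarz

/-! ### Comparison with the Bernoulli series in 𝕜[z]((w)). -/

section BernoulliSeries

open PowerSeries Finset

variable {𝕜 : Type*} [Field 𝕜] (n : ℕ) (ħ : 𝕜)

theorem wMonomial_mul (a b : ℤ) (c d : 𝕜) :
    wMonomial a c * wMonomial b d = wMonomial (a + b) (c * d) := by
  rw [wMonomial, wMonomial, HahnSeries.single_mul_single, ← map_mul]; rfl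

theorem wMonomial_zero_one : wMonomial 0 (1 : 𝕜) = 1 := by
  rw [wMonomial, map_one]; rfl

theorem wMonomial_zero_add (c d : 𝕜) : wMonomial 0 c + wMonomial 0 d = wMonomial 0 (c + d) := by
  rw [wMonomial, wMonomial, ← HahnSeries.single_add, ← map_add]; rfl

theorem ofPowerSeries_smul (c : 𝕜) (f : PowerSeries (Polynomial 𝕜)) :
    HahnSeries.ofPowerSeries ℤ _ (c • f) = wMonomial 0 c * HahnSeries.ofPowerSeries ℤ _ f := by
  rw [show c • f = C (Polynomial.C c) * f by
    ext1 m; rw [coeff_smul, coeff_C_mul, Polynomial.smul_eq_C_mul], map_mul,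
    HahnSeries.ofPowerSeries_C]
  rfl

theorem ofPowerSeries_X_pow_eq (k : ℕ) :
    HahnSeries.ofPowerSeries ℤ (Polynomial 𝕜) (X ^ k) = wMonomial (k : ℤ) (1 : 𝕜) := by
  rw [HahnSeries.ofPowerSeries_X_pow, wMonomial, map_one Polynomial.C]

theorem ofPowerSeries_chiSeries :
    HahnSeries.ofPowerSeries ℤ _ (chiSeries n ħ) = wMonomial (n + 1) ħ := by
  rw [chiSeries, ofPowerSeries_smul, ofPowerSeries_X_pow_eq, wMonomial_mul, zero_add, mul_one]
  push_cast; rfl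

theorem ofPowerSeries_wySeries :
    HahnSeries.ofPowerSeries ℤ _ (wySeries 𝕜) = wMonomial 1 1 * zPoly 𝕜 := by
  rw [wySeries, map_mul, ← pow_one X, ofPowerSeries_X_pow_eq, HahnSeries.ofPowerSeries_C]
  rfl

variable [CharZero 𝕜]

/-- The reflection B_k(1 - t) = (-1)^k B_k(t) absorbs the sign of (-χw)^k. It is used with t = 1/2 +
z/χ, so that ht = w(z + χ/2) contains no negative power of w. -/
theorem neg_pow_mul_eval₂_bernoulli {K : Type*} [CommRing K] (f : ℚ →+* K) (h t c : K) (k : ℕ) :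
    (-h) ^ k * c * (Polynomial.bernoulli k).eval₂ f (1 - t) =
      c * ∑ i ∈ range (k + 1), f (bernoulli i * k.choose i) * (h ^ i * (h * t) ^ (k - i)) := by
  have hrefl := congrArg (Polynomial.eval₂ f t) (Polynomial.bernoulli_comp_one_sub_X k)
  rw [Polynomial.eval₂_comp, Polynomial.eval₂_mul, Polynomial.eval₂_pow, Polynomial.eval₂_sub,
    Polynomial.eval₂_one, Polynomial.eval₂_X, Polynomial.eval₂_neg, Polynomial.eval₂_one] at hrefl
  have hsq : ((-1 : K) ^ k) * (-1) ^ k = 1 := by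
    rw [← mul_pow]; simp
  have hsum : h ^ k * (Polynomial.bernoulli k).eval₂ f t =
      ∑ i ∈ range (k + 1), f (bernoulli i * k.choose i) * (h ^ i * (h * t) ^ (k - i)) := by
    rw [eval₂_bernoulli, Finset.mul_sum]
    refine Finset.sum_congr rfl fun i hi => ?_
    have hi : i ≤ k := by simpa [Nat.lt_succ_iff] using hi
    have : h ^ k = h ^ i * h ^ (k - i) := by rw [← pow_add, Nat.add_sub_cancel' hi]
    rw [this, mul_pow]
    ring
  rw [hrefl, neg_pow, ← hsum]
  linear_combination (h ^ k * c * (Polynomial.bernoulli k).eval₂ f t) * hsq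

variable {ħ} in
theorem bernoulliTerm_eq (hħ : ħ ≠ 0) (k : ℕ) : bernoulliTerm n ħ k =
    HahnSeries.ofPowerSeries ℤ _ (bernoulliSeriesTerm n ħ k) := by
  set ι := HahnSeries.ofPowerSeries ℤ (Polynomial 𝕜) with hι
  set h : LaurentSeries (Polynomial 𝕜) := wMonomial (n + 1) ħ * wMonomial 1 1 with hh
  set t : LaurentSeries (Polynomial 𝕜) :=
    wMonomial 0 (2 : 𝕜)⁻¹ + zPoly 𝕜 * wMonomial (-(n + 1)) ħ⁻¹ with ht
  have hXχ : ι (X * chiSeries n ħ) = h := by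
    rw [map_mul, ofPowerSeries_chiSeries, ← pow_one X, ofPowerSeries_X_pow_eq, hh, mul_comm]
    rfl
  have hmid : ι (midSeries n ħ) = h * t := by
    have h1 : wMonomial (n + 1) ħ * wMonomial (-(n + 1)) ħ⁻¹ = 1 := by
      rw [wMonomial_mul, mul_inv_cancel₀ hħ, add_neg_cancel, wMonomial_zero_one]
    rw [midSeries, map_add, ofPowerSeries_wySeries, ofPowerSeries_smul, hXχ, ht, hh]
    linear_combination -wMonomial 1 1 * zPoly 𝕜 * h1
  have hone : wMonomial 0 (2 : 𝕜)⁻¹ - zPoly 𝕜 * wMonomial (-(n + 1)) ħ⁻¹ = 1 - t := by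
    have : wMonomial 0 (2 : 𝕜)⁻¹ + wMonomial 0 (2 : 𝕜)⁻¹ = 1 := by
      rw [wMonomial_zero_add, ← wMonomial_zero_one]; congr 1; norm_num
    rw [← this, ht]; ring
  rw [bernoulliTerm, hone, bernoulliSeriesTerm, ofPowerSeries_smul, bernoulliHom, map_sum]
  refine (neg_pow_mul_eval₂_bernoulli _ h t _ k).trans ?_
  congr 1
  refine Finset.sum_congr rfl fun i _ => ?_
  rw [ofPowerSeries_smul, ← hι, map_mul ι, map_pow ι, map_pow ι, hXχ, hmid]
  rfl

/-- Modulo w^(n+1) one has χ = 0, and only the leading powers (wy)^k / k of the Bernoulli terms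
survive. This removes the negative powers of w from F minus the logarithmic terms. -/
theorem bernoulliSeries_sub_dvd : X ^ (n + 1) ∣ bernoulliSeries n ħ -
    ∑ k ∈ Icc 1 n, (k : 𝕜)⁻¹ • wySeries 𝕜 ^ k := by
  have h1 := X_pow_dvd_evalOne_sub (mk_bernoulliSeriesTerm_mem n ħ) (n + 1)
  have h2 : ∀ k, X ^ (n + 1) ∣ bernoulliSeriesTerm n ħ k - (k : 𝕜)⁻¹ • wySeries 𝕜 ^ k := by
    intro k
    have hX : X ^ (n + 1) ∣ X * chiSeries n ħ :=
      (X_pow_dvd_chiSeries n ħ).trans (dvd_mul_left _ _)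
    rw [bernoulliSeriesTerm, ← smul_sub]
    refine smul_X_pow_dvd 𝕜 _ ?_
    rw [bernoulliHom, Finset.sum_range_succ', add_sub_assoc]
    refine dvd_add (Finset.dvd_sum fun i _ => smul_X_pow_dvd 𝕜 _ ?_) ?_
    · rw [pow_succ' (X * chiSeries n ħ), mul_assoc (X * chiSeries n ħ)]
      exact hX.mul_right _
    · simp only [bernoulli_zero, Nat.choose_zero_right, Nat.cast_one, mul_one, map_one, one_smul,
        pow_zero, one_mul, Nat.sub_zero]
      refine (?_ : X ^ (n + 1) ∣ midSeries n ħ - wySeries 𝕜).trans (sub_dvd_pow_sub_pow _ _ k)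
      rw [midSeries, add_sub_cancel_left]
      exact smul_X_pow_dvd 𝕜 _ hX
  rw [sum_Icc_one_eq]
  have h3 : X ^ (n + 1) ∣ ∑ k ∈ range (n + 1), bernoulliSeriesTerm n ħ k -
      ∑ k ∈ range n, ((k + 1 : ℕ) : 𝕜)⁻¹ • wySeries 𝕜 ^ (k + 1) := by
    have := Finset.dvd_sum fun k (_ : k ∈ range (n + 1)) => h2 k
    rw [Finset.sum_sub_distrib, Finset.sum_range_succ' (fun k => (k : 𝕜)⁻¹ • wySeries 𝕜 ^ k)] at this
    simpa using this
  have := dvd_add h1 h3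
  simp only [coeff_mk, sub_add_sub_cancel] at this
  exact this

theorem exists_curveSeries : ∃ R : PowerSeries (Polynomial 𝕜), X ^ (n + 1) * R =
    bernoulliSeries n ħ - ∑ k ∈ Icc 1 n, (k : 𝕜)⁻¹ • wySeries 𝕜 ^ k := by
  obtain ⟨R, hR⟩ := bernoulliSeries_sub_dvd n ħ
  exact ⟨R, hR.symm⟩

variable {ħ} in
theorem isBernoulliSeries (hħ : ħ ≠ 0) : IsBernoulliSeries n ħ
    (wMonomial (-(n + 1)) 1 * HahnSeries.ofPowerSeries ℤ _ (bernoulliSeries n ħ)) := by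
  intro m
  -- The coefficient of w^m in F is that of w^(m+n+1) in w^(n+1)F, to which the terms with k > m + n
  -- + 1 do not contribute.
  filter_upwards [Filter.eventually_ge_atTop (m + (n + 1)).natAbs] with K hK
  rw [eq_comm, ← sub_eq_zero, ← HahnSeries.coeff_sub, ← mul_sub]
  simp only [bernoulliTerm_eq n hħ]
  rw [← map_sum, ← map_sub, wMonomial, HahnSeries.coeff_single_mul, sum_Icc_one_eq]
  have h1 := X_pow_dvd_evalOne_sub (mk_bernoulliSeriesTerm_mem n ħ) (K + 1)
  simp only [coeff_mk] at h1
  rw [Finset.sum_range_succ', show bernoulliSeriesTerm n ħ 0 = 0 by simp [bernoulliSeriesTerm],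
    add_zero] at h1
  rw [PowerSeries.coeff_coe]
  split_ifs
  · rw [mul_zero]
  · rw [bernoulliSeries, X_pow_dvd_iff.mp h1 _ (by omega), mul_zero]

theorem ofPowerSeries_curveSeries {R : PowerSeries (Polynomial 𝕜)} (hR : X ^ (n + 1) * R =
    bernoulliSeries n ħ - ∑ k ∈ Icc 1 n, (k : 𝕜)⁻¹ • wySeries 𝕜 ^ k) :
    HahnSeries.ofPowerSeries ℤ _ R =
      wMonomial (-(n + 1)) 1 * HahnSeries.ofPowerSeries ℤ _ (bernoulliSeries n ħ) -
        logTerms 𝕜 n := by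
  have h := congrArg (HahnSeries.ofPowerSeries ℤ _) hR
  have h1 : wMonomial (-(n + 1)) (1 : 𝕜) * wMonomial ((n + 1 : ℕ) : ℤ) 1 = 1 := by
    rw [wMonomial_mul, mul_one, show -((n : ℤ) + 1) + (n + 1 : ℕ) = 0 by push_cast; ring,
      wMonomial_zero_one]
  have h2 : logTerms 𝕜 n = wMonomial (-(n + 1)) 1 * HahnSeries.ofPowerSeries ℤ _
      (∑ k ∈ Icc 1 n, (k : 𝕜)⁻¹ • wySeries 𝕜 ^ k) := by
    rw [logTerms, map_sum]
    congr 1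
    refine Finset.sum_congr rfl fun k _ => ?_
    rw [ofPowerSeries_smul, map_pow, ofPowerSeries_wySeries, mul_comm]
  rw [map_mul, ofPowerSeries_X_pow_eq, map_sub] at h
  rw [h2, ← mul_sub, ← h, ← mul_assoc, h1, one_mul]

end BernoulliSeries

/-! ### The candidate operator P. -/

section KacSchwarzOperator

open PowerSeries Finset

variable {𝕜 : Type*} [Field 𝕜]

theorem isValueAt_evalSeries (R : PowerSeries (Polynomial 𝕜)) (Q : OpSeries 𝕜) :
    IsValueAt R (act Q) (act (evalSeries 𝕜 Q R)) := by
  intro f m i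
  have hterm : ∀ l, (mulOp (w 𝕜 ^ l) * (coeff l R).eval₂
      (mulOp.comp (PowerSeries.C.comp HahnSeries.C)) (act Q)) f =
      act (X ^ l * Polynomial.aeval Q (coeff l R)) f := by
    intro l
    have h1 : (mulOp.comp (PowerSeries.C.comp HahnSeries.C) : 𝕜 →+* Op 𝕜) =
        act.comp (algebraMap 𝕜 (OpSeries 𝕜)) :=
      RingHom.ext fun c => by
        rw [RingHom.comp_apply, RingHom.comp_apply, RingHom.comp_apply, ← act_mulS, ← mulS_cst]
        rfl
    rw [h1, ← Polynomial.hom_eval₂, ← act_mulS, map_pow, mulS_w, ← map_mul]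
    rfl
  filter_upwards [Filter.eventually_ge_atTop (m + 1)] with N hN
  have h2 := X_pow_dvd_evalOne_sub (extendTerms_mem (Polynomial.aeval Q) R) N
  obtain ⟨g, hg⟩ := h2
  have h3 : act (evalSeries 𝕜 Q R) f - ∑ l ∈ range N, act (X ^ l * Polynomial.aeval Q (coeff l R)) f
      = w 𝕜 ^ N * act g f := by
    rw [← act_X_pow, ← act_mul_apply, ← hg, map_sub, map_sum]
    simp only [coeff_extendTerms]
    change _ = act (evalSeries 𝕜 Q R) f - (∑ l ∈ range N, act _) f
    congr 1
    exact (AddMonoidHom.finsetSum_apply _ _ _).symm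
  have h4 := congrArg (fun s => (coeff m s).coeff i) h3
  simp only [w, coeff_X_pow_mul', map_sub, HahnSeries.coeff_sub] at h4
  rw [if_neg (by omega), HahnSeries.coeff_zero, sub_eq_zero] at h4
  rw [Finset.sum_congr rfl fun l _ => hterm l, h4]

variable [CharZero 𝕜] (n : ℕ) {ħ : 𝕜}

/-- The candidate for the Kac-Schwarz operator. -/
def kacS (ħ : 𝕜) (R : PowerSeries (Polynomial 𝕜)) : OpSeries 𝕜 :=
  ħ⁻¹ • (evalSeries 𝕜 (qS n ħ) R - mulS (potV' 𝕜 n))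

/-- The right side is -χP: the powers of Q̃ in the curve exponent are those subtracted from F. -/
theorem X_pow_mul_kacS (hħ : ħ ≠ 0) {R : PowerSeries (Polynomial 𝕜)} (hR : X ^ (n + 1) * R =
    bernoulliSeries n ħ - ∑ k ∈ Icc 1 n, (k : 𝕜)⁻¹ • wySeries 𝕜 ^ k) :
    curveS n ħ - evalSeries 𝕜 (qS n ħ) (bernoulliSeries n ħ) =
      -(X ^ (n + 1) * (ħ • kacS n ħ R)) := by
  have h := congrArg (evalSeries 𝕜 (qS n ħ)) hR
  have hs : ∀ k : ℕ, evalSeries 𝕜 (qS n ħ) ((k : 𝕜)⁻¹ • wySeries 𝕜 ^ k) =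
      (k : 𝕜)⁻¹ • (X * qS n ħ) ^ k := fun k => by
    rw [← evalSeries_wySeries (qS n ħ), ← map_pow]
    exact extend_smul _ _ _
  rw [map_mul, map_pow, show evalSeries 𝕜 (qS n ħ) X = X from extend_X _, map_sub, map_sum,
    Finset.sum_congr rfl fun k _ => hs k, eq_sub_iff_add_eq] at h
  rw [kacS, smul_smul, mul_inv_cancel₀ hħ, one_smul, curveS, ← h, mul_sub]
  abel

omit [CharZero 𝕜] in
theorem neg_mul_smul_add {T : Type*} [Ring T] [Algebra 𝕜 T] (c : 𝕜) (x p d : T) :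
    -(x * (c • p)) + (c • x) * d = x * ((-c) • (p - d)) := by
  rw [neg_smul, smul_sub, smul_mul_assoc, mul_neg, mul_sub, mul_smul_comm c x d]
  abel

/-- Division by -χ is harmless: w^(n+1) only shifts coefficients and ħ is a nonzero scalar. -/
theorem kacS_sub_dS_mem (hn : 1 ≤ n) (hħ : ħ ≠ 0) {R : PowerSeries (Polynomial 𝕜)}
    (hR : X ^ (n + 1) * R =
      bernoulliSeries n ħ - ∑ k ∈ Icc 1 n, (k : 𝕜)⁻¹ • wySeries 𝕜 ^ k) :
    kacS n ħ R - dS 𝕜 ∈ filS (-1) := by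
  have h1 := curveS_sub_evalSeries_add_mem n hn hħ
  have h2 : curveS n ħ - evalSeries 𝕜 (qS n ħ) (bernoulliSeries n ħ) + chiDS n ħ =
      X ^ (n + 1) * ((-ħ) • (kacS n ħ R - dS 𝕜)) := by
    rw [X_pow_mul_kacS n hħ hR, chiDS]
    exact neg_mul_smul_add ħ _ _ _
  rw [h2] at h1
  have h3 := (X_pow_mul_mem_coeffwise (F := fil (𝕜 := 𝕜) (-1)) (n + 1)).mp h1
  have h4 := (filS (𝕜 := 𝕜) (-1)).smul_mem (-ħ)⁻¹ h3
  rwa [smul_smul, inv_mul_cancel₀ (neg_ne_zero.mpr hħ), one_smul] at h4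

end KacSchwarzOperator

/-! ### The grading in which z and ψ have degree 1 and w has degree -1. -/

section Growth

open PowerSeries Finset

variable {𝕜 : Type*} [Field 𝕜]

/-- The degree in `z` of the coefficient of `w ^ m` is at most `c + m`. -/
def GrowthLE (c : ℤ) (f : Space 𝕜) : Prop := ∀ m : ℕ, ZDegLE (c + m) (coeff m f)

theorem GrowthLE.mono {c c' : ℤ} {f : Space 𝕜} (h : GrowthLE c f) (hc : c ≤ c') : GrowthLE c' f :=
  fun m => (h m).mono (by omega)

theorem GrowthLE.zero (c : ℤ) : GrowthLE c (0 : Space 𝕜) := fun m => by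
  rw [map_zero]; exact ZDegLE.zero _

theorem GrowthLE.add {c : ℤ} {f g : Space 𝕜} (hf : GrowthLE c f) (hg : GrowthLE c g) :
    GrowthLE c (f + g) := fun m => by rw [map_add]; exact (hf m).add (hg m)

theorem GrowthLE.neg {c : ℤ} {f : Space 𝕜} (hf : GrowthLE c f) : GrowthLE c (-f) :=
  fun m => by rw [map_neg]; exact (hf m).neg

theorem GrowthLE.sum {ι : Type*} {c : ℤ} (s : Finset ι) {f : ι → Space 𝕜}
    (hf : ∀ k ∈ s, GrowthLE c (f k)) : GrowthLE c (∑ k ∈ s, f k) := fun m => by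
  rw [map_sum]; exact ZDegLE.sum s fun k hk => hf k hk m

theorem GrowthLE.mul {c c' : ℤ} {f g : Space 𝕜} (hf : GrowthLE c f) (hg : GrowthLE c' g) :
    GrowthLE (c + c') (f * g) := fun m => by
  rw [coeff_mul]
  refine ZDegLE.sum _ fun p hp => ((hf p.1).mul (hg p.2)).mono ?_
  have := Finset.HasAntidiagonal.mem_antidiagonal.mp hp
  omega

theorem SDegLE.growthLE {c : ℤ} {f : Space 𝕜} (hf : SDegLE c f) : GrowthLE c f :=
  fun m => (hf m).mono (by omega)

theorem growthLE_w : GrowthLE (-1) (w 𝕜) := fun m => by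
  rw [w, coeff_X]; split_ifs with h
  · rw [h]; exact zDegLE_single (0 : ℤ) (1 : 𝕜)
  · exact ZDegLE.zero _

theorem GrowthLE.pow {c : ℤ} {f : Space 𝕜} (hf : GrowthLE c f) (k : ℕ) :
    GrowthLE (k * c) (f ^ k) := by
  induction k with
  | zero => simpa using (sDegLE_one (𝕜 := 𝕜)).growthLE
  | succ k ih => rw [pow_succ]; exact (ih.mul hf).mono (by push_cast; linarith)

theorem GrowthLE.dz_pow {c : ℤ} {f : Space 𝕜} (hf : GrowthLE c f) (j : ℕ) :
    GrowthLE (c - j) ((dz 𝕜 ^ j) f) := by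
  induction j with
  | zero => simpa using hf
  | succ j ih =>
    rw [pow_succ']
    intro m
    change ZDegLE _ (coeff m (DeformedGKM.dz 𝕜 ((DeformedGKM.dz 𝕜 ^ j) f)))
    rw [coeff_dz']
    exact (dL_mem_degLE _ _ (ih m)).mono (by push_cast; omega)

theorem GrowthLE.dz {c : ℤ} {f : Space 𝕜} (hf : GrowthLE c f) : GrowthLE (c - 1) (dz 𝕜 f) := by
  simpa using hf.dz_pow 1

/-- A power series in `ψ` whose coefficients have growth at most `c - j`. -/
def Weighted (c : ℤ) (g : PowerSeries (Space 𝕜)) : Prop := ∀ j : ℕ, GrowthLE (c - j) (coeff j g)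

theorem Weighted.add {c : ℤ} {f g : PowerSeries (Space 𝕜)} (hf : Weighted c f)
    (hg : Weighted c g) : Weighted c (f + g) := fun j => by
  rw [map_add]; exact (hf j).add (hg j)

theorem Weighted.mul {c c' : ℤ} {f g : PowerSeries (Space 𝕜)} (hf : Weighted c f)
    (hg : Weighted c' g) : Weighted (c + c') (f * g) := fun m => by
  rw [coeff_mul]
  refine GrowthLE.sum _ fun p hp => ((hf p.1).mul (hg p.2)).mono ?_
  have := Finset.HasAntidiagonal.mem_antidiagonal.mp hp
  omega

theorem weighted_C {c : ℤ} {a : Space 𝕜} (ha : GrowthLE c a) : Weighted c (C a) := fun j => by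
  rw [coeff_C]; split_ifs with h
  · rw [h]; simpa using ha
  · exact GrowthLE.zero _

theorem weighted_X : Weighted 1 (X : PowerSeries (Space 𝕜)) := fun j => by
  rw [coeff_X]; split_ifs with h
  · rw [h]; simpa using (sDegLE_one (𝕜 := 𝕜)).growthLE
  · exact GrowthLE.zero _

theorem Weighted.pow {c : ℤ} {f : PowerSeries (Space 𝕜)} (hf : Weighted c f) (k : ℕ) :
    Weighted (k * c) (f ^ k) := by
  induction k with
  | zero => simpa using weighted_C (sDegLE_one (𝕜 := 𝕜)).growthLE
  | succ k ih =>
    rw [pow_succ, show ((k + 1 : ℕ) : ℤ) * c = k * c + c by push_cast; ring]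
    exact ih.mul hf

theorem Weighted.pderiv {c : ℤ} {f : PowerSeries (Space 𝕜)} (hf : Weighted c f) :
    Weighted (c - 1) (pderiv f) := fun j => by
  rw [coeff_pderiv, nsmul_eq_mul, ← cst_natCast]
  exact ((sDegLE_cst _).growthLE.mul (hf (j + 1))).mono (by push_cast; omega)

end Growth

/-! ### Taylor series in ψ and exponentials of them. -/

section Taylor

open PowerSeries Finset

variable {𝕜 : Type*} [Field 𝕜]

variable (𝕜) in
/-- `∂/∂z` on power series in `ψ`. -/
def dzT : PowerSeries (Space 𝕜) →+ PowerSeries (Space 𝕜) where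
  toFun f := PowerSeries.mk fun j => dz 𝕜 (coeff j f)
  map_zero' := by ext1 j; simp
  map_add' f g := by ext1 j; simp

theorem coeff_dzT (f : PowerSeries (Space 𝕜)) (j : ℕ) : coeff j (dzT 𝕜 f) = dz 𝕜 (coeff j f) :=
  coeff_mk j fun j => dz 𝕜 (coeff j f)

theorem dzT_mul (f g : PowerSeries (Space 𝕜)) :
    dzT 𝕜 (f * g) = dzT 𝕜 f * g + f * dzT 𝕜 g := by
  ext1 j
  rw [coeff_dzT, map_add, coeff_mul, coeff_mul, coeff_mul, map_sum, ← Finset.sum_add_distrib]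
  exact Finset.sum_congr rfl fun p _ => by rw [dz_mul, coeff_dzT, coeff_dzT]

theorem dzT_C (a : Space 𝕜) : dzT 𝕜 (C a) = C (dz 𝕜 a) := by
  ext1 j
  rw [coeff_dzT, coeff_C, coeff_C]; split_ifs
  · rfl
  · exact map_zero _

theorem dzT_X : dzT 𝕜 X = 0 := by
  ext1 j
  rw [coeff_dzT, coeff_X, map_zero]; split_ifs
  · exact dz_one
  · exact map_zero _

theorem dzT_pow (f : PowerSeries (Space 𝕜)) (i : ℕ) :
    dzT 𝕜 (f ^ (i + 1)) = (i + 1) • (dzT 𝕜 f * f ^ i) := by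
  induction i with
  | zero => simp
  | succ i ih =>
    rw [pow_succ f (i + 1), dzT_mul, ih]
    simp only [nsmul_eq_mul]
    push_cast
    ring

variable (𝕜) in
/-- `z + ψ`. -/
def zPsi : PowerSeries (Space 𝕜) := C (z 𝕜) + X

theorem weighted_zPsi_pow (k : ℕ) : Weighted k (zPsi 𝕜 ^ k) := by
  have := ((weighted_C (sDegLE_z (𝕜 := 𝕜)).growthLE).add weighted_X).pow k
  rwa [mul_one] at this

theorem pderiv_zPsi_pow (k : ℕ) : pderiv (zPsi 𝕜 ^ (k + 1)) = (k + 1) • zPsi 𝕜 ^ k := by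
  rw [pderiv_pow (Commute.all _ _), zPsi, map_add, pderiv_C, pderiv_X, zero_add, one_mul]

theorem dzT_zPsi_pow (k : ℕ) : dzT 𝕜 (zPsi 𝕜 ^ k) = pderiv (zPsi 𝕜 ^ k) := by
  cases k with
  | zero => rw [pow_zero, pderiv_one, ← map_one C, dzT_C, dz_one, map_zero]
  | succ k =>
    rw [pderiv_zPsi_pow, dzT_pow, zPsi, map_add, dzT_C, dzT_X, dz_z, map_one, add_zero, one_mul]

variable [CharZero 𝕜]

/-- For series in ψ over `Space 𝕜` the formal exponential is taken with scalar field `LaurentSeries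
𝕜`. -/
instance : CharZero (LaurentSeries 𝕜) :=
  charZero_of_injective_ringHom (f := (HahnSeries.C : 𝕜 →+* LaurentSeries 𝕜))
    HahnSeries.C_injective

omit [CharZero 𝕜] in
theorem inv_natCast_smul (k : ℕ) (f : Space 𝕜) :
    ((k : LaurentSeries 𝕜)⁻¹) • f = cst (k : 𝕜)⁻¹ * f := by
  ext1 m
  rw [coeff_smul, coeff_cst_mul, smul_eq_mul, map_inv₀ (HahnSeries.C : 𝕜 →+* LaurentSeries 𝕜),
    map_natCast]

theorem eq_of_nsmul_succ (k : ℕ) {f g : Space 𝕜} (h : (k + 1) • f = (k + 1) • g) : f = g :=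
  nsmul_succ_injective (LaurentSeries 𝕜) k h

/-- The Taylor series `f(z + ψ)`. -/
def taylorT (f : Space 𝕜) : PowerSeries (Space 𝕜) :=
  PowerSeries.mk fun j => cst (j.factorial : 𝕜)⁻¹ * (dz 𝕜 ^ j) f

omit [CharZero 𝕜] in
theorem coeff_taylorT (f : Space 𝕜) (j : ℕ) :
    coeff j (taylorT f) = cst (j.factorial : 𝕜)⁻¹ * (dz 𝕜 ^ j) f :=
  coeff_mk j fun j => cst (j.factorial : 𝕜)⁻¹ * (dz 𝕜 ^ j) f

theorem nsmul_cst_factorial_inv (j : ℕ) (f : Space 𝕜) :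
    (j + 1) • (cst ((j + 1).factorial : 𝕜)⁻¹ * f) = cst (j.factorial : 𝕜)⁻¹ * f := by
  have h0 : ((j + 1 : ℕ) : 𝕜) ≠ 0 := Nat.cast_ne_zero.mpr (by omega)
  rw [nsmul_eq_mul, ← cst_natCast, ← mul_assoc, ← cst_mul, Nat.factorial_succ, Nat.cast_mul,
    mul_inv, mul_inv_cancel_left₀ h0]

theorem pderiv_taylorT (f : Space 𝕜) : pderiv (taylorT f) = dzT 𝕜 (taylorT f) := by
  ext1 j
  rw [coeff_pderiv, coeff_dzT, coeff_taylorT, coeff_taylorT, nsmul_cst_factorial_inv, dz_cst_mul,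
    pow_succ']
  rfl

/-- The equation ∂F/∂ψ = ∂F/∂z determines each coefficient in ψ from the preceding one. -/
theorem eq_taylorT {F : PowerSeries (Space 𝕜)} {f : Space 𝕜} (h : pderiv F = dzT 𝕜 F)
    (h0 : coeff 0 F = f) : F = taylorT f := by
  ext1 j
  induction j with
  | zero => rw [h0, coeff_taylorT]; simp [cst_one]
  | succ j ih =>
    refine eq_of_nsmul_succ j ?_
    rw [← coeff_pderiv, ← coeff_pderiv, h, pderiv_taylorT, coeff_dzT, coeff_dzT, ih]

omit [CharZero 𝕜] in
theorem weighted_taylorT {c : ℤ} {f : Space 𝕜} (hf : GrowthLE c f) : Weighted c (taylorT f) :=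
  fun j => by
    rw [coeff_taylorT]
    exact ((sDegLE_cst _).growthLE.mul (hf.dz_pow j)).mono (by omega)

omit [CharZero 𝕜] in
theorem expSeries_eq_pexp (T : PowerSeries (Space 𝕜)) :
    expSeries T = pexp (LaurentSeries 𝕜) T := by
  ext1 N
  rw [expSeries, pexp, coeff_mk, coeff_mk]
  exact Finset.sum_congr rfl fun l _ => (inv_natCast_smul _ _).symm

theorem pderiv_expSeries {T : PowerSeries (Space 𝕜)} (hT : X ∣ T) :
    pderiv (expSeries T) = pderiv T * expSeries T := by
  rw [expSeries_eq_pexp]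
  exact pderiv_pexp _ hT (Commute.all _ _)

theorem dzT_expSeries {T : PowerSeries (Space 𝕜)} (hT : X ∣ T) :
    dzT 𝕜 (expSeries T) = dzT 𝕜 T * expSeries T := by
  ext1 N
  rw [expSeries_eq_pexp, coeff_dzT, coeff_pexp hT (Nat.le_succ N), coeff_mul_pexp hT _ le_rfl,
    map_sum, Finset.sum_range_succ']
  have h0 : dz 𝕜 (((Nat.factorial 0 : LaurentSeries 𝕜)⁻¹) • coeff N (T ^ 0)) = 0 := by
    rw [inv_natCast_smul, dz_cst_mul, ← coeff_dzT, pow_zero, ← map_one C, dzT_C, dz_one, map_zero,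
      map_zero, mul_zero]
  rw [h0, add_zero]
  refine Finset.sum_congr rfl fun i _ => ?_
  rw [inv_natCast_smul, inv_natCast_smul, dz_cst_mul, ← coeff_dzT, dzT_pow, map_nsmul,
    mul_smul_comm, nsmul_cst_factorial_inv]

end Taylor

/-! ### Perturbative Gaussian integrals, term by term. -/

section Gaussian

open PowerSeries Finset

variable {𝕜 : Type*} [Field 𝕜] (n : ℕ) (ħ : 𝕜)

/-- The Gaussian integral of the term of degree `2 r` in `ψ`. -/
def gaussTerm (f : PowerSeries (Space 𝕜)) (r : ℕ) : Space 𝕜 :=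
  cst (Nat.doubleFactorial (2 * r - 1) : 𝕜) * uInv n ħ ^ r * coeff (2 * r) f

theorem gaussTerm_add (f g : PowerSeries (Space 𝕜)) (r : ℕ) :
    gaussTerm n ħ (f + g) r = gaussTerm n ħ f r + gaussTerm n ħ g r := by
  rw [gaussTerm, map_add, mul_add]; rfl

theorem gaussTerm_neg (f : PowerSeries (Space 𝕜)) (r : ℕ) :
    gaussTerm n ħ (-f) r = -gaussTerm n ħ f r := by
  rw [gaussTerm, map_neg, mul_neg]; rfl

theorem gaussTerm_C_mul (a : Space 𝕜) (f : PowerSeries (Space 𝕜)) (r : ℕ) :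
    gaussTerm n ħ (C a * f) r = a * gaussTerm n ħ f r := by
  rw [gaussTerm, gaussTerm, coeff_C_mul]; ring

theorem gaussTerm_zero_X_mul (f : PowerSeries (Space 𝕜)) : gaussTerm n ħ (X * f) 0 = 0 := by
  rw [gaussTerm, mul_zero, coeff_zero_X_mul, mul_zero]

theorem doubleFactorial_succ (r : ℕ) :
    Nat.doubleFactorial (2 * (r + 1) - 1) = (2 * r + 1) * Nat.doubleFactorial (2 * r - 1) := by
  cases r with
  | zero => rfl
  | succ r =>
    rw [show 2 * (r + 1 + 1) - 1 = 2 * r + 1 + 2 by omega, Nat.doubleFactorial_add_two,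
      show 2 * (r + 1) - 1 = 2 * r + 1 by omega,
      show 2 * r + 1 + 2 = 2 * (r + 1) + 1 by ring]

variable {ħ}

/-- Integration by parts. -/
theorem potU_mul_gaussTerm (hħ : ħ ≠ 0) (f : PowerSeries (Space 𝕜)) (r : ℕ) :
    potU n ħ * gaussTerm n ħ (X * f) (r + 1) = gaussTerm n ħ (pderiv f) r := by
  rw [gaussTerm, gaussTerm, show 2 * (r + 1) = 2 * r + 1 + 1 by ring, coeff_succ_X_mul,
    coeff_pderiv, show 2 * r + 1 + 1 - 1 = 2 * (r + 1) - 1 by omega, doubleFactorial_succ,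
    Nat.cast_mul, cst_mul, cst_natCast (2 * r + 1), nsmul_eq_mul, pow_succ]
  linear_combination (((2 * r + 1 : ℕ) : Space 𝕜) * cst (Nat.doubleFactorial (2 * r - 1) : 𝕜) *
    uInv n ħ ^ r * coeff (2 * r + 1) f) * potU_mul_uInv n hħ

/-- Differentiation with respect to the parameter. -/
theorem uInv_mul_dz_gaussTerm [CharZero 𝕜] (hħ : ħ ≠ 0) (f : PowerSeries (Space 𝕜)) (r : ℕ) :
    uInv n ħ * dz 𝕜 (gaussTerm n ħ f r) + cst 2⁻¹ * dz 𝕜 (uInv n ħ) * gaussTerm n ħ f r =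
      uInv n ħ * (gaussTerm n ħ (dzT 𝕜 f) r -
        cst 2⁻¹ * dz 𝕜 (potU n ħ) * gaussTerm n ħ (X * (X * f)) (r + 1)) := by
  -- Moment recursion: two more factors ψ give (2r + 1) U⁻¹. Half of it accounts for the derivative
  -- of U⁻ʳ together with that of the normalization.
  have h1 : gaussTerm n ħ (X * (X * f)) (r + 1) =
      cst ((2 * r + 1 : ℕ) : 𝕜) * uInv n ħ * gaussTerm n ħ f r := by
    rw [gaussTerm, gaussTerm, show 2 * (r + 1) = 2 * r + 1 + 1 by ring, coeff_succ_X_mul,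
      coeff_succ_X_mul, show 2 * r + 1 + 1 - 1 = 2 * (r + 1) - 1 by omega, doubleFactorial_succ,
      Nat.cast_mul, cst_mul]
    ring
  have h2 : (r : Space 𝕜) * uInv n ħ ^ (r - 1) * uInv n ħ ^ 2 = r * uInv n ħ ^ r * uInv n ħ := by
    cases r with
    | zero => simp
    | succ r => rw [Nat.add_sub_cancel]; ring
  have h3 : dz 𝕜 (gaussTerm n ħ f r) = gaussTerm n ħ (dzT 𝕜 f) r -
      r * dz 𝕜 (potU n ħ) * uInv n ħ * gaussTerm n ħ f r := by
    rw [gaussTerm, gaussTerm, dz_mul, dz_cst_mul, dz_pow, coeff_dzT, dz_uInv n hħ]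
    linear_combination -(cst (Nat.doubleFactorial (2 * r - 1) : 𝕜) * dz 𝕜 (potU n ħ) *
      coeff (2 * r) f) * h2
  have h4 : (cst (2 : 𝕜)⁻¹ : Space 𝕜) * 2 = 1 := by
    have := cst_mul_cst_inv (𝕜 := 𝕜) (a := 2) two_ne_zero
    rw [show cst (2 : 𝕜) = 2 by exact_mod_cast cst_natCast (𝕜 := 𝕜) 2] at this
    rw [mul_comm, this]
  rw [h1, h3, dz_uInv n hħ, cst_natCast]
  push_cast
  linear_combination (r * dz 𝕜 (potU n ħ) * uInv n ħ ^ 2 * gaussTerm n ħ f r) * h4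

end Gaussian

section GaussianConvergence

open PowerSeries Finset

variable {𝕜 : Type*} [Field 𝕜]

theorem isNull_of_growthLE {u : ℕ → Space 𝕜} (c : ℤ) (h : ∀ r, GrowthLE (c - (r / 3 : ℕ)) (u r)) :
    IsNull u := fun m L => by
  filter_upwards [Filter.eventually_ge_atTop (3 * (c + m - L).natAbs)] with r hr
  exact (h r m).mono (by omega)

theorem StrongHasSum.zDegLE {u : ℕ → Space 𝕜} {s : Space 𝕜} (h : StrongHasSum u s) {m : ℕ} {L : ℤ}
    (hu : ∀ r, ZDegLE L (coeff m (u r))) : ZDegLE L (coeff m s) := by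
  obtain ⟨N, hN⟩ := (h m L).exists
  rw [map_sub, map_sum] at hN
  have := hN.add (ZDegLE.sum (range N) fun r _ => hu r)
  rwa [sub_add_cancel] at this

theorem StrongHasSum.shift {u : ℕ → Space 𝕜} {s : Space 𝕜} (h : StrongHasSum u s) :
    StrongHasSum (fun r => u (r + 1)) (s - u 0) := fun m L => by
  filter_upwards [(Filter.tendsto_add_atTop_nat 1).eventually (h m L)] with N hN
  rw [Finset.sum_range_succ'] at hN
  rwa [sub_sub, add_comm (u 0)]

theorem StrongHasSum.neg {u : ℕ → Space 𝕜} {s : Space 𝕜} (h : StrongHasSum u s) :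
    StrongHasSum (fun r => -u r) (-s) := by
  simpa only [neg_one_mul] using h.mul_left (-1)

theorem StrongHasSum.congr {u v : ℕ → Space 𝕜} {s : Space 𝕜} (h : StrongHasSum u s)
    (huv : ∀ r, u r = v r) : StrongHasSum v s := by
  rwa [← funext huv]

end GaussianConvergence

/-! ### Convergence, integration by parts and the action of Q̃ on integrals. -/

section GaussianIntegral

open PowerSeries Finset

variable {𝕜 : Type*} [Field 𝕜] [CharZero 𝕜] (n : ℕ) {ħ : 𝕜}

omit [CharZero 𝕜] in
theorem coeff_interaction (j : ℕ) : coeff j (interaction n ħ) =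
    if 3 ≤ j then -(cst (j.factorial : 𝕜)⁻¹ * (dz 𝕜 ^ (j - 2)) (potU n ħ)) else 0 :=
  coeff_mk j fun j =>
    if 3 ≤ j then -(cst (j.factorial : 𝕜)⁻¹ * (dz 𝕜 ^ (j - 2)) (potU n ħ)) else 0

omit [CharZero 𝕜] in
theorem X_dvd_interaction : X ∣ interaction n ħ := by
  rw [← pow_one X, X_pow_dvd_iff]
  intro m hm
  rw [coeff_interaction, if_neg (by omega)]

theorem coeff_pderiv_interaction (j : ℕ) : coeff j (pderiv (interaction n ħ)) =
    if 2 ≤ j then -(cst (j.factorial : 𝕜)⁻¹ * (dz 𝕜 ^ (j - 1)) (potU n ħ)) else 0 := by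
  rw [coeff_pderiv, coeff_interaction]
  by_cases h : 2 ≤ j
  · rw [if_pos h, if_pos (by omega), smul_neg, nsmul_cst_factorial_inv, show j + 1 - 2 = j - 1 by omega]
  · rw [if_neg h, if_neg (by omega), smul_zero]

variable (ħ) in
/-- `∑_{j ≥ 1} U^{(j-1)} ψ ^ j / j!`. -/
def primitiveT : PowerSeries (Space 𝕜) := PowerSeries.mk fun j =>
  if 1 ≤ j then cst (j.factorial : 𝕜)⁻¹ * (dz 𝕜 ^ (j - 1)) (potU n ħ) else 0

omit [CharZero 𝕜] in
theorem coeff_primitiveT (j : ℕ) : coeff j (primitiveT n ħ) =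
    if 1 ≤ j then cst (j.factorial : 𝕜)⁻¹ * (dz 𝕜 ^ (j - 1)) (potU n ħ) else 0 :=
  coeff_mk j fun j => if 1 ≤ j then cst (j.factorial : 𝕜)⁻¹ * (dz 𝕜 ^ (j - 1)) (potU n ħ) else 0

/-- The full exponent is -Uψ²/2 plus the interaction, so its ψ-derivative is -`primitiveT`. -/
theorem pderiv_interaction :
    pderiv (interaction n ħ) = C (potU n ħ) * X - primitiveT n ħ := by
  ext1 j
  rw [coeff_pderiv_interaction, map_sub, coeff_C_mul, coeff_X, coeff_primitiveT]
  rcases j with _ | _ | j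
  · simp
  · simp [cst_one]
  · simp

/-- Both derivatives send the interaction to terms -U^{(j-1)} ψ^j / j!, with j ≥ 3 for ∂/∂z and j ≥
2 for ∂/∂ψ; the boundary term j = 2 is the difference. -/
theorem dzT_interaction : dzT 𝕜 (interaction n ħ) =
    pderiv (interaction n ħ) + C (cst (2 : 𝕜)⁻¹ * dz 𝕜 (potU n ħ)) * (X * X) := by
  ext1 j
  rw [coeff_dzT, map_add, coeff_pderiv_interaction, coeff_C_mul, ← pow_two, coeff_X_pow,
    coeff_interaction]
  rcases lt_trichotomy j 2 with h | rfl | h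
  · rw [if_neg (by omega), if_neg (by omega), if_neg (by omega), map_zero, mul_zero, add_zero]
  · simp
  · rw [if_pos (by omega), if_pos (by omega), if_neg (by omega), mul_zero, add_zero, map_neg,
      dz_cst_mul, show j - 1 = (j - 2) + 1 by omega, pow_succ']
    rfl

omit [CharZero 𝕜] in
theorem dz_pow_succ (j : ℕ) (f : Space 𝕜) : (dz 𝕜 ^ (j + 1)) f = dz 𝕜 ((dz 𝕜 ^ j) f) := by
  rw [pow_succ']; rfl

/-- Identifies ħ `primitiveT` as V'(z + ψ) - V'(z), by V'' = ħU. -/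
theorem primitiveT_eq (hħ : ħ ≠ 0) :
    taylorT (potV' 𝕜 n) = C (potV' 𝕜 n) + C (cst ħ) * primitiveT n ħ := by
  have hdz : ∀ j : ℕ, (dz 𝕜 ^ (j + 1)) (potV' 𝕜 n) = cst ħ * (dz 𝕜 ^ j) (potU n ħ) := by
    intro j
    induction j with
    | zero => simpa using dz_potV' n hħ
    | succ j ih => rw [dz_pow_succ (j + 1), ih, dz_cst_mul, ← dz_pow_succ]
  ext1 j
  rw [coeff_taylorT, map_add, coeff_C_mul, coeff_C, coeff_primitiveT]
  cases j with
  | zero => simp [cst_one]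
  | succ j =>
    rw [if_neg (by omega), if_pos (by omega), hdz, Nat.add_sub_cancel, zero_add]
    ring

omit [CharZero 𝕜] in
theorem growthLE_zL_pow_mul {N : ℕ} (c : ℕ → 𝕜) :
    GrowthLE N (PowerSeries.mk fun m => HahnSeries.C (c m) * zL 𝕜 ^ (m + N)) := fun m => by
  rw [coeff_mk, zL_pow]
  exact ((zDegLE_single (0 : ℤ) (c m)).mul (zDegLE_single _ _)).mono (by push_cast; omega)

omit [CharZero 𝕜] in
variable (𝕜) in
theorem growthLE_potV' : GrowthLE (n + 1) (potV' 𝕜 n) :=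
  (growthLE_zL_pow_mul (N := n + 1) fun m => ((m + n + 1 : ℕ) : 𝕜)⁻¹).mono (by push_cast; omega)

theorem growthLE_potU (hħ : ħ ≠ 0) : GrowthLE n (potU n ħ) := by
  have h : potU n ħ = cst ħ⁻¹ * dz 𝕜 (potV' 𝕜 n) := by
    rw [dz_potV' n hħ, ← mul_assoc, ← cst_mul, inv_mul_cancel₀ hħ, cst_one, one_mul]
  rw [h]
  exact ((sDegLE_cst _).growthLE.mul (growthLE_potV' 𝕜 n).dz).mono (by omega)

omit [CharZero 𝕜] in
variable (ħ) in
theorem growthLE_uInv : GrowthLE (-n) (uInv n ħ) := by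
  have h1 : GrowthLE 0 (1 - w 𝕜 * z 𝕜) := by
    rw [sub_eq_add_neg]
    exact (sDegLE_one.growthLE).add ((growthLE_w.mul sDegLE_z.growthLE).mono (by omega)).neg
  exact ((sDegLE_zInv.growthLE.pow n).mul ((sDegLE_cst ħ).growthLE.mul h1)).mono (by linarith)

theorem weighted_primitiveT (hħ : ħ ≠ 0) : Weighted (n + 1) (primitiveT n ħ) := fun j => by
  rw [coeff_primitiveT]
  split_ifs with h
  · exact ((sDegLE_cst _).growthLE.mul ((growthLE_potU n hħ).dz_pow (j - 1))).mono (by omega)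
  · exact GrowthLE.zero _

variable (ħ) in
/-- The exponential of the interaction. -/
def gaussWeight : PowerSeries (Space 𝕜) := expSeries (interaction n ħ)

theorem pderiv_gaussWeight : pderiv (gaussWeight n ħ) =
    (C (potU n ħ) * X - primitiveT n ħ) * gaussWeight n ħ := by
  rw [gaussWeight, pderiv_expSeries (X_dvd_interaction n), pderiv_interaction]

theorem dzT_gaussWeight : dzT 𝕜 (gaussWeight n ħ) = (C (potU n ħ) * X - primitiveT n ħ +
    C (cst (2 : 𝕜)⁻¹ * dz 𝕜 (potU n ħ)) * (X * X)) * gaussWeight n ħ := by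
  rw [gaussWeight, dzT_expSeries (X_dvd_interaction n), dzT_interaction, pderiv_interaction]

/-- A vertex with j legs carries U^{(j-2)}, of degree n + 2 - j, and j ≥ 3. Hence ψ^N comes with at
most N/3 vertices, each contributing n + 2, while the legs contribute -N. -/
theorem growthLE_gaussWeight (hħ : ħ ≠ 0) (N : ℕ) :
    GrowthLE ((N / 3 : ℕ) * (n + 2) - N) (coeff N (gaussWeight n ħ)) := by
  induction N using Nat.strong_induction_on with
  | _ N ih =>
    cases N with
    | zero =>
      rw [gaussWeight, expSeries_eq_pexp, coeff_zero_pexp]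
      simpa using (sDegLE_one (𝕜 := 𝕜)).growthLE
    | succ N =>
      have h1 : GrowthLE (((N + 1) / 3 : ℕ) * (n + 2) - (N + 1 : ℕ))
          ((N + 1) • coeff (N + 1) (gaussWeight n ħ)) := by
        rw [← coeff_pderiv, gaussWeight, pderiv_expSeries (X_dvd_interaction n), coeff_mul]
        refine GrowthLE.sum _ fun p hp => ?_
        have hp := Finset.HasAntidiagonal.mem_antidiagonal.mp hp
        rw [coeff_pderiv_interaction]
        split_ifs with h
        · have hg := ((sDegLE_cst ((p.1.factorial : 𝕜)⁻¹)).growthLE.mul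
            ((growthLE_potU n hħ).dz_pow (p.1 - 1))).neg.mul (ih p.2 (by omega))
          refine hg.mono ?_
          -- The differentiated vertex uses p.1 + 1 ≥ 3 of the N + 1 legs.
          have h3 : ((p.2 / 3 : ℕ) : ℤ) ≤ ((N + 1) / 3 : ℕ) - 1 := by omega
          have h4 : ((p.1 - 1 : ℕ) : ℤ) = p.1 - 1 := by omega
          have h5 : ((p.2 / 3 : ℕ) : ℤ) * (n + 2) ≤ (((N + 1) / 3 : ℕ) - 1) * (n + 2) :=
            mul_le_mul_of_nonneg_right h3 (by omega)
          rw [h4]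
          push_cast at h5 ⊢
          have h6 : (p.1 : ℤ) + p.2 = N := by exact_mod_cast hp
          linarith
        · rw [zero_mul]; exact GrowthLE.zero _
      have h0 : ((N + 1 : ℕ) : 𝕜) ≠ 0 := Nat.cast_ne_zero.mpr (by omega)
      have h2 := (sDegLE_cst (((N + 1 : ℕ) : 𝕜)⁻¹)).growthLE.mul h1
      rw [nsmul_eq_mul, ← cst_natCast, ← mul_assoc, ← cst_mul, inv_mul_cancel₀ h0, cst_one,
        one_mul, zero_add] at h2
      exact h2

/-- Contracting 2r legs costs (n + 2) r, of which nr comes from U⁻ʳ, and the vertices give back at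
most (n + 2)⌊2r/3⌋. The degree tends to -∞ with r, which makes the integral converge. -/
theorem growthLE_gaussTerm (hħ : ħ ≠ 0) {c : ℤ} {g : PowerSeries (Space 𝕜)} (hg : Weighted c g)
    (r : ℕ) : GrowthLE (c - (n + 2) * (r - (2 * r / 3 : ℕ)))
      (gaussTerm n ħ (g * gaussWeight n ħ) r) := by
  have h1 : GrowthLE (c + (2 * r / 3 : ℕ) * (n + 2) - (2 * r : ℕ))
      (coeff (2 * r) (g * gaussWeight n ħ)) := by
    rw [coeff_mul]
    refine GrowthLE.sum _ fun p hp => ((hg p.1).mul (growthLE_gaussWeight n hħ p.2)).mono ?_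
    have hp := Finset.HasAntidiagonal.mem_antidiagonal.mp hp
    have h3 : ((p.2 / 3 : ℕ) : ℤ) ≤ (2 * r / 3 : ℕ) := by omega
    have h5 := mul_le_mul_of_nonneg_right h3 (show (0 : ℤ) ≤ n + 2 by omega)
    have h6 : (p.1 : ℤ) + p.2 = (2 * r : ℕ) := by exact_mod_cast hp
    linarith
  refine (((sDegLE_cst _).growthLE.mul ((growthLE_uInv n ħ).pow r)).mul h1).mono ?_
  push_cast
  linarith

theorem isNull_gaussTerm (hħ : ħ ≠ 0) {c : ℤ} {g : PowerSeries (Space 𝕜)} (hg : Weighted c g) :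
    IsNull (gaussTerm n ħ (g * gaussWeight n ħ)) :=
  isNull_of_growthLE c fun r => (growthLE_gaussTerm n hħ hg r).mono (by
    have h1 : ((r / 3 : ℕ) : ℤ) ≤ r - (2 * r / 3 : ℕ) := by omega
    have h2 : (0 : ℤ) ≤ r - (2 * r / 3 : ℕ) := by omega
    nlinarith)

variable (ħ) in
/-- The perturbative Gaussian integral of `g`. -/
def gaussInt (g : PowerSeries (Space 𝕜)) : Space 𝕜 :=
  formalSum (gaussTerm n ħ (g * gaussWeight n ħ))

theorem strongHasSum_gaussInt (hħ : ħ ≠ 0) {c : ℤ} {g : PowerSeries (Space 𝕜)}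
    (hg : Weighted c g) :
    StrongHasSum (gaussTerm n ħ (g * gaussWeight n ħ)) (gaussInt n ħ g) := by
  obtain ⟨s, hs⟩ := (isNull_gaussTerm n hħ hg).exists_strongHasSum
  rwa [gaussInt, hs.formalHasSum.formalSum_eq]

theorem gaussInt_add (hħ : ħ ≠ 0) {c c' : ℤ} {g g' : PowerSeries (Space 𝕜)}
    (hg : Weighted c g) (hg' : Weighted c' g') :
    gaussInt n ħ (g + g') = gaussInt n ħ g + gaussInt n ħ g' := by
  have h := (strongHasSum_gaussInt n hħ hg).add (strongHasSum_gaussInt n hħ hg')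
  have h' : StrongHasSum (gaussTerm n ħ ((g + g') * gaussWeight n ħ))
      (gaussInt n ħ g + gaussInt n ħ g') := by
    refine h.congr fun r => ?_
    rw [add_mul, gaussTerm_add]
  rw [gaussInt, h'.formalHasSum.formalSum_eq]

theorem gaussInt_C_mul (hħ : ħ ≠ 0) {c : ℤ} (a : Space 𝕜) {g : PowerSeries (Space 𝕜)}
    (hg : Weighted c g) : gaussInt n ħ (C a * g) = a * gaussInt n ħ g := by
  have h' : StrongHasSum (gaussTerm n ħ ((C a * g) * gaussWeight n ħ)) (a * gaussInt n ħ g) := by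
    refine ((strongHasSum_gaussInt n hħ hg).mul_left a).congr fun r => ?_
    rw [mul_assoc, gaussTerm_C_mul]
  rw [gaussInt, h'.formalHasSum.formalSum_eq]

theorem gaussInt_sum (hħ : ħ ≠ 0) {ι : Type*} (s : Finset ι) (c : ι → ℤ) (a : ι → Space 𝕜)
    (g : ι → PowerSeries (Space 𝕜)) (hg : ∀ i, Weighted (c i) (g i)) :
    gaussInt n ħ (∑ i ∈ s, C (a i) * g i) = ∑ i ∈ s, a i * gaussInt n ħ (g i) := by
  have h' : StrongHasSum (gaussTerm n ħ ((∑ i ∈ s, C (a i) * g i) * gaussWeight n ħ))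
      (∑ i ∈ s, a i * gaussInt n ħ (g i)) := by
    classical
    induction s using Finset.induction_on with
    | empty =>
      rw [Finset.sum_empty, Finset.sum_empty, zero_mul]
      have : ∀ r, gaussTerm n ħ (0 : PowerSeries (Space 𝕜)) r = 0 := fun r => by
        rw [gaussTerm, map_zero, mul_zero]
      intro m L
      simp only [this]
      exact Filter.Eventually.of_forall fun N => by simpa using ZDegLE.zero _
    | insert i s hi ih =>
      rw [Finset.sum_insert hi, Finset.sum_insert hi]
      refine (((strongHasSum_gaussInt n hħ (hg i)).mul_left (a i)).add ih).congr fun r => ?_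
      rw [add_mul, gaussTerm_add, mul_assoc, gaussTerm_C_mul]
  rw [gaussInt, h'.formalHasSum.formalSum_eq]

/-- Integration by parts. -/
theorem strongHasSum_pderiv (hħ : ħ ≠ 0) {c : ℤ} {g : PowerSeries (Space 𝕜)}
    (hg : Weighted c g) :
    StrongHasSum (gaussTerm n ħ (pderiv (g * gaussWeight n ħ)))
      (potU n ħ * gaussInt n ħ (X * g)) := by
  have h := (strongHasSum_gaussInt n hħ (weighted_X.mul hg)).shift.mul_left (potU n ħ)
  rw [mul_assoc, gaussTerm_zero_X_mul, sub_zero] at h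
  refine h.congr fun r => ?_
  rw [potU_mul_gaussTerm n hħ]

/-- The integral of a total ψ-derivative of g against the full weight vanishes, and the logarithmic
derivative of that weight is -`primitiveT`. -/
theorem gaussInt_pderiv (hħ : ħ ≠ 0) {c : ℤ} {g : PowerSeries (Space 𝕜)} (hg : Weighted c g) :
    gaussInt n ħ (pderiv g) = gaussInt n ħ (primitiveT n ħ * g) := by
  have h1 := strongHasSum_pderiv n hħ hg
  have h2 := ((strongHasSum_gaussInt n hħ (hg.pderiv)).add
    ((strongHasSum_gaussInt n hħ (weighted_X.mul hg)).mul_left (potU n ħ))).add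
      (strongHasSum_gaussInt n hħ ((weighted_primitiveT n hħ).mul hg)).neg
  have h3 := h1.unique (h2.congr fun r => by
    rw [← gaussTerm_C_mul, ← gaussTerm_add, ← gaussTerm_neg, ← gaussTerm_add]
    congr 1
    rw [pderiv_mul, pderiv_gaussWeight]
    ring)
  linear_combination -h3

omit [CharZero 𝕜] in
theorem Qtilde_apply (hħ : ħ ≠ 0) (f : Space 𝕜) : Qtilde n ħ f =
    z 𝕜 * f + (uInv n ħ * dz 𝕜 f + cst 2⁻¹ * dz 𝕜 (uInv n ħ) * f) := by
  rw [← act_qS n hħ, qS, map_add, map_add, map_mul, act_mulS, act_mulS, act_mulS, act_dS,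
    ← add_assoc]
  rfl

/-- When g depends on z + ψ only, the z-derivative of the integrand is its ψ-derivative up to a ψ²
term, and U⁻¹ times the latter integrates to ψ by parts. The term -U'/(2U²) of Q̃ undoes the
derivative of the normalization √U. -/
theorem Qtilde_gaussInt (hħ : ħ ≠ 0) {c : ℤ} {g : PowerSeries (Space 𝕜)} (hg : Weighted c g)
    (hd : dzT 𝕜 g = pderiv g) : Qtilde n ħ (gaussInt n ħ g) = gaussInt n ħ (zPsi 𝕜 * g) := by
  have hI := strongHasSum_gaussInt n hħ hg
  have h1 := ((hI.act isBoundedOp_dS).mul_left (uInv n ħ)).add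
    (hI.mul_left (cst 2⁻¹ * dz 𝕜 (uInv n ħ)))
  have h2 := (strongHasSum_gaussInt n hħ (weighted_X.mul (weighted_X.mul hg))).shift
  rw [mul_assoc, gaussTerm_zero_X_mul, sub_zero] at h2
  -- The two ψ² contributions sit at neighbouring indices r and r + 1, so they cancel only after
  -- summation; the shift costs nothing as the term r = 0 vanishes.
  have h3 := ((strongHasSum_pderiv n hħ hg).add ((strongHasSum_gaussInt n hħ
    (weighted_X.mul (weighted_X.mul hg))).mul_left (cst 2⁻¹ * dz 𝕜 (potU n ħ)))).add
      (h2.mul_left (cst 2⁻¹ * dz 𝕜 (potU n ħ))).neg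
  have h4 := (h3.mul_left (uInv n ħ)).unique (h1.congr fun r => by
    have key : gaussTerm n ħ (dzT 𝕜 (g * gaussWeight n ħ)) r =
        gaussTerm n ħ (pderiv (g * gaussWeight n ħ)) r +
          cst 2⁻¹ * dz 𝕜 (potU n ħ) * gaussTerm n ħ (X * (X * g) * gaussWeight n ħ) r := by
      rw [← gaussTerm_C_mul, ← gaussTerm_add]
      congr 1
      rw [dzT_mul, dzT_gaussWeight, hd, pderiv_mul, pderiv_gaussWeight]
      ring
    rw [act_dS, uInv_mul_dz_gaussTerm n hħ, key, mul_assoc X g]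
    ring)
  rw [act_dS] at h4
  rw [Qtilde_apply n hħ, ← h4, zPsi, add_mul, gaussInt_add n hħ
    ((weighted_C (sDegLE_z (𝕜 := 𝕜)).growthLE).mul hg) (weighted_X.mul hg), gaussInt_C_mul n hħ _ hg]
  linear_combination gaussInt n ħ (X * g) * potU_mul_uInv n hħ

end GaussianIntegral

/-! ### Action of Q̃ and V' on the basis of W. -/

section Basis

open PowerSeries Finset

variable {𝕜 : Type*} [Field 𝕜] [CharZero 𝕜] (n : ℕ) {ħ : 𝕜}

omit [CharZero 𝕜] in
theorem gkmTerm_eq (hħ : ħ ≠ 0) (k : ℕ) :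
    gkmTerm n ħ k = gaussTerm n ħ (zPsi 𝕜 ^ k * gaussWeight n ħ) := by
  funext r
  rw [gkmTerm, potU_inv n hħ]
  rfl

omit [CharZero 𝕜] in
theorem gkmBasis_eq (hħ : ħ ≠ 0) (k : ℕ) : gkmBasis n ħ k = gaussInt n ħ (zPsi 𝕜 ^ k) := by
  rw [gkmBasis, gkmTerm_eq n hħ, gaussInt]

theorem formalHasSum_gkmTerm (hħ : ħ ≠ 0) (k : ℕ) :
    FormalHasSum (gkmTerm n ħ k) (gkmBasis n ħ k) := by
  rw [gkmTerm_eq n hħ, gkmBasis_eq n hħ]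
  exact (strongHasSum_gaussInt n hħ (weighted_zPsi_pow k)).formalHasSum

theorem Qtilde_gkmBasis (hħ : ħ ≠ 0) (k : ℕ) :
    Qtilde n ħ (gkmBasis n ħ k) = gkmBasis n ħ (k + 1) := by
  rw [gkmBasis_eq n hħ, gkmBasis_eq n hħ, Qtilde_gaussInt n hħ (weighted_zPsi_pow k)
    (dzT_zPsi_pow k), pow_succ']

/-- The term r = 0 of the integral is z^k and every later one has lower degree at w = 0: this places
W in the big cell. -/
theorem zDegLE_coeff_gkmBasis (hħ : ħ ≠ 0) (k : ℕ) :
    ZDegLE (k - 1) (coeff 0 (gkmBasis n ħ k) - zL 𝕜 ^ k) := by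
  have h := (strongHasSum_gaussInt n hħ (weighted_zPsi_pow (𝕜 := 𝕜) k)).shift
  have h0 : gaussTerm n ħ (zPsi 𝕜 ^ k * gaussWeight n ħ) 0 = z 𝕜 ^ k := by
    rw [gaussTerm, mul_zero, coeff_zero_mul, gaussWeight, expSeries_eq_pexp, coeff_zero_pexp]
    simp [zPsi, cst_one]
  have hz : coeff 0 (z 𝕜 ^ k) = zL 𝕜 ^ k := by rw [z, ← map_pow, coeff_zero_C]
  rw [gkmBasis_eq n hħ, ← hz, ← map_sub, ← h0]
  refine h.zDegLE fun r => ((growthLE_gaussTerm n hħ (weighted_zPsi_pow k) (r + 1)) 0).mono ?_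
  have h1 : (1 : ℤ) ≤ (r + 1 : ℕ) - (2 * (r + 1) / 3 : ℕ) := by omega
  push_cast at h1 ⊢
  nlinarith

variable (𝕜) in
/-- The tail of `V'`, divided by `w ^ N`. -/
def potVTail (N : ℕ) : Space 𝕜 := PowerSeries.mk fun m =>
  HahnSeries.C ((m + N + n + 1 : ℕ) : 𝕜)⁻¹ * zL 𝕜 ^ (m + (N + n + 1))

omit [CharZero 𝕜] in
theorem weighted_taylorT_potVTail (N : ℕ) :
    Weighted ((N + n + 1 : ℕ) : ℤ) (taylorT (potVTail 𝕜 n N)) :=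
  weighted_taylorT (growthLE_zL_pow_mul fun m => ((m + N + n + 1 : ℕ) : 𝕜)⁻¹)

omit [CharZero 𝕜] in
theorem potV'_eq (N : ℕ) : potV' 𝕜 n = ∑ m ∈ range N, (w 𝕜 ^ m * cst ((m + n + 1 : ℕ) : 𝕜)⁻¹) *
    z 𝕜 ^ (m + n + 1) + w 𝕜 ^ N * potVTail 𝕜 n N := by
  ext1 i
  have hc : ∀ m : ℕ, coeff i ((w 𝕜 ^ m * cst ((m + n + 1 : ℕ) : 𝕜)⁻¹) * z 𝕜 ^ (m + n + 1)) =
      if i = m then HahnSeries.C ((m + n + 1 : ℕ) : 𝕜)⁻¹ * zL 𝕜 ^ (m + n + 1) else 0 := by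
    intro m
    rw [mul_assoc, w, z, cst, ← map_pow, ← map_mul, coeff_X_pow_mul', coeff_C]
    split_ifs <;> first | rfl | omega
  rw [map_add, map_sum, Finset.sum_congr rfl fun m _ => hc m, Finset.sum_ite_eq, w,
    coeff_X_pow_mul', potV', coeff_mk]
  by_cases h : i < N
  · rw [if_pos (by simpa using h), if_neg (by omega), add_zero]
  · rw [if_neg (by simpa using h), if_pos (by omega), potVTail, coeff_mk, zero_add,
      show i - N + N + n + 1 = i + n + 1 by omega,
      show i - N + (N + n + 1) = i + n + 1 by omega]

/-- A finite sum with a tail divisible by w^N is enough: the closed span is tested modulo powers of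
w, so only finite additivity of the integral is needed. -/
theorem taylorT_potV' (N : ℕ) : taylorT (potV' 𝕜 n) =
    ∑ m ∈ range N, C (w 𝕜 ^ m * cst ((m + n + 1 : ℕ) : 𝕜)⁻¹) * zPsi 𝕜 ^ (m + n + 1) +
      C (w 𝕜 ^ N) * taylorT (potVTail 𝕜 n N) := by
  symm
  refine eq_taylorT ?_ ?_
  · have hdz : ∀ m : ℕ, dz 𝕜 (w 𝕜 ^ m * cst ((m + n + 1 : ℕ) : 𝕜)⁻¹) = 0 := fun m => by
      rw [dz_w_pow_mul, dz_cst, mul_zero]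
    have hdw : dz 𝕜 (w 𝕜 ^ N) = 0 := by rw [dz_pow, dz_w, mul_zero]
    rw [map_add, map_add, map_sum, map_sum, pderiv_mul, dzT_mul, pderiv_C, dzT_C, hdw, map_zero,
      pderiv_taylorT]
    congr 1
    refine Finset.sum_congr rfl fun m _ => ?_
    rw [pderiv_mul, dzT_mul, pderiv_C, dzT_C, hdz, map_zero, dzT_zPsi_pow]
  · rw [potV'_eq n N, map_add, map_sum, coeff_C_mul, coeff_taylorT]
    congr 1
    · refine Finset.sum_congr rfl fun m _ => ?_
      rw [coeff_C_mul]
      simp [zPsi]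
    · simp [cst_one]

theorem gaussInt_pderiv_zPsi_pow (hħ : ħ ≠ 0) (k : ℕ) :
    gaussInt n ħ (pderiv (zPsi 𝕜 ^ k)) = k * gkmBasis n ħ (k - 1) := by
  cases k with
  | zero =>
    have hw1 : Weighted 0 (1 : PowerSeries (Space 𝕜)) := by
      simpa using weighted_zPsi_pow (𝕜 := 𝕜) 0
    rw [pow_zero, pderiv_one, Nat.cast_zero, zero_mul, ← zero_mul (1 : PowerSeries (Space 𝕜)),
      ← map_zero C, gaussInt_C_mul n hħ 0 hw1, zero_mul]
  | succ k =>
    rw [pderiv_zPsi_pow, nsmul_eq_mul, ← map_natCast C, gaussInt_C_mul n hħ _ (weighted_zPsi_pow k),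
      Nat.add_sub_cancel, gkmBasis_eq n hħ]

theorem gaussInt_taylorT_potV' (hħ : ħ ≠ 0) (k : ℕ) :
    gaussInt n ħ (taylorT (potV' 𝕜 n) * zPsi 𝕜 ^ k) =
      potV' 𝕜 n * gkmBasis n ħ k + cst ħ * (k * gkmBasis n ħ (k - 1)) := by
  have hk := weighted_zPsi_pow (𝕜 := 𝕜) k
  have hp := (weighted_primitiveT n hħ).mul hk
  rw [primitiveT_eq n hħ, add_mul, mul_assoc, gaussInt_add n hħ
    ((weighted_C (growthLE_potV' 𝕜 n)).mul hk)
    ((weighted_C (sDegLE_cst ħ).growthLE).mul hp), gaussInt_C_mul n hħ _ hk,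
    gaussInt_C_mul n hħ _ hp, ← gaussInt_pderiv n hħ hk, gkmBasis_eq n hħ,
    gaussInt_pderiv_zPsi_pow n hħ]

theorem sum_mul_pow_mul_pow {K : Type*} [CommRing K] (a : ℕ → K) (p b c : K) (N e k : ℕ) :
    (∑ m ∈ range N, a m * p ^ (m + e + 1) + b * c) * p ^ k =
      ∑ m ∈ range N, a m * p ^ (m + e + 1 + k) + b * (c * p ^ k) := by
  rw [add_mul, Finset.sum_mul, mul_assoc]
  congr 1
  exact Finset.sum_congr rfl fun m _ => by rw [mul_assoc, pow_add p (m + e + 1)]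

theorem gaussInt_taylorT_mul (hħ : ħ ≠ 0) (k N : ℕ) :
    gaussInt n ħ (taylorT (potV' 𝕜 n) * zPsi 𝕜 ^ k) =
      ∑ m ∈ range N, (w 𝕜 ^ m * cst ((m + n + 1 : ℕ) : 𝕜)⁻¹) * gkmBasis n ħ (m + n + 1 + k) +
        w 𝕜 ^ N * gaussInt n ħ (taylorT (potVTail 𝕜 n N) * zPsi 𝕜 ^ k) := by
  have hk := weighted_zPsi_pow (𝕜 := 𝕜) k
  have hs : taylorT (potV' 𝕜 n) * zPsi 𝕜 ^ k = ∑ m ∈ range N,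
      C (w 𝕜 ^ m * cst ((m + n + 1 : ℕ) : 𝕜)⁻¹) * zPsi 𝕜 ^ (m + n + 1 + k) +
        C (w 𝕜 ^ N) * (taylorT (potVTail 𝕜 n N) * zPsi 𝕜 ^ k) := by
    rw [taylorT_potV' n N]
    exact sum_mul_pow_mul_pow _ _ _ _ _ _ _
  have hvk := (weighted_taylorT_potVTail (𝕜 := 𝕜) n N).mul hk
  have hw : GrowthLE 0 (w 𝕜 ^ N) := (sDegLE_w.pow N).growthLE.mono (by simp)
  have hsum : Weighted (N + n + 1 + k : ℕ) (∑ m ∈ range N,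
      C (w 𝕜 ^ m * cst ((m + n + 1 : ℕ) : 𝕜)⁻¹) * zPsi 𝕜 ^ (m + n + 1 + k)) := fun j => by
    rw [map_sum]
    refine GrowthLE.sum _ fun m hm => ?_
    have hm : m < N := by simpa using hm
    have hw : GrowthLE 0 (w 𝕜 ^ m * cst ((m + n + 1 : ℕ) : 𝕜)⁻¹) :=
      (((sDegLE_w.pow m).mul (sDegLE_cst _)).mono (by simp)).growthLE
    exact (((weighted_C hw).mul (weighted_zPsi_pow (m + n + 1 + k))) j).mono
      (by push_cast; omega)
  rw [hs, gaussInt_add n hħ hsum ((weighted_C hw).mul hvk), gaussInt_C_mul n hħ _ hvk,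
    gaussInt_sum n hħ _ (fun m => ((m + n + 1 + k : ℕ) : ℤ)) _ _
      (fun m => weighted_zPsi_pow (m + n + 1 + k))]
  exact congrArg (· + w 𝕜 ^ N * gaussInt n ħ (taylorT (potVTail 𝕜 n N) * zPsi 𝕜 ^ k))
    (Finset.sum_congr rfl fun m _ => by rw [gkmBasis_eq n hħ])

/-- The integral of V'(z + ψ)(z + ψ)^k is computed twice: by expanding V' in powers of z + ψ, and by
splitting off V'(z) and integrating the rest by parts. -/
theorem potV'_mul_gkmBasis (hħ : ħ ≠ 0) (k N : ℕ) : ∃ f : Space 𝕜,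
    potV' 𝕜 n * gkmBasis n ħ k =
      ∑ m ∈ range N, (w 𝕜 ^ m * cst ((m + n + 1 : ℕ) : 𝕜)⁻¹) * gkmBasis n ħ (m + n + 1 + k) -
        cst ħ * (k * gkmBasis n ħ (k - 1)) + w 𝕜 ^ N * f := by
  refine ⟨gaussInt n ħ (taylorT (potVTail 𝕜 n N) * zPsi 𝕜 ^ k), ?_⟩
  have h1 := gaussInt_taylorT_mul n hħ k N
  rw [gaussInt_taylorT_potV' n hħ] at h1
  linear_combination h1

end Basis

/-! ### Operators of the filtration are determined on polynomials. -/

section Vanishing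

variable {𝕜 : Type*} [Field 𝕜]

/-- If a kills the lower powers, then a z^j is the j-fold commutator of a with z applied to 1, whose
degree is at most r whatever j is. -/
theorem zDegLE_of_apply_pow_eq_zero {r : ℤ} {j : ℕ} {a : LaurentEnd 𝕜} (ha : a ∈ fil r)
    (h : ∀ i < j, a (zL 𝕜 ^ i) = 0) : ZDegLE r (a (zL 𝕜 ^ j)) := by
  induction j generalizing a with
  | zero =>
    rw [pow_zero]
    exact (fil_le_degLE r ha 1 0 (zDegLE_single (0 : ℤ) (1 : 𝕜))).mono (by omega)
  | succ j ih =>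
    have h1 := ih (adZ_mem_fil ha) fun i hi => by
      rw [adZ_apply_apply, ← pow_succ', h _ (by omega), h _ (by omega), mul_zero, sub_zero]
    rwa [adZ_apply_apply, ← pow_succ', h j (by omega), mul_zero, sub_zero] at h1

/-- Smaller index means higher power of z. If a kills all powers above z^(-e), the k-fold commutator
of a with z maps z^(-e) to (-z)^k a z^(-e), of degree at most r - e for every k; hence a z^(-e) = 0.
-/
theorem apply_single_eq_zero_of_forall_lt {r : ℤ} {a : LaurentEnd 𝕜} (ha : a ∈ fil r) {e : ℤ}
    (h : ∀ i < e, a (HahnSeries.single i (1 : 𝕜)) = 0) :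
    a (HahnSeries.single e (1 : 𝕜)) = 0 := by
  have key : ∀ (k : ℕ) (a : LaurentEnd 𝕜), a ∈ fil r →
      (∀ i < e, a (HahnSeries.single i (1 : 𝕜)) = 0) →
      ZDegLE (r - e - k) (a (HahnSeries.single e (1 : 𝕜))) := by
    intro k
    induction k with
    | zero =>
      intro a ha _
      exact (fil_le_degLE r ha _ _ (zDegLE_single e 1)).mono (by push_cast; omega)
    | succ k ih =>
      intro a ha h
      have h1 := ih _ (adZ_mem_fil ha) fun i hi => by
        rw [adZ_apply_apply, zL_mul_single, h _ (by omega), h i hi, mul_zero, sub_zero]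
      rw [adZ_apply_apply, zL_mul_single, h _ (by omega), zero_sub] at h1
      intro i hi
      have h2 := h1.neg (i - 1) (by push_cast at hi; omega)
      rwa [neg_neg, coeff_zL_mul, sub_add_cancel] at h2
  refine eq_zero_of_zDegLE fun k => ⟨r - e - (k + (r - e).natAbs : ℕ), by omega, ?_⟩
  exact key _ a ha h

/-- Vanishing descends from the nonnegative powers to each negative one, and then extends to all
series, since truncating f at low degree changes a f only at low degree. -/
theorem eq_zero_of_apply_pow_eq_zero {r : ℤ} {a : LaurentEnd 𝕜} (ha : a ∈ fil r)
    (h : ∀ j : ℕ, a (zL 𝕜 ^ j) = 0) : a = 0 := by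
  have hneg : ∀ i : ℤ, i ≤ 0 → a (HahnSeries.single i (1 : 𝕜)) = 0 := fun i hi => by
    have := h i.natAbs
    rwa [zL_pow, show -(i.natAbs : ℤ) = i by omega] at this
  have hall : ∀ (k : ℕ) (i : ℤ), i ≤ k → a (HahnSeries.single i (1 : 𝕜)) = 0 := by
    intro k
    induction k with
    | zero => exact fun i hi => hneg i (by simpa using hi)
    | succ k ih =>
      intro i hi
      exact apply_single_eq_zero_of_forall_lt ha fun i' hi' => ih i' (by push_cast at hi; omega)
  refine LinearMap.ext fun f => ?_
  obtain ⟨L, hL⟩ := exists_zDegLE f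
  refine eq_zero_of_zDegLE fun k => ⟨-(k + r.natAbs : ℕ) - r + r, by omega, ?_⟩
  have h1 := fil_le_degLE r ha _ _ (exists_truncation f L (-(k + r.natAbs : ℕ) - r) hL)
  rw [map_sub, map_sum, Finset.sum_eq_zero fun e _ => by
    rw [map_smul, hall e.natAbs e (by omega), smul_zero], sub_zero] at h1
  exact h1

end Vanishing

/-! ### Infinite-order differential operators and the inverse of 1 + 𝒟₋. -/

section DifferentialSeries

open PowerSeries Finset

variable {𝕜 : Type*} [Field 𝕜]

theorem exists_laurent_strongSum (u : ℕ → LaurentSeries 𝕜) {L : ℤ}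
    (hu : ∀ k : ℕ, ZDegLE (L - k) (u k)) :
    ∃ s : LaurentSeries 𝕜, ∀ N : ℕ, ZDegLE (L - N) (s - ∑ k ∈ range N, u k) := by
  have hnull : IsNull fun k => (C (u k) : Space 𝕜) := fun m L' => by
    filter_upwards [Filter.eventually_ge_atTop (L - L').natAbs] with k hk
    rw [coeff_C]; split_ifs
    · exact (hu k).mono (by omega)
    · exact ZDegLE.zero _
  obtain ⟨s, hs⟩ := hnull.exists_strongHasSum
  refine ⟨coeff 0 s, fun N => ?_⟩
  obtain ⟨M, hM, hNM⟩ := ((hs 0 (L - N)).and (Filter.eventually_ge_atTop N)).exists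
  rw [map_sub, map_sum] at hM
  simp only [coeff_zero_C] at hM
  have h2 : ZDegLE (L - N) (∑ k ∈ Ico N M, u k) := ZDegLE.sum _ fun k hk =>
    (hu k).mono (by have := (Finset.mem_Ico.mp hk).1; omega)
  have h3 := hM.add h2
  rwa [Finset.sum_Ico_eq_sub _ hNM, sub_add_sub_cancel] at h3

/-- The operator `∑ k, b k (∂/∂z) ^ k`. -/
theorem exists_differentialEnd (b : ℕ → LaurentSeries 𝕜) (hb : ∀ k, ZDegLE (-1) (b k)) :
    ∃ D : LaurentEnd 𝕜, D ∈ fil (-1) ∧ ∀ f L, ZDegLE L f → ∀ N : ℕ,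
      ZDegLE (L - 1 - N) (D f - ∑ k ∈ range N, b k * (dL 𝕜 ^ k) f) := by
  have hu : ∀ f L, ZDegLE L f → ∀ k : ℕ, ZDegLE (L - 1 - k) (b k * (dL 𝕜 ^ k) f) :=
    fun f L hf k => ((hb k).mul (dL_pow_mem_degLE k f L hf)).mono (by omega)
  have hex : ∀ f, ∃ s : LaurentSeries 𝕜, ∀ L, ZDegLE L f → ∀ N : ℕ,
      ZDegLE (L - 1 - N) (s - ∑ k ∈ range N, b k * (dL 𝕜 ^ k) f) := by
    intro f
    obtain ⟨L₀, hL₀⟩ := exists_zDegLE f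
    obtain ⟨s, hs⟩ := exists_laurent_strongSum (fun k => b k * (dL 𝕜 ^ k) f) (hu f L₀ hL₀)
    refine ⟨s, fun L hL N => ?_⟩
    -- The sum was built with one bound L₀, while the estimate is wanted for every bound L; the
    -- additional terms make up for the difference.
    set M := N + (L₀ - L).natAbs with hM
    have h1 := (hs M).mono (show L₀ - 1 - (M : ℤ) ≤ L - 1 - N by omega)
    have h2 : ZDegLE (L - 1 - N) (∑ k ∈ Ico N M, b k * (dL 𝕜 ^ k) f) := ZDegLE.sum _ fun k hk =>
      (hu f L hL k).mono (by have := (Finset.mem_Ico.mp hk).1; omega)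
    have h3 := h1.add h2
    rwa [Finset.sum_Ico_eq_sub _ (by omega), sub_add_sub_cancel] at h3
  choose D hD using hex
  have huniq : ∀ f (x : LaurentSeries 𝕜) (L : ℤ),
      (∀ N : ℕ, ZDegLE (L - N) (x - ∑ k ∈ range N, b k * (dL 𝕜 ^ k) f)) → D f = x := by
    intro f x L hx
    obtain ⟨L₀, hL₀⟩ := exists_zDegLE f
    rw [← sub_eq_zero]
    refine eq_zero_of_zDegLE fun k => ?_
    set N : ℕ := k + L.natAbs + L₀.natAbs
    refine ⟨-k, le_rfl, ?_⟩
    have h1 := ((hD f L₀ hL₀ N).mono (show L₀ - 1 - (N : ℤ) ≤ -k by omega)).sub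
      ((hx N).mono (show L - (N : ℤ) ≤ -k by omega))
    rwa [sub_sub_sub_cancel_right] at h1
  refine ⟨{ toFun := D, map_add' := fun f g => ?_, map_smul' := fun c f => ?_ }, ?_, hD⟩
  · obtain ⟨L₁, h1⟩ := exists_zDegLE f
    obtain ⟨L₂, h2⟩ := exists_zDegLE g
    refine huniq _ _ (max L₁ L₂ - 1) fun N => ?_
    have h3 := (hD f _ (h1.mono (le_max_left L₁ L₂)) N).add
      (hD g _ (h2.mono (le_max_right L₁ L₂)) N)
    simp only [map_add, mul_add, Finset.sum_add_distrib]
    rwa [add_sub_add_comm]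
  · obtain ⟨L₁, h1⟩ := exists_zDegLE f
    refine huniq _ _ (L₁ - 1) fun N => ?_
    have h3 := (hD f _ h1 N).smul c
    rw [smul_sub, Finset.smul_sum] at h3
    have h4 : ∀ k, c • (b k * (dL 𝕜 ^ k) f) = b k * (dL 𝕜 ^ k) (c • f) := fun k =>
      ((mulL (b k) * dL 𝕜 ^ k).map_smul c f).symm
    rwa [Finset.sum_congr rfl fun k _ => h4 k] at h3
  · refine mem_fil_of_eventually (fun N => ∑ k ∈ range N, mulL (b k) * dL 𝕜 ^ k) (fun N => ?_) ?_
    · exact sum_mem fun k _ => fil_mono (by omega) (mul_mem_fil (mulL_mem_fil (hb k))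
        (dL_pow_mem_fil k))
    · intro f i
      obtain ⟨L, hL⟩ := exists_zDegLE f
      filter_upwards [Filter.eventually_ge_atTop (L.natAbs + i.natAbs)] with N hN
      have h1 := hD f L hL N i (by omega)
      rw [HahnSeries.coeff_sub, sub_eq_zero] at h1
      rw [LinearMap.sum_apply]
      exact h1.symm

theorem mem_HMinus_iff {f : Space 𝕜} : f ∈ HMinus 𝕜 ↔ SDegLE (-1) f :=
  ⟨fun h m i hi => h m i (by omega), fun h m i hi => h m i (by omega)⟩

theorem coeff_dz_pow (k m : ℕ) (f : Space 𝕜) :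
    coeff m ((dz 𝕜 ^ k) f) = (dL 𝕜 ^ k) (coeff m f) := by
  induction k with
  | zero => rfl
  | succ k ih => rw [pow_succ', pow_succ', Module.End.mul_apply, ← ih]; exact coeff_dz' _ _

/-- The operator `∑ k, a k (∂/∂z) ^ k` with coefficients in `H₋`. -/
theorem exists_differentialSeries (a : ℕ → Space 𝕜) (ha : ∀ k, a k ∈ HMinus 𝕜) :
    ∃ D : OpSeries 𝕜, D ∈ filS (-1) ∧
      ∀ f, StrongHasSum (fun k => (mulOp (a k) * dz 𝕜 ^ k) f) (act D f) := by
  have hex := fun m => exists_differentialEnd (fun k => coeff m (a k))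
    (fun k => mem_HMinus_iff.mp (ha k) m)
  choose D hD hsum using hex
  refine ⟨PowerSeries.mk D, fun m => by rw [coeff_mk]; exact hD m, fun f m L => ?_⟩
  choose B hB using fun m => exists_zDegLE (coeff m f)
  have hp : ∀ p ∈ antidiagonal m, ∀ᶠ N in atTop, ZDegLE L (D p.1 (coeff p.2 f) -
      ∑ k ∈ range N, coeff p.1 (a k) * (dL 𝕜 ^ k) (coeff p.2 f)) := fun p _ => by
    filter_upwards [Filter.eventually_ge_atTop (L.natAbs + (B p.2).natAbs)] with N hN
    exact (hsum p.1 _ _ (hB p.2) N).mono (by omega)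
  filter_upwards [(Filter.eventually_all_finset _).mpr hp] with N hN
  have h1 : ∀ k, coeff m ((mulOp (a k) * dz 𝕜 ^ k) f) =
      ∑ p ∈ antidiagonal m, coeff p.1 (a k) * (dL 𝕜 ^ k) (coeff p.2 f) := fun k => by
    change coeff m (a k * (dz 𝕜 ^ k) f) = _
    rw [coeff_mul]
    exact Finset.sum_congr rfl fun p _ => by rw [coeff_dz_pow]
  rw [map_sub, map_sum, Finset.sum_congr rfl fun k _ => h1 k, Finset.sum_comm, coeff_act,
    ← Finset.sum_sub_distrib]
  exact ZDegLE.sum _ fun p hp => by rw [coeff_mk]; exact hN p hp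

theorem one_add_mul_neg_pow {T : Type*} [Ring T] (D : T) (N : ℕ) :
    (1 + D) * (-D) ^ N = (-D) ^ N - (-D) ^ (N + 1) := by
  rw [pow_succ', add_mul, one_mul, neg_mul, sub_neg_eq_add]

/-- Operators `1 + D` with `D ∈ 𝒟₋` are invertible. -/
theorem bijective_act_one_add {D : OpSeries 𝕜} (hD : D ∈ filS (-1)) :
    Function.Bijective (act (1 + D)) := by
  -- (-D)^k lowers the degree by k. So the Neumann series converges and gives surjectivity, and a
  -- kernel vector f, being equal to all (-D)^k f, is zero.
  have hpow : ∀ k : ℕ, (-D) ^ k ∈ filS (-(k : ℤ)) := by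
    intro k
    induction k with
    | zero => simpa using one_mem_filS (𝕜 := 𝕜)
    | succ k ih => rw [pow_succ]; exact mul_mem_filS (by push_cast; omega) ih (neg_mem hD)
  have hnull : ∀ f, IsNull fun k => act ((-D) ^ k) f := fun f m L => by
    choose B hB using fun m => exists_zDegLE (coeff m f)
    have hp : ∀ p ∈ antidiagonal m, ∀ᶠ k : ℕ in atTop,
        ZDegLE L (coeff p.1 ((-D) ^ k) (coeff p.2 f)) := fun p _ => by
      filter_upwards [Filter.eventually_ge_atTop (L.natAbs + (B p.2).natAbs)] with k hk
      exact (fil_le_degLE _ (hpow k p.1) _ _ (hB p.2)).mono (by omega)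
    filter_upwards [(Filter.eventually_all_finset _).mpr hp] with k hk
    rw [coeff_act]
    exact ZDegLE.sum _ hk
  constructor
  · rw [injective_iff_map_eq_zero]
    intro f hf
    have h1 : act (-D) f = f := by
      rw [map_add, map_one] at hf
      rw [map_neg]
      exact neg_eq_of_add_eq_zero_left hf
    have h2 : ∀ k : ℕ, act ((-D) ^ k) f = f := by
      intro k
      induction k with
      | zero => rw [pow_zero, map_one]; rfl
      | succ k ih => rw [pow_succ, act_mul_apply, h1, ih]
    have h3 := hnull f
    simp only [h2] at h3
    exact eq_zero_of_isNull_const h3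
  · intro f
    obtain ⟨s, hs⟩ := (hnull f).exists_strongHasSum
    refine ⟨s, ?_⟩
    have h1 := hs.act (isBoundedOp_of_mem_filS (add_mem one_mem_filS (filS_mono (by omega) hD)))
    refine h1.unique ?_
    have h2 : ∀ N, ∑ k ∈ range N, act (1 + D) (act ((-D) ^ k) f) = f - act ((-D) ^ N) f := by
      intro N
      induction N with
      | zero => rw [Finset.sum_range_zero, pow_zero, map_one]; exact (sub_self f).symm
      | succ N ih =>
        have h3 : (1 + D) * (-D) ^ N = (-D) ^ N - (-D) ^ (N + 1) := by
          exact one_add_mul_neg_pow D N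
        rw [Finset.sum_range_succ, ih, ← act_mul_apply, h3, map_sub]
        exact sub_add_sub_cancel _ _ _
    simp only [StrongHasSum, h2, sub_sub_cancel]
    exact hnull f

end DifferentialSeries

/-! ### Closed spans over 𝕜[[w]]. -/

section ClosedSpan

open PowerSeries Finset

variable {𝕜 : Type*} [Field 𝕜]

/-- The embedding of the scalars `𝕜[[w]]`. -/
def scalar : PowerSeries 𝕜 →+* Space 𝕜 := PowerSeries.map HahnSeries.C

theorem scalar_C (c : 𝕜) : scalar (C c) = cst c := map_C _ _

theorem scalar_X : scalar (X : PowerSeries 𝕜) = w 𝕜 := map_X _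

theorem coeff_scalar (b : PowerSeries 𝕜) (m : ℕ) : coeff m (scalar b) = HahnSeries.C (coeff m b) :=
  coeff_map _ _ _

/-- The `𝕜[[w]]`-linear combination of the `Φ k` with coefficients `c`. -/
def linComb (Φ : ℕ → Space 𝕜) : (ℕ →₀ PowerSeries 𝕜) →+ Space 𝕜 :=
  Finsupp.liftAddHom fun k => (AddMonoidHom.mulRight (Φ k)).comp scalar.toAddMonoidHom

theorem linComb_apply (Φ : ℕ → Space 𝕜) (c : ℕ →₀ PowerSeries 𝕜) :
    linComb Φ c = ∑ k ∈ c.support, scalar (c k) * Φ k := rfl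

theorem mem_closedSpan {Φ : ℕ → Space 𝕜} {f : Space 𝕜} :
    f ∈ closedSpan Φ ↔ ∀ N : ℕ, ∃ c, w 𝕜 ^ N ∣ f - linComb Φ c := Iff.rfl

/-- `closedSpan` as an additive group. -/
def closedSpanGroup (Φ : ℕ → Space 𝕜) : AddSubgroup (Space 𝕜) where
  carrier := closedSpan Φ
  zero_mem' N := ⟨0, by simp⟩
  add_mem' hf hg N := by
    obtain ⟨c, hc⟩ := mem_closedSpan.mp hf N
    obtain ⟨d, hd⟩ := mem_closedSpan.mp hg N
    refine ⟨c + d, ?_⟩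
    change _ ∣ _ - linComb Φ (c + d)
    rw [map_add, add_sub_add_comm]
    exact dvd_add hc hd
  neg_mem' {f} hf N := by
    obtain ⟨c, hc⟩ := mem_closedSpan.mp hf N
    refine ⟨-c, ?_⟩
    change _ ∣ _ - linComb Φ (-c)
    rw [map_neg, neg_sub_neg, ← neg_sub]
    exact (dvd_neg (a := w 𝕜 ^ N)).mpr hc

theorem mem_closedSpanGroup {Φ : ℕ → Space 𝕜} {f : Space 𝕜} :
    f ∈ closedSpanGroup Φ ↔ f ∈ closedSpan Φ := Iff.rfl

variable {Φ Φ' : ℕ → Space 𝕜}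

theorem mem_closedSpan_of_dvd {f : Space 𝕜}
    (h : ∀ N : ℕ, ∃ g ∈ closedSpanGroup Φ, w 𝕜 ^ N ∣ f - g) : f ∈ closedSpanGroup Φ := fun N => by
  obtain ⟨g, hg, h⟩ := h N
  obtain ⟨c, hc⟩ := mem_closedSpan.mp hg N
  refine ⟨c, ?_⟩
  change _ ∣ _ - linComb Φ c
  rw [← sub_add_sub_cancel f g]
  exact dvd_add h hc

theorem basis_mem_closedSpan (Φ : ℕ → Space 𝕜) (k : ℕ) : Φ k ∈ closedSpanGroup Φ := fun N => by
  refine ⟨Finsupp.single k 1, ?_⟩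
  rw [Finsupp.sum_single_index] <;> simp

theorem scalar_mul_mem_closedSpan (b : PowerSeries 𝕜) {f : Space 𝕜}
    (hf : f ∈ closedSpanGroup Φ) : scalar b * f ∈ closedSpanGroup Φ := fun N => by
  obtain ⟨c, hc⟩ := mem_closedSpan.mp hf N
  refine ⟨b • c, ?_⟩
  have h : linComb Φ (b • c) = scalar b * linComb Φ c := by
    change (b • c).sum (fun k a => scalar a * Φ k) = scalar b * c.sum fun k a => scalar a * Φ k
    rw [Finsupp.sum_smul_index (by simp), Finsupp.mul_sum]
    exact Finsupp.sum_congr fun k _ => by rw [map_mul, mul_assoc]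
  change _ ∣ _ - linComb Φ (b • c)
  rw [h, ← mul_sub]
  exact dvd_mul_of_dvd_right hc _

theorem cst_mul_mem_closedSpan (c : 𝕜) {f : Space 𝕜} (hf : f ∈ closedSpanGroup Φ) :
    cst c * f ∈ closedSpanGroup Φ := by
  rw [← scalar_C]; exact scalar_mul_mem_closedSpan _ hf

theorem w_pow_mul_mem_closedSpan (k : ℕ) {f : Space 𝕜} (hf : f ∈ closedSpanGroup Φ) :
    w 𝕜 ^ k * f ∈ closedSpanGroup Φ := by
  rw [← scalar_X, ← map_pow]; exact scalar_mul_mem_closedSpan _ hf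

theorem act_scalar_mul (a : OpSeries 𝕜) (b : PowerSeries 𝕜) (f : Space 𝕜) :
    act a (scalar b * f) = scalar b * act a f := by
  have h : Commute a (mulS (scalar b)) := commute_of_coeff fun i j => by
    rw [coeff_mulS, coeff_scalar, mulL_C]
    exact (Algebra.commutes _ _).symm
  have h1 := congrArg (fun x => act x f) h.eq
  simp only [act_mul_apply, act_mulS, mulOp_apply] at h1
  exact h1

theorem act_mem_closedSpan {a : OpSeries 𝕜} (h : ∀ k, act a (Φ k) ∈ closedSpanGroup Φ')
    {f : Space 𝕜} (hf : f ∈ closedSpanGroup Φ) : act a f ∈ closedSpanGroup Φ' :=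
  mem_closedSpan_of_dvd fun N => by
    obtain ⟨c, r, hc⟩ := mem_closedSpan.mp hf N
    refine ⟨act a (linComb Φ c), ?_, act a r, ?_⟩
    · rw [linComb_apply, map_sum]
      exact sum_mem fun k _ => by
        rw [act_scalar_mul]; exact scalar_mul_mem_closedSpan _ (h k)
    · rw [← map_sub, hc, act_w_pow_mul]

end ClosedSpan

/-! ### The decomposition W ⊕ H₋ and the wave function. -/

section BigCell

open PowerSeries Finset

variable {𝕜 : Type*} [Field 𝕜]

theorem coeff_C_mul_laurent (c : 𝕜) (f : LaurentSeries 𝕜) (i : ℤ) :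
    (HahnSeries.C c * f).coeff i = c * f.coeff i := by
  rw [HahnSeries.C_mul_eq_smul]; rfl

theorem coeff_zL_pow_self (k : ℕ) : (zL 𝕜 ^ k).coeff (-k) = 1 := by
  rw [zL_pow, HahnSeries.coeff_single_same]

theorem zDegLE_zL_pow (k : ℕ) : ZDegLE k (zL 𝕜 ^ k) := by
  rw [zL_pow]; simpa using zDegLE_single (-(k : ℤ)) (1 : 𝕜)

theorem ZDegLE.C_mul {L : ℤ} (c : 𝕜) {f : LaurentSeries 𝕜} (hf : ZDegLE L f) :
    ZDegLE L (HahnSeries.C c * f) := by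
  rw [HahnSeries.C_mul_eq_smul]; exact hf.smul c

section Triangular

variable {φ : ℕ → LaurentSeries 𝕜} (hφ : ∀ k : ℕ, ZDegLE (k - 1) (φ k - zL 𝕜 ^ k))

include hφ

theorem zDegLE_of_triangular (k : ℕ) : ZDegLE k (φ k) := by
  have := ((hφ k).mono (show (k : ℤ) - 1 ≤ k by omega)).add (zDegLE_zL_pow k)
  rwa [sub_add_cancel] at this

theorem coeff_of_triangular (k : ℕ) : (φ k).coeff (-k) = 1 := by
  have := hφ k (-k) (by omega)
  rwa [HahnSeries.coeff_sub, coeff_zL_pow_self, sub_eq_zero] at this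

theorem eq_zero_of_triangular_sum (s : Finset ℕ) (a : ℕ → 𝕜)
    (h : ZDegLE (-1) (∑ k ∈ s, HahnSeries.C (a k) * φ k)) : ∀ k ∈ s, a k = 0 := by
  induction s using Finset.induction_on_max with
  | empty => simp
  | insert m s hm ih =>
    have hms : m ∉ s := fun hs => (hm m hs).ne rfl
    rw [Finset.sum_insert hms] at h
    have h1 := h (-m) (by omega)
    have h2 : ZDegLE (m - 1) (∑ k ∈ s, HahnSeries.C (a k) * φ k) := ZDegLE.sum _ fun k hk =>
      ((zDegLE_of_triangular hφ k).C_mul _).mono (by have := hm k hk; omega)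
    rw [HahnSeries.coeff_add, h2 (-m) (by omega), coeff_C_mul_laurent, coeff_of_triangular hφ,
      mul_one, add_zero] at h1
    rw [h1, map_zero, zero_mul, zero_add] at h
    intro k hk
    rcases Finset.mem_insert.mp hk with rfl | hk
    · exact h1
    · exact ih h k hk

theorem zDegLE_sub_C_mul_of_triangular {d : ℕ} {x : LaurentSeries 𝕜} (hx : ZDegLE d x) :
    ZDegLE (d - 1) (x - HahnSeries.C (x.coeff (-d)) * φ d) := fun i hi => by
  rw [HahnSeries.coeff_sub, coeff_C_mul_laurent]
  by_cases h : i = -d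
  · rw [h, coeff_of_triangular hφ, mul_one, sub_self]
  · rw [hx i (by omega), zDegLE_of_triangular hφ d i (by omega), mul_zero, sub_zero]

end Triangular

theorem coeff_scalar_mul {b : PowerSeries 𝕜} {i : ℕ} (hb : ∀ j < i, coeff j b = 0)
    (g : Space 𝕜) : coeff i (scalar b * g) = HahnSeries.C (coeff i b) * coeff 0 g := by
  rw [coeff_mul, Finset.sum_eq_single (i, 0)]
  · rw [coeff_scalar]
  · intro p hp hne
    have h := Finset.HasAntidiagonal.mem_antidiagonal.mp hp
    have h1 : p.1 < i := by
      rcases Nat.lt_or_ge p.1 i with h1 | h1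
      · exact h1
      · exact absurd (Prod.ext (by change p.1 = i; omega) (by change p.2 = 0; omega)) hne
    rw [coeff_scalar, hb _ h1, map_zero, zero_mul]
  · intro h
    exact absurd (Finset.HasAntidiagonal.mem_antidiagonal.mpr (add_zero i)) h

variable {Φ : ℕ → Space 𝕜} (hΦ : ∀ k : ℕ, ZDegLE (k - 1) (coeff 0 (Φ k) - zL 𝕜 ^ k))

include hΦ

/-- A point of the big cell meets `H₋` in `0`. -/
theorem eq_zero_of_mem_closedSpan {f : Space 𝕜} (hf : f ∈ closedSpanGroup Φ)
    (hf' : SDegLE (-1) f) : f = 0 := by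
  have key : ∀ N : ℕ, ∀ i < N, coeff i f = 0 := by
    intro N
    obtain ⟨c, hc⟩ := mem_closedSpan.mp hf N
    have heq : ∀ i < N, coeff i f = ∑ k ∈ c.support, coeff i (scalar (c k) * Φ k) := by
      intro i hi
      have := X_pow_dvd_iff.mp hc i hi
      rwa [map_sub, sub_eq_zero, linComb_apply, map_sum] at this
    -- Once the lower orders vanish, the w^i part of the combination involves the basis only at w =
    -- 0, where triangularity applies.
    have hzero : ∀ i < N, ∀ k ∈ c.support, coeff i (c k) = 0 := by
      intro i
      induction i using Nat.strong_induction_on with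
      | _ i ih =>
        intro hi
        refine eq_zero_of_triangular_sum hΦ c.support (fun k => coeff i (c k)) ?_
        have h1 := hf' i
        rw [heq i hi, Finset.sum_congr rfl fun k hk =>
          coeff_scalar_mul (fun j hj => ih j hj (by omega) k hk) (Φ k)] at h1
        exact h1
    intro i hi
    rw [heq i hi]
    refine Finset.sum_eq_zero fun k hk => ?_
    rw [coeff_scalar_mul (fun j hj => hzero j (by omega) k hk), hzero i hi k hk, map_zero, zero_mul]
  ext1 m
  rw [key (m + 1) m (by omega), map_zero]

/-- Descent on the degree of x: a multiple of Φ d removes z^d. -/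
theorem exists_mem_closedSpan_coeff_zero (x : LaurentSeries 𝕜) :
    ∃ h ∈ closedSpanGroup Φ, ZDegLE (-1) (x - coeff 0 h) := by
  have key : ∀ (d : ℕ) (x : LaurentSeries 𝕜), ZDegLE (d - 1) x →
      ∃ h ∈ closedSpanGroup Φ, ZDegLE (-1) (x - coeff 0 h) := by
    intro d
    induction d with
    | zero => exact fun x hx => ⟨0, zero_mem _, by rw [map_zero, sub_zero]; exact hx.mono (by omega)⟩
    | succ d ih =>
      intro x hx
      obtain ⟨h, hh, hxh⟩ := ih _ (zDegLE_sub_C_mul_of_triangular hΦ (d := d)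
        (hx.mono (by push_cast; omega)))
      refine ⟨cst (x.coeff (-d)) * Φ d + h, add_mem (cst_mul_mem_closedSpan _
        (basis_mem_closedSpan Φ d)) hh, ?_⟩
      rwa [map_add, coeff_cst_mul, ← sub_sub]
  obtain ⟨L, hL⟩ := exists_zDegLE x
  exact key (L.natAbs + 1) x (hL.mono (by omega))

/-- A point of the big cell is complementary to `H₋`. -/
theorem exists_mem_closedSpan_sub (f : Space 𝕜) :
    ∃ g ∈ closedSpanGroup Φ, SDegLE (-1) (f - g) := by
  choose H hH hHdeg using exists_mem_closedSpan_coeff_zero hΦ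
  -- Order by order in w: the m-th correction brings the coefficient of w^m in f - s into H₋ and
  -- leaves the lower ones unchanged.
  let s : ℕ → Space 𝕜 := fun m => Nat.rec 0 (fun m g => g + w 𝕜 ^ m * H (coeff m (f - g))) m
  have hs : ∀ m, s (m + 1) = s m + w 𝕜 ^ m * H (coeff m (f - s m)) := fun m => rfl
  have hmem : ∀ m, s m ∈ closedSpanGroup Φ := by
    intro m
    induction m with
    | zero => exact zero_mem _
    | succ m ih => rw [hs]; exact add_mem ih (w_pow_mul_mem_closedSpan _ (hH _))
  have hlt : ∀ m, ∀ i < m, coeff i (s (m + 1)) = coeff i (s m) := fun m i hi => by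
    rw [hs, map_add, w, coeff_X_pow_mul', if_neg (by omega), add_zero]
  have hstab : ∀ i N, i + 1 ≤ N → coeff i (s N) = coeff i (s (i + 1)) := by
    intro i N hN
    induction N, hN using Nat.le_induction with
    | base => rfl
    | succ N hN ih => rw [hlt N i (by omega), ih]
  refine ⟨PowerSeries.mk fun i => coeff i (s (i + 1)), mem_closedSpan_of_dvd fun N =>
    ⟨s N, hmem N, X_pow_dvd_iff.mpr fun i hi => ?_⟩, fun m => ?_⟩
  · rw [map_sub, coeff_mk, hstab i N (by omega), sub_self]
  · have h := hHdeg (coeff m (f - s m))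
    rw [map_sub, coeff_mk, hs, map_add, w, coeff_X_pow_mul', if_pos le_rfl, Nat.sub_self,
      ← sub_sub, ← map_sub]
    exact h

theorem existsUnique_waveFunction : ∃! Ψ : Space 𝕜, IsWaveFunction (closedSpan Φ) Ψ := by
  obtain ⟨g, hg, hdeg⟩ := exists_mem_closedSpan_sub hΦ 1
  refine ⟨g, ⟨hg, mem_HMinus_iff.mpr ?_⟩, fun g' hg' => ?_⟩
  · rw [← neg_sub]; exact hdeg.neg
  · rw [← sub_eq_zero]
    refine eq_zero_of_mem_closedSpan hΦ (sub_mem hg'.1 hg) ?_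
    rw [← sub_add_sub_cancel g' 1 g]
    exact (mem_HMinus_iff.mp hg'.2).add hdeg

omit hΦ

theorem coeff_z_pow (k : ℕ) : z 𝕜 ^ k = C (zL 𝕜 ^ k) := by rw [z, map_pow]

theorem zDegLE_coeff_z_pow (k : ℕ) : ZDegLE (k - 1) (coeff 0 (z 𝕜 ^ k) - zL 𝕜 ^ k) := by
  rw [coeff_z_pow, coeff_zero_C, sub_self]; exact ZDegLE.zero _

variable (𝕜) in
/-- `H₊` as an additive group. -/
def hPlusGroup : AddSubgroup (Space 𝕜) where
  carrier := HPlus 𝕜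
  zero_mem' m i _ := by rw [map_zero]; rfl
  add_mem' hf hg m i hi := by rw [map_add, HahnSeries.coeff_add, hf m i hi, hg m i hi, add_zero]
  neg_mem' hf m i hi := by rw [map_neg, HahnSeries.coeff_neg, hf m i hi, neg_zero]

theorem mem_HPlus_iff {f : Space 𝕜} : f ∈ HPlus 𝕜 ↔ f ∈ closedSpanGroup fun k => z 𝕜 ^ k := by
  have hle : ∀ f ∈ closedSpanGroup fun k => z 𝕜 ^ k, f ∈ hPlusGroup 𝕜 := by
    intro f hf m i hi
    obtain ⟨c, hc⟩ := mem_closedSpan.mp hf (m + 1)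
    have h1 := X_pow_dvd_iff.mp hc m (by omega)
    rw [map_sub, sub_eq_zero] at h1
    rw [h1, linComb_apply, map_sum, HahnSeries.coeff_sum]
    refine Finset.sum_eq_zero fun k _ => ?_
    rw [coeff_z_pow, coeff_mul_C, coeff_scalar, coeff_C_mul_laurent, zL_pow,
      HahnSeries.coeff_single_of_ne (by omega), mul_zero]
  refine ⟨fun hf => ?_, hle f⟩
  obtain ⟨g, hg, hdeg⟩ := exists_mem_closedSpan_sub zDegLE_coeff_z_pow f
  have h1 : f - g ∈ hPlusGroup 𝕜 := sub_mem hf (hle g hg)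
  have h2 : f - g = 0 := by
    ext m i
    by_cases hi : 0 < i
    · rw [h1 m i hi]; simp
    · rw [hdeg m i (by omega)]; simp
  rw [sub_eq_zero.mp h2]
  exact hg

theorem z_pow_mem_HPlus (k : ℕ) : z 𝕜 ^ k ∈ HPlus 𝕜 :=
  mem_HPlus_iff.mpr (basis_mem_closedSpan (fun k => z 𝕜 ^ k) k)

end BigCell

/-! ### The Sato group element and the canonical Kac–Schwarz operator. -/

section SatoGroup

open PowerSeries Finset

variable {𝕜 : Type*} [Field 𝕜]

theorem formalHasSum_of_forall_ge {u : ℕ → Space 𝕜} (K : ℕ) (hu : ∀ k ≥ K, u k = 0) :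
    FormalHasSum u (∑ k ∈ range K, u k) := fun m i => by
  filter_upwards [Filter.eventually_ge_atTop K] with N hN
  rw [← Finset.sum_subset (Finset.range_mono hN) fun k _ hk =>
    hu k (by simpa using hk)]

theorem dz_pow_z_pow (j k : ℕ) :
    (dz 𝕜 ^ k) (z 𝕜 ^ j) = cst (j.descFactorial k : 𝕜) * z 𝕜 ^ (j - k) := by
  induction k with
  | zero => rw [Nat.descFactorial_zero, Nat.cast_one, cst_one, one_mul]; rfl
  | succ k ih =>
    rw [pow_succ']
    change dz 𝕜 ((dz 𝕜 ^ k) (z 𝕜 ^ j)) = _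
    rw [ih, dz_cst_mul, dz_pow, dz_z, mul_one, Nat.descFactorial_succ, Nat.cast_mul, cst_mul,
      cst_natCast (j - k), Nat.sub_sub]
    ring

/-- The coefficients of the operator `1 + ∑ k, a k (∂/∂z) ^ k` that sends every `z ^ j` to
the kernel of the projection `π`. -/
def satoCoeff (π : Space 𝕜 → Space 𝕜) (j : ℕ) : Space 𝕜 :=
  -(cst (j.factorial : 𝕜)⁻¹ * π (z 𝕜 ^ j + ∑ k : Fin j,
    satoCoeff π k * (cst (j.descFactorial k : 𝕜) * z 𝕜 ^ (j - k))))
termination_by j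
decreasing_by exact k.2

/-- On z^j only the terms k ≤ j act, and k = j contributes j! a_j. So a_j can be chosen in H₋ to
remove the H₋ component of all the rest. -/
theorem exists_sato_operator [CharZero 𝕜] {W : AddSubgroup (Space 𝕜)}
    (hW : ∀ f, ∃ g ∈ W, SDegLE (-1) (f - g)) :
    ∃ a : ℕ → Space 𝕜, (∀ k, a k ∈ HMinus 𝕜) ∧ ∃ D ∈ filS (-1),
      (∀ f, StrongHasSum (fun k => (mulOp (a k) * dz 𝕜 ^ k) f) (act D f)) ∧
      ∀ j, act (1 + D) (z 𝕜 ^ j) ∈ W := by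
  choose g hg hdeg using hW
  set a := satoCoeff fun f => f - g f with ha_def
  have hS : ∀ j, cst (j.factorial : 𝕜) * a j =
      -((z 𝕜 ^ j + ∑ k ∈ range j, a k * (cst (j.descFactorial k : 𝕜) * z 𝕜 ^ (j - k))) -
      g (z 𝕜 ^ j + ∑ k ∈ range j, a k * (cst (j.descFactorial k : 𝕜) * z 𝕜 ^ (j - k)))) := by
    intro j
    rw [ha_def, satoCoeff, mul_neg, ← mul_assoc,
      cst_mul_cst_inv (Nat.cast_ne_zero.mpr j.factorial_ne_zero), one_mul, Finset.sum_range]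
  have ha : ∀ j, a j ∈ HMinus 𝕜 := by
    intro j
    rw [mem_HMinus_iff, ha_def, satoCoeff]
    exact (((sDegLE_cst _).mul (hdeg _)).mono (by omega)).neg
  obtain ⟨D, hD, hsum⟩ := exists_differentialSeries a ha
  refine ⟨a, ha, D, hD, hsum, fun j => ?_⟩
  have hterm : ∀ k, (mulOp (a k) * dz 𝕜 ^ k) (z 𝕜 ^ j) =
      a k * (cst (j.descFactorial k : 𝕜) * z 𝕜 ^ (j - k)) := fun k => by
    rw [← dz_pow_z_pow]; rfl
  have hact : act D (z 𝕜 ^ j) = ∑ k ∈ range (j + 1),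
      a k * (cst (j.descFactorial k : 𝕜) * z 𝕜 ^ (j - k)) := by
    have h1 := (hsum (z 𝕜 ^ j)).formalHasSum
    simp only [hterm] at h1
    refine h1.unique (formalHasSum_of_forall_ge _ fun k hk => ?_)
    rw [Nat.descFactorial_of_lt hk, Nat.cast_zero, cst, map_zero, map_zero, zero_mul, mul_zero]
  have h2 : act (1 + D) (z 𝕜 ^ j) =
      g (z 𝕜 ^ j + ∑ k ∈ range j, a k * (cst (j.descFactorial k : 𝕜) * z 𝕜 ^ (j - k))) := by
    rw [map_add, map_one]
    change z 𝕜 ^ j + act D (z 𝕜 ^ j) = _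
    rw [hact, Finset.sum_range_succ, Nat.descFactorial_self, Nat.sub_self, pow_zero, mul_one,
      mul_comm (a j), hS]
    ring
  rw [h2]
  exact hg _

/-- Induction on j: if D kills the lower powers, then D z^j has degree at most -1 and lies in W,
hence is zero. Both uniqueness of G and the identification of P rest on this. -/
theorem eq_zero_of_act_z_pow {D : OpSeries 𝕜} (hD : D ∈ filS (-1)) {W : AddSubgroup (Space 𝕜)}
    (hW : ∀ f ∈ W, SDegLE (-1) f → f = 0) (h : ∀ j, act D (z 𝕜 ^ j) ∈ W) : D = 0 := by
  have hco : ∀ j m, coeff m (act D (z 𝕜 ^ j)) = coeff m D (zL 𝕜 ^ j) := fun j m => by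
    rw [coeff_z_pow, coeff_act_C]
  have hz : ∀ j : ℕ, ∀ m, coeff m D (zL 𝕜 ^ j) = 0 := by
    intro j
    induction j using Nat.strong_induction_on with
    | _ j ih =>
      have h1 : act D (z 𝕜 ^ j) = 0 := hW _ (h j) fun m => by
        rw [hco]
        exact zDegLE_of_apply_pow_eq_zero (hD m) fun i hi => ih i hi m
      intro m
      rw [← hco, h1, map_zero]
  ext1 m
  rw [map_zero]
  exact eq_zero_of_apply_pow_eq_zero (hD m) fun j => hz j m

/-- `1 + D` as an invertible operator. -/
def unitOfFilS {D : OpSeries 𝕜} (hD : D ∈ filS (-1)) : (Op 𝕜)ˣ where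
  val := act (1 + D)
  inv := (AddEquiv.ofBijective (act (1 + D)) (bijective_act_one_add hD)).symm.toAddMonoidHom
  val_inv := AddMonoidHom.ext fun f =>
    (AddEquiv.ofBijective (act (1 + D)) (bijective_act_one_add hD)).apply_symm_apply f
  inv_val := AddMonoidHom.ext fun f =>
    (AddEquiv.ofBijective (act (1 + D)) (bijective_act_one_add hD)).symm_apply_apply f

/-- Every point of the big cell has exactly one Sato group element. -/
theorem exists_isSatoGroupElement [CharZero 𝕜] {Φ : ℕ → Space 𝕜}
    (hΦ : ∀ k : ℕ, ZDegLE (k - 1) (coeff 0 (Φ k) - zL 𝕜 ^ k)) :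
    ∃ (D : OpSeries 𝕜) (hD : D ∈ filS (-1)),
      (∀ f ∈ HPlus 𝕜, act (1 + D) f ∈ closedSpanGroup Φ) ∧
      ∀ G' : (Op 𝕜)ˣ, IsSatoGroupElement (closedSpan Φ) G' ↔ G' = unitOfFilS hD := by
  obtain ⟨a, ha, D, hD, hsum, hmem⟩ :=
    exists_sato_operator (W := closedSpanGroup Φ) (exists_mem_closedSpan_sub hΦ)
  have himg : ∀ f ∈ HPlus 𝕜, act (1 + D) f ∈ closedSpanGroup Φ := fun f hf =>
    act_mem_closedSpan hmem (mem_HPlus_iff.mp hf)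
  refine ⟨D, hD, himg, fun G' => ⟨fun hG => ?_, ?_⟩⟩
  · obtain ⟨⟨a', ha', hsum'⟩, himg'⟩ := hG
    obtain ⟨D', hD', hstrong⟩ := exists_differentialSeries a' ha'
    have h1 : ∀ f, (G' : Op 𝕜) f = act (1 + D') f := fun f => by
      have h2 : (G' - 1 : Op 𝕜) f = act D' f := (hsum' f).unique (hstrong f).formalHasSum
      rw [map_add, map_one]
      change (G' : Op 𝕜) f = f + act D' f
      rw [← h2]
      exact (add_sub_cancel f ((G' : Op 𝕜) f)).symm
    have h3 : D' - D = 0 := eq_zero_of_act_z_pow (sub_mem hD' hD)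
      (fun f => eq_zero_of_mem_closedSpan hΦ) fun j => by
        have h4 : act (1 + D') (z 𝕜 ^ j) ∈ closedSpanGroup Φ := by
          rw [← h1, mem_closedSpanGroup, ← himg']
          exact ⟨_, z_pow_mem_HPlus j, rfl⟩
        have h5 := sub_mem h4 (hmem j)
        have h6 : act (D' - D) = act (1 + D') - act (1 + D) := by
          rw [← map_sub, add_sub_add_left_eq_sub]
        rw [h6]
        exact h5
    refine Units.ext (AddMonoidHom.ext fun f => ?_)
    refine (h1 f).trans ?_
    rw [sub_eq_zero.mp h3]
    rfl
  · rintro rfl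
    refine ⟨⟨a, ha, fun f => ?_⟩, Set.Subset.antisymm ?_ ?_⟩
    · have h1 : ((unitOfFilS hD : Op 𝕜) - 1) f = act D f := by
        change (act (1 + D)) f - f = _
        rw [map_add, map_one]
        exact add_sub_cancel_left f (act D f)
      rw [h1]
      exact (hsum f).formalHasSum
    · rintro _ ⟨f, hf, rfl⟩
      exact himg f hf
    · intro g hg
      obtain ⟨f, rfl⟩ := (bijective_act_one_add hD).2 g
      -- Split the preimage into its H₊ and H₋ parts. As 1 + D preserves H₋, the image of the second
      -- part lies in W ∩ H₋ = 0.
      obtain ⟨p, hp, hfp⟩ := exists_mem_closedSpan_sub (zDegLE_coeff_z_pow (𝕜 := 𝕜)) f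
      have hp' := mem_HPlus_iff.mpr hp
      have h1 : act (1 + D) (f - p) = 0 := by
        refine eq_zero_of_mem_closedSpan hΦ ?_ ?_
        · rw [map_sub]; exact sub_mem hg (himg p hp')
        · intro m
          rw [coeff_act]
          exact ZDegLE.sum _ fun q _ => (fil_le_degLE 0
            (add_mem one_mem_filS (filS_mono (by omega) hD) q.1) _ _ (hfp q.2)).mono (by omega)
      have h2 : f - p = 0 := (bijective_act_one_add hD).1 (h1.trans (map_zero _).symm)
      rw [sub_eq_zero.mp h2]
      exact ⟨p, hp', rfl⟩

theorem sub_add_mul_sub_eq {T : Type*} [Ring T] (P D d : T) :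
    P * (1 + D) - (1 + D) * d = (P - d) + P * D - D * d := by
  rw [mul_add, add_mul, mul_one, one_mul]; abel

/-- An operator of the form `∂/∂z + O(z⁻¹)` stabilizing `W` is the canonical Kac–Schwarz operator
of `W`. -/
theorem canonicalP_eq_act {Φ : ℕ → Space 𝕜}
    (hΦ : ∀ k : ℕ, ZDegLE (k - 1) (coeff 0 (Φ k) - zL 𝕜 ^ k)) {D P : OpSeries 𝕜}
    (hD : D ∈ filS (-1)) (hG : ∀ f ∈ HPlus 𝕜, act (1 + D) f ∈ closedSpanGroup Φ)
    (hP : P - dS 𝕜 ∈ filS (-1)) (hW : ∀ k, act P (Φ k) ∈ closedSpanGroup Φ) :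
    canonicalP (unitOfFilS hD) = act P := by
  have hP0 : P ∈ filS 0 := by
    have := add_mem (filS_mono (by omega : (-1 : ℤ) ≤ 0) hP) dS_mem_filS
    rwa [sub_add_cancel] at this
  -- P G - G ∂ lies in 𝒟₋ because the leading ∂ cancels, and it maps H₊ into W because P preserves W
  -- and ∂ preserves H₊.
  have h0 : P * (1 + D) - (1 + D) * dS 𝕜 = 0 := by
    refine eq_zero_of_act_z_pow (W := closedSpanGroup Φ) ?_
      (fun f => eq_zero_of_mem_closedSpan hΦ) fun j => ?_
    · rw [sub_add_mul_sub_eq]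
      exact sub_mem (add_mem hP (mul_mem_filS (by omega) hP0 hD))
        (mul_mem_filS (by omega) hD dS_mem_filS)
    · rw [map_sub]
      change act (P * (1 + D)) (z 𝕜 ^ j) - act ((1 + D) * dS 𝕜) (z 𝕜 ^ j) ∈ _
      rw [act_mul_apply, act_mul_apply, act_dS]
      refine sub_mem (act_mem_closedSpan hW (hG _ (z_pow_mem_HPlus j))) (hG _ ?_)
      have h1 := dz_pow_z_pow (𝕜 := 𝕜) j 1
      rw [pow_one] at h1
      rw [h1]
      exact mem_HPlus_iff.mpr (cst_mul_mem_closedSpan _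
        (basis_mem_closedSpan (fun k => z 𝕜 ^ k) (j - 1)))
  have h1 : act P * (unitOfFilS hD : Op 𝕜) = (unitOfFilS hD : Op 𝕜) * dz 𝕜 := by
    change act P * act (1 + D) = act (1 + D) * dz 𝕜
    rw [← map_mul, sub_eq_zero.mp h0, map_mul, act_dS]
  rw [canonicalP, ← h1, mul_assoc, Units.mul_inv, mul_one]

/-- The wave function is annihilated by the canonical Kac–Schwarz operator. -/
theorem canonicalP_waveFunction {Φ : ℕ → Space 𝕜}
    (hΦ : ∀ k : ℕ, ZDegLE (k - 1) (coeff 0 (Φ k) - zL 𝕜 ^ k)) {D : OpSeries 𝕜}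
    (hD : D ∈ filS (-1)) (hG : ∀ f ∈ HPlus 𝕜, act (1 + D) f ∈ closedSpanGroup Φ)
    {Ψ : Space 𝕜} (hΨ : IsWaveFunction (closedSpan Φ) Ψ) :
    canonicalP (unitOfFilS hD) Ψ = 0 := by
  -- G·1 has both properties of the wave function; then P Ψ = G ∂ 1 = 0.
  have h1 : act (1 + D) 1 = Ψ := by
    refine (existsUnique_waveFunction hΦ).unique ⟨?_, mem_HMinus_iff.mpr fun m => ?_⟩ hΨ
    · have := z_pow_mem_HPlus (𝕜 := 𝕜) 0
      rw [pow_zero] at this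
      exact hG _ this
    · have h2 : act (1 + D) 1 - 1 = act D (1 : Space 𝕜) := by
        rw [RingHom.map_add act, RingHom.map_one act]
        exact add_sub_cancel_left (1 : Space 𝕜) (act D 1)
      rw [h2, ← map_one C, coeff_act_C]
      exact (fil_le_degLE _ (hD m) 1 0 (zDegLE_single (0 : ℤ) (1 : 𝕜))).mono (by omega)
  have h3 : canonicalP (unitOfFilS hD) ((unitOfFilS hD : Op 𝕜) 1) =
      (unitOfFilS hD : Op 𝕜) (dz 𝕜 1) :=
    congrArg (fun x => (unitOfFilS hD : Op 𝕜) (dz 𝕜 x))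
      (congrArg (fun a : Op 𝕜 => a 1) (unitOfFilS hD).inv_mul)
  rw [dz_one, map_zero] at h3
  rw [← h1]
  exact h3

end SatoGroup

section Apply

variable {𝕜 : Type*} [Field 𝕜]

theorem act_sub_apply (a b : OpSeries 𝕜) (f : Space 𝕜) : act (a - b) f = act a f - act b f := by
  rw [map_sub]; rfl

theorem act_neg_apply (a : OpSeries 𝕜) (f : Space 𝕜) : act (-a) f = -act a f := by
  rw [map_neg]; rfl

theorem act_sum_apply {ι : Type*} (s : Finset ι) (a : ι → OpSeries 𝕜) (f : Space 𝕜) :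
    act (∑ i ∈ s, a i) f = ∑ i ∈ s, act (a i) f := by
  rw [map_sum]; exact AddMonoidHom.finsetSum_apply _ _ _

end Apply

/-! ### P maps W into itself. -/

section Stability

open PowerSeries Finset

variable {𝕜 : Type*} [Field 𝕜] [CharZero 𝕜] (n : ℕ) {ħ : 𝕜} (hħ : ħ ≠ 0)

include hħ

theorem act_qS_pow_gkmBasis (j k : ℕ) :
    act (qS n ħ ^ j) (gkmBasis n ħ k) = gkmBasis n ħ (k + j) := by
  induction j with
  | zero => rw [pow_zero, map_one]; rfl
  | succ j ih => rw [pow_succ', act_mul_apply, ih, act_qS n hħ, Qtilde_gkmBasis n hħ, add_assoc]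

theorem act_aeval_qS_mem (p : Polynomial 𝕜) (k : ℕ) :
    act (Polynomial.aeval (qS n ħ) p) (gkmBasis n ħ k) ∈ closedSpanGroup (gkmBasis n ħ) := by
  induction p using Polynomial.induction_on' with
  | add p q hp hq =>
    rw [map_add, RingHom.map_add act]
    exact add_mem hp hq
  | monomial j c =>
    rw [Polynomial.aeval_monomial, ← mulS_cst, act_mul_apply, act_mulS, mulOp_apply,
      act_qS_pow_gkmBasis n hħ]
    exact cst_mul_mem_closedSpan _ (basis_mem_closedSpan _ _)

theorem act_evalSeries_qS_mem (R : PowerSeries (Polynomial 𝕜)) (k : ℕ) :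
    act (evalSeries 𝕜 (qS n ħ) R) (gkmBasis n ħ k) ∈ closedSpanGroup (gkmBasis n ħ) := by
  refine mem_closedSpan_of_dvd fun N => ?_
  obtain ⟨g, hg⟩ := X_pow_dvd_evalOne_sub (extendTerms_mem (Polynomial.aeval (qS n ħ)) R) N
  refine ⟨∑ l ∈ range N, act (X ^ l * Polynomial.aeval (qS n ħ) (coeff l R)) (gkmBasis n ħ k),
    sum_mem fun l _ => ?_, act g (gkmBasis n ħ k), ?_⟩
  · rw [act_mul_apply, act_X_pow]
    exact w_pow_mul_mem_closedSpan _ (act_aeval_qS_mem n hħ _ _)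
  · rw [← act_X_pow, ← act_mul_apply, ← hg, act_sub_apply, act_sum_apply]
    simp only [coeff_extendTerms]
    rfl

theorem potV'_mul_gkmBasis_mem (k : ℕ) :
    potV' 𝕜 n * gkmBasis n ħ k ∈ closedSpanGroup (gkmBasis n ħ) := by
  refine mem_closedSpan_of_dvd fun N => ?_
  obtain ⟨f, hf⟩ := potV'_mul_gkmBasis n hħ k N
  refine ⟨_, ?_, f, by rw [hf]; exact add_sub_cancel_left _ _⟩
  refine sub_mem (sum_mem fun m _ => ?_) ?_
  · rw [mul_assoc]
    exact w_pow_mul_mem_closedSpan _ (cst_mul_mem_closedSpan _ (basis_mem_closedSpan _ _))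
  · rw [← cst_natCast]
    exact cst_mul_mem_closedSpan _ (cst_mul_mem_closedSpan _ (basis_mem_closedSpan _ _))

omit [CharZero 𝕜] in
omit hħ in
theorem act_kacS_apply (R : PowerSeries (Polynomial 𝕜)) (f : Space 𝕜) : act (kacS n ħ R) f =
    cst ħ⁻¹ * (act (evalSeries 𝕜 (qS n ħ) R) f - potV' 𝕜 n * f) := by
  rw [kacS, act_smul, act_sub_apply, act_mulS]
  rfl

theorem act_kacS_mem (R : PowerSeries (Polynomial 𝕜)) (k : ℕ) :
    act (kacS n ħ R) (gkmBasis n ħ k) ∈ closedSpanGroup (gkmBasis n ħ) := by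
  rw [act_kacS_apply]
  exact cst_mul_mem_closedSpan _
    (sub_mem (act_evalSeries_qS_mem n hħ R k) (potV'_mul_gkmBasis_mem n hħ k))

end Stability

/-! ### Fixed vectors of exponentials. -/

section Exponential

open PowerSeries Finset

variable {𝕜 : Type*} [Field 𝕜]

theorem pow_pred_mul {T : Type*} [Ring T] (N : T) {i : ℕ} (hi : 2 ≤ i) :
    N ^ i = N * N ^ (i - 2) * N := by
  rw [← pow_succ', ← pow_succ]; congr 1; omega

theorem coeff_act_eq_zero {a : OpSeries 𝕜} {m : ℕ} (ha : X ^ (m + 1) ∣ a) (f : Space 𝕜) :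
    coeff m (act a f) = 0 := by
  obtain ⟨b, rfl⟩ := ha
  rw [act_mul_apply, act_X_pow, w, coeff_X_pow_mul', if_neg (by omega)]

/-- The exponential series, applied to a vector. -/
theorem formalHasSum_pexp {A : OpSeries 𝕜} (hA : X ∣ A) (g : Space 𝕜) :
    FormalHasSum (fun i => cst (i.factorial : 𝕜)⁻¹ * act (A ^ i) g) (act (pexp 𝕜 A) g) := by
  intro m i
  filter_upwards [Filter.eventually_ge_atTop (m + 1)] with N hN
  have h1 : X ^ (m + 1) ∣ pexp 𝕜 A - ∑ i ∈ range N, (i.factorial : 𝕜)⁻¹ • A ^ i :=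
    X_pow_dvd_iff.mpr fun l hl => by
      rw [map_sub, map_sum, coeff_pexp hA (show l ≤ N - 1 by omega), Nat.sub_add_cancel (by omega)]
      simp only [coeff_smul, sub_self]
  have h2 := coeff_act_eq_zero h1 g
  have h3 : act (pexp 𝕜 A - ∑ i ∈ range N, (i.factorial : 𝕜)⁻¹ • A ^ i) g =
      act (pexp 𝕜 A) g - ∑ i ∈ range N, cst (i.factorial : 𝕜)⁻¹ * act (A ^ i) g := by
    rw [act_sub_apply, act_sum_apply]
    simp only [act_smul]
  rw [h3, map_sub, sub_eq_zero] at h2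
  rw [h2]

/-- If w^k divides N f, then w^(k+1) divides N^i f for i ≥ 2, so e^N f - f = 0 reduces to N f modulo
w^(k+1). -/
theorem w_pow_dvd_of_act_pexp_eq {N : OpSeries 𝕜} (hN : X ∣ N) {f : Space 𝕜}
    (hf : act (pexp 𝕜 N) f = f) (k : ℕ) : w 𝕜 ^ k ∣ act N f := by
  induction k with
  | zero => exact one_dvd _
  | succ k ih =>
    obtain ⟨h, hh⟩ := ih
    obtain ⟨N', hN'⟩ := hN
    have h1 : ∀ i, 2 ≤ i → ∀ m < k + 1, coeff m (act (N ^ i) f) = 0 := by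
      intro i hi m hm
      rw [pow_pred_mul N hi, act_mul_apply, hh, act_w_pow_mul, act_mul_apply, hN', act_mul_apply,
        act_X, ← mul_assoc, ← pow_succ, w, coeff_X_pow_mul', if_neg (by omega)]
    refine X_pow_dvd_iff.mpr fun m hm => ?_
    have h2 := formalHasSum_pexp (𝕜 := 𝕜) (A := N) ⟨N', hN'⟩ f
    rw [hf] at h2
    ext i
    obtain ⟨K, h3, hK⟩ := ((h2 m i).and (Filter.eventually_ge_atTop 2)).exists
    obtain ⟨K, rfl⟩ := Nat.exists_eq_add_of_le hK
    rw [add_comm, Finset.sum_range_succ', Finset.sum_range_succ', map_add, map_add, map_sum,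
      Finset.sum_eq_zero fun i _ => by
        rw [coeff_cst_mul, h1 _ (by omega) m hm, mul_zero]] at h3
    simpa [cst_one] using h3

theorem act_pexp_eq_iff {N : OpSeries 𝕜} (hN : X ∣ N) (f : Space 𝕜) :
    act (pexp 𝕜 N) f = f ↔ act N f = 0 := by
  constructor
  · intro h
    ext1 m
    rw [X_pow_dvd_iff.mp (w_pow_dvd_of_act_pexp_eq hN h (m + 1)) m (by omega), map_zero]
  · intro h
    have h1 := formalHasSum_pexp hN f
    refine h1.unique ?_
    have h2 := formalHasSum_of_forall_ge (u := fun i => cst (i.factorial : 𝕜)⁻¹ * act (N ^ i) f) 1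
      fun i hi => by
        obtain ⟨i, rfl⟩ := Nat.exists_eq_add_of_le hi
        rw [add_comm, pow_succ, act_mul_apply, h, map_zero, mul_zero]
    rw [Finset.sum_range_one, pow_zero, map_one, Nat.factorial_zero, Nat.cast_one, inv_one,
      cst_one, one_mul] at h2
    exact h2

end Exponential

/-! ### The modified quantum curve. -/

section Curve

open PowerSeries Finset

variable {𝕜 : Type*} [Field 𝕜] (n : ℕ) (ħ : 𝕜)

/-- `modConj` as a ring homomorphism. -/
def modConjHom : Op 𝕜 →+* AddMonoid.End (ModSpace n ħ) where
  toFun := modConj n ħ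
  map_one' := rfl
  map_mul' _ _ := rfl
  map_zero' := rfl
  map_add' _ _ := rfl

theorem modMul_eq (g : Space 𝕜) : modMul n ħ g = modConjHom n ħ (act (mulS g)) := by
  rw [act_mulS]; rfl

variable [CharZero 𝕜]

theorem dz_potV : dz 𝕜 (potV 𝕜 n) = potV' 𝕜 n := by
  ext1 m
  have h : ((m + n + 2 : ℕ) : 𝕜) ≠ 0 := Nat.cast_ne_zero.mpr (by omega)
  rw [coeff_dz', potV, coeff_mk, potV', coeff_mk, dL_C_mul_zL_pow, mul_inv, mul_assoc,
    inv_mul_cancel₀ h, mul_one]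

variable {ħ} (hħ : ħ ≠ 0)

include hħ

theorem cst_mul_dz_potV'_inv : cst ħ * (dz 𝕜 (potV' 𝕜 n))⁻¹ = uInv n ħ := by
  have h := cst_mul_cst_inv hħ
  rw [dz_potV' n hħ, PowerSeries.mul_inv_rev, potU_inv n hħ]
  have h1 : (cst ħ)⁻¹ = cst ħ⁻¹ := by
    have h0 : constantCoeff (cst ħ) ≠ 0 := by simpa [cst] using hħ
    have := PowerSeries.mul_inv_cancel (cst ħ) h0
    linear_combination cst ħ⁻¹ * this - (cst ħ)⁻¹ * h
  rw [h1]
  linear_combination uInv n ħ * h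

/-- S₀' = z V'' = ħ z U and S₁' = -U'/(2U). This is what makes ŷ conjugate to Q̃. -/
theorem uInv_mul_dzExponent :
    uInv n ħ * dzExponent n ħ = z 𝕜 + cst (2 : 𝕜)⁻¹ * dz 𝕜 (uInv n ħ) := by
  have h1 := cst_mul_dz_potV'_inv n hħ
  have h2 := cst_mul_cst_inv hħ
  have h3 := potU_mul_uInv n hħ
  rw [dzExponent, map_sub, dz_potV, dz_mul, dz_z, one_mul, add_sub_cancel_left, dz_uInv n hħ]
  have h4 : dz 𝕜 (dz 𝕜 (potV' 𝕜 n)) = cst ħ * dz 𝕜 (potU n ħ) := by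
    rw [dz_potV' n hħ, dz_cst_mul]
  rw [h4]
  generalize (dz 𝕜 (potV' 𝕜 n))⁻¹ = v at *
  rw [dz_potV' n hħ]
  linear_combination (uInv n ħ * z 𝕜 * potU n ħ) * h2 + z 𝕜 * h3 -
    uInv n ħ * cst 2⁻¹ * dz 𝕜 (potU n ħ) * h1

theorem yHat_eq : yHat n ħ = modConjHom n ħ (act (qS n ħ)) := by
  have h : mulOp (cst ħ * (dz 𝕜 (potV' 𝕜 n))⁻¹) * (dz 𝕜 + mulOp (dzExponent n ħ)) =
      act (qS n ħ) := by
    refine AddMonoidHom.ext fun f => ?_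
    rw [cst_mul_dz_potV'_inv n hħ, act_qS n hħ]
    change uInv n ħ * (dz 𝕜 f + dzExponent n ħ * f) = Qtilde n ħ f
    rw [Qtilde_apply n hħ]
    linear_combination f * uInv_mul_dzExponent n hħ
  rw [← h]
  rfl

theorem curveExponent_eq : curveExponent n ħ = modConjHom n ħ (act (curveS n ħ)) := by
  have h : ∀ k : ℕ, (k : 𝕜)⁻¹ • (X * qS n ħ) ^ k =
      mulS (cst (k : 𝕜)⁻¹ * w 𝕜 ^ k) * qS n ħ ^ k := fun k => by
    rw [(commute_X (qS n ħ)).symm.mul_pow, map_mul mulS (cst _), mulS_cst, map_pow, mulS_w, Algebra.smul_def,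
      mul_assoc]
  rw [curveExponent, xHat, modMul_eq, modMul_eq, yHat_eq n hħ, curveS, RingHom.map_add,
    RingHom.map_add, map_pow mulS, mulS_w, RingHom.map_mul act, RingHom.map_mul, map_sum act, map_sum]
  congr 1
  refine Finset.sum_congr rfl fun k _ => ?_
  rw [h, modMul_eq, RingHom.map_mul act (mulS _), RingHom.map_mul (modConjHom n ħ) (act (mulS _)),
    RingHom.map_pow act, RingHom.map_pow (modConjHom n ħ)]

theorem curveFactor_eq : curveFactor n ħ =
    modConjHom n ħ (act (1 - evalSeries 𝕜 (qS n ħ) (midSeries n ħ))) := by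
  have h : (2 : 𝕜)⁻¹ • (X * (ħ • X ^ (n + 1))) =
      mulS (w 𝕜 ^ (n + 1) * cst ħ * w 𝕜 * cst (2 : 𝕜)⁻¹) := by
    rw [show w 𝕜 ^ (n + 1) * cst ħ * w 𝕜 * cst (2 : 𝕜)⁻¹ =
      cst (2 : 𝕜)⁻¹ * (w 𝕜 * (cst ħ * w 𝕜 ^ (n + 1))) by ring, mulS_cst_mul,
      map_mul mulS (w 𝕜) (cst ħ * w 𝕜 ^ (n + 1)), mulS_cst_mul, map_pow mulS, mulS_w]
  rw [curveFactor, modMul_eq, modMul_eq, yHat_eq n hħ, evalSeries_midSeries, ← sub_sub, h,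
    mulS_w, ← RingHom.map_mul (modConjHom n ħ), ← RingHom.map_mul act]
  refine AddMonoidHom.ext fun (f : Space 𝕜) => ?_
  change f - act (X * qS n ħ) f - act (mulS _) f = act (_ - _ - _) f
  rw [act_sub_apply, act_sub_apply, map_one act]
  rfl

/-- After conjugation the operator of the curve is exp(-χP), whose fixed vectors are the kernel of
χP; neither w nor ħ is a zero divisor. -/
theorem satisfiesModifiedCurve_iff {R : PowerSeries (Polynomial 𝕜)} (hR : X ^ (n + 1) * R =
    bernoulliSeries n ħ - ∑ k ∈ Icc 1 n, (k : 𝕜)⁻¹ • wySeries 𝕜 ^ k) (f : Space 𝕜) :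
    SatisfiesModifiedCurve n ħ (toMod n ħ f) ↔ act (kacS n ħ R) f = 0 := by
  set g : Space 𝕜 := act (1 - evalSeries 𝕜 (qS n ħ) (midSeries n ħ)) f with hg
  have h1 : ∀ i : ℕ, (toMod n ħ).symm (modMul n ħ (cst (i.factorial : 𝕜)⁻¹)
      ((curveExponent n ħ ^ i) (curveFactor n ħ (toMod n ħ f)))) =
      cst (i.factorial : 𝕜)⁻¹ * act (curveS n ħ ^ i) g := fun i => by
    rw [curveExponent_eq n hħ, curveFactor_eq n hħ, ← RingHom.map_pow, ← RingHom.map_pow]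
    rfl
  have hX : X ∣ curveS n ħ - evalSeries 𝕜 (qS n ħ) (bernoulliSeries n ħ) := by
    rw [sub_eq_add_neg]
    exact dvd_add (X_dvd_curveS n ħ) (X_dvd_neg (X_dvd_extend _ (X_dvd_bernoulliSeries n ħ)))
  have h2 : act (pexp 𝕜 (curveS n ħ)) g =
      act (pexp 𝕜 (curveS n ħ - evalSeries 𝕜 (qS n ħ) (bernoulliSeries n ħ))) f := by
    rw [hg, ← act_mul_apply, ← pexp_sub_bernoulliSeries hħ
      (by rw [evalSeries_chiSeries]; exact qS_mul_curveS n hħ) (X_dvd_curveS n ħ)]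
  have h3 := formalHasSum_pexp (X_dvd_curveS n ħ) g
  have h4 : SatisfiesModifiedCurve n ħ (toMod n ħ f) ↔ act (pexp 𝕜 (curveS n ħ)) g = f := by
    unfold SatisfiesModifiedCurve
    simp only [h1]
    exact ⟨fun h => h3.unique h, fun h => by rw [← h] at *; exact h3⟩
  rw [h4, h2, act_pexp_eq_iff hX, X_pow_mul_kacS n hħ hR]
  have h5 : act (-(X ^ (n + 1) * (ħ • kacS n ħ R))) f =
      -(w 𝕜 ^ (n + 1) * (cst ħ * act (kacS n ħ R) f)) := by
    rw [act_neg_apply, act_mul_apply, act_X_pow, act_smul]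
  rw [h5, neg_eq_zero]
  constructor
  · intro h
    have h6 : cst ħ * act (kacS n ħ R) f = 0 :=
      (mul_eq_zero.mp h).resolve_left (pow_ne_zero _ X_ne_zero)
    linear_combination cst ħ⁻¹ * h6 - act (kacS n ħ R) f * cst_mul_cst_inv hħ
  · intro h
    rw [h, mul_zero, mul_zero]

end Curve

end

end DeformedGKM

theorem proposition4p14 {𝕜 : Type*} [Field 𝕜] [CharZero 𝕜] (n : ℕ) (hn : 1 ≤ n)
    (ħ : 𝕜) (hħ : ħ ≠ 0) :
    (∀ k, FormalHasSum (gkmTerm n ħ k) (gkmBasis n ħ k)) ∧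
    (∃! Ψ : Space 𝕜, IsWaveFunction (pointW n ħ) Ψ) ∧
    ∃ G : (Op 𝕜)ˣ,
      (∀ G' : (Op 𝕜)ˣ, IsSatoGroupElement (pointW n ħ) G' ↔ G' = G) ∧
      (∃ (F : LaurentSeries (Polynomial 𝕜)) (R : PowerSeries (Polynomial 𝕜)) (A : Op 𝕜),
        IsBernoulliSeries n ħ F ∧
        HahnSeries.ofPowerSeries ℤ (Polynomial 𝕜) R = F - logTerms 𝕜 n ∧
        IsValueAt R (Qtilde n ħ) A ∧
        canonicalP G = mulOp (cst ħ⁻¹) * (A - mulOp (potV' 𝕜 n))) ∧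
      (∀ Ψ : Space 𝕜, IsWaveFunction (pointW n ħ) Ψ →
        SatisfiesModifiedCurve n ħ (toMod n ħ Ψ)) ∧
      (∀ f : Space 𝕜, canonicalP G f = 0 ↔ SatisfiesModifiedCurve n ħ (toMod n ħ f)) := by
  have hΦ := zDegLE_coeff_gkmBasis n hħ
  obtain ⟨R, hR⟩ := exists_curveSeries n ħ
  obtain ⟨D, hD, hG, huniq⟩ := exists_isSatoGroupElement hΦ
  -- The two properties that characterise G ∂ G⁻¹: leading term ∂ modulo 𝒟₋, and stability of W.
  have hP : canonicalP (unitOfFilS hD) = act (kacS n ħ R) :=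
    canonicalP_eq_act hΦ hD hG (kacS_sub_dS_mem n hn hħ hR) (act_kacS_mem n hħ R)
  have hcurve : ∀ f : Space 𝕜, canonicalP (unitOfFilS hD) f = 0 ↔
      SatisfiesModifiedCurve n ħ (toMod n ħ f) := fun f => by
    rw [hP]; exact (satisfiesModifiedCurve_iff n hħ hR f).symm
  refine ⟨formalHasSum_gkmTerm n hħ, existsUnique_waveFunction hΦ, unitOfFilS hD, huniq,
    ⟨_, R, act (evalSeries 𝕜 (qS n ħ) R), isBernoulliSeries n hħ, ofPowerSeries_curveSeries n ħ hR,
      ?_, ?_⟩, fun Ψ hΨ => (hcurve Ψ).mp (canonicalP_waveFunction hΦ hD hG hΨ), hcurve⟩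
  · rw [← act_qS n hħ]
    exact isValueAt_evalSeries R (qS n ħ)
  · rw [hP]
    exact AddMonoidHom.ext fun f => act_kacS_apply n R f
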